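/- \textbf{Notation.} Let $\mathbb B=\{x\in\mathbb R^d:|x|\le 1\}$ and let $\widehat F(\xi)=\int_{\mathbb R^d}e^{-2\pi i x\cdot\xi}F(x)\,dx$. For $q>3$ let $K_q:\mathbb R^d\to\mathbb R$ be the continuous function with $\widehat{K_q}=|\widehat{1_{\mathbb B}}|^{q-2}\,\widehat{1_{\mathbb B}}$, i.e. the inverse Fourier transform of the integrable function $|\widehat{1_{\mathbb B}}|^{q-2}\,\widehat{1_{\mathbb B}}$; when $q\ge4$ is an even integer, $K_q>0$ on $\mathbb B$. For an even integer $\overline q\ge 4$ let $\mathcal H\subset L^2(\mathbb B)=L^2(\mathbb B;\mathbb R)$ be the finite-dimensional subspace of the functions $K_{\overline q}^{1/2}(x)\,(\alpha\cdot x+b)$ with $\alpha\in\mathbb R^d$, $b\in\mathbb R$, and let $P_{\mathcal H}$ be the orthogonal projection of $L^2(\mathbb B)$ onto $\mathcal H$. \textbf{Theorem.} Let $d\ge 1$ and let $\overline q\ge 4$ be an even integer. There exist constants $\delta_0,\rho,c,C>0$ and a function $\omega:\mathbb R\to\mathbb R$ with $\omega(t)\to\omega(0)=0$ as $t\to0$,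 all depending only on $d$ and $\overline q$, such that the following holds. Let $q\in(3,\infty)$ with $|q-\overline q|<\rho$, and let $f,g$ be real-valued measurable functions on $\mathbb B$ such that, almost everywhere on $\mathbb B$, $0\le f\le 1$ and $|g|\le \frac{5\pi}{4}$. If $\|f-1\|_{L^1(\mathbb B)}\le\delta_0$ and $\|g\|_{L^2(\mathbb B)}\le\delta_0$, then $\widehat{fe^{ig}1_{\mathbb B}}$ and $\widehat{1_{\mathbb B}}$ belong to $L^q(\mathbb R^d)$ and \begin{align*} \|\widehat{fe^{ig}1_{\mathbb B}}\|_q^q\le{}& \|\widehat{1_{\mathbb B}}\|_q^q-c\,\|(I-P_{\mathcal H})(K_{\overline q}^{1/2}g)\|_{L^2(\mathbb B)}^2+\omega(q-\overline q)\,\|g\|_{L^2(\mathbb B)}^2\\ &+C\,\|f-1\|_{L^1(\mathbb B)}\|g\|_{L^2(\mathbb B)}+C\left(\|f-1\|_{L^1(\mathbb B)}^2+\|g\|_{L^2(\mathbb B)}^{5/2}\right). \end{align*} -/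

import Mathlib

open MeasureTheory
open scoped FourierTransform ENNReal Topology

noncomputable section

namespace BallFourier

/-- The closed unit ball of `ℝ^d`. -/
def unitBall (d : ℕ) : Set (EuclideanSpace ℝ (Fin d)) := Metric.closedBall 0 1

/-- Lebesgue measure on the unit ball. -/
def ballMeasure (d : ℕ) : Measure (EuclideanSpace ℝ (Fin d)) := volume.restrict (unitBall d)

/-- The indicator function of the unit ball, as a complex-valued function on `ℝ^d`. -/
def ballIndicator (d : ℕ) : EuclideanSpace ℝ (Fin d) → ℂ := (unitBall d).indicator (fun _ => 1)

/-- The function `f e^{ig} 1_B` on `ℝ^d`. -/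
def modulated (d : ℕ) (f g : EuclideanSpace ℝ (Fin d) → ℝ) : EuclideanSpace ℝ (Fin d) → ℂ :=
  (unitBall d).indicator (fun x => (f x : ℂ) * Complex.exp (Complex.I * (g x : ℂ)))

/-- The function `|F|^{q-2} F` with `F` the Fourier transform of the indicator of the ball. -/
def kernelHat (d : ℕ) (q : ℝ) : EuclideanSpace ℝ (Fin d) → ℂ :=
  fun ξ => ((‖𝓕 (ballIndicator d) ξ‖ ^ (q - 2) : ℝ) : ℂ) * 𝓕 (ballIndicator d) ξ

/-- The kernel `K_q`, whose Fourier transform is `kernelHat d q`. The function `kernelHat d q` is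
real and even, so that its inverse Fourier transform is real; `re` only changes the codomain. -/
def kernel (d : ℕ) (q : ℝ) : EuclideanSpace ℝ (Fin d) → ℝ :=
  fun x => (𝓕⁻ (kernelHat d q) x).re

theorem continuous_kernel (d : ℕ) (q : ℝ) : Continuous (kernel d q) := by
  refine Complex.continuous_re.comp ?_
  by_cases h : Integrable (kernelHat d q)
  · have : Continuous (𝓕 (kernelHat d q)) :=
      VectorFourier.fourierIntegral_continuous Real.continuous_fourierChar
        (by exact continuous_inner) h
    have h2 : 𝓕⁻ (kernelHat d q) = fun x => 𝓕 (kernelHat d q) (-x) := by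
      funext x
      exact Real.fourierInv_eq_fourier_neg _ _
    rw [h2]
    exact this.comp continuous_neg
  · have h2 : 𝓕⁻ (kernelHat d q) = fun _ => 0 := by
      funext x
      rw [Real.fourierInv_eq_fourier_neg, Real.fourier_eq]
      apply integral_undef
      rwa [Real.fourierIntegral_convergent_iff]
    rw [h2]
    exact continuous_const

theorem memLp_sqrt_kernel_mul (d : ℕ) (q : ℝ) {g : EuclideanSpace ℝ (Fin d) → ℝ}
    (hg : MemLp g 2 (ballMeasure d)) :
    MemLp (fun x => √(kernel d q x) * g x) 2 (ballMeasure d) := by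
  have hc : Continuous fun x => √(kernel d q x) := (continuous_kernel d q).sqrt
  obtain ⟨C, hC⟩ := (isCompact_closedBall (0 : EuclideanSpace ℝ (Fin d)) 1).exists_bound_of_continuousOn
    hc.continuousOn
  have htop : MemLp (fun x => √(kernel d q x)) ∞ (ballMeasure d) :=
    memLp_top_of_bound hc.aestronglyMeasurable C
      ((ae_restrict_mem Metric.isClosed_closedBall.measurableSet).mono fun x hx => hC x hx)
  exact hg.mul htop

theorem memLp_affine (d : ℕ) (p : EuclideanSpace ℝ (Fin d) × ℝ) :
    MemLp (fun x => inner ℝ p.1 x + p.2) 2 (ballMeasure d) := by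
  have hc : Continuous fun x : EuclideanSpace ℝ (Fin d) => inner ℝ p.1 x + p.2 := by fun_prop
  obtain ⟨C, hC⟩ := (isCompact_closedBall (0 : EuclideanSpace ℝ (Fin d)) 1).exists_bound_of_continuousOn
    hc.continuousOn
  have : IsFiniteMeasure (ballMeasure d) :=
    ⟨by simpa [ballMeasure, unitBall] using measure_closedBall_lt_top⟩
  exact MemLp.of_bound hc.aestronglyMeasurable C
      ((ae_restrict_mem Metric.isClosed_closedBall.measurableSet).mono fun x hx => hC x hx)

/-- The product `K_q^{1/2} g` as an element of the real Hilbert space `L²(B)`. -/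
def weighted (d : ℕ) (q : ℝ) (g : EuclideanSpace ℝ (Fin d) → ℝ) (hg : MemLp g 2 (ballMeasure d)) :
    Lp ℝ 2 (ballMeasure d) :=
  (memLp_sqrt_kernel_mul d q hg).toLp _

/-- The linear map sending `(a, b)` to `K_q^{1/2} (a · x + b)` in `L²(B)`. -/
def weightedAffine (d : ℕ) (q : ℝ) :
    (EuclideanSpace ℝ (Fin d) × ℝ) →ₗ[ℝ] Lp ℝ 2 (ballMeasure d) where
  toFun p := weighted d q (fun x => inner ℝ p.1 x + p.2) (memLp_affine d p)
  map_add' p r := by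
    rw [weighted, weighted, weighted, ← MemLp.toLp_add]
    congr 1
    funext x
    simp only [Prod.fst_add, Prod.snd_add, inner_add_left, Pi.add_apply]
    ring
  map_smul' c p := by
    rw [weighted, weighted, RingHom.id_apply, ← MemLp.toLp_const_smul]
    congr 1
    funext x
    simp only [Prod.smul_fst, Prod.smul_snd, real_inner_smul_left, Pi.smul_apply, smul_eq_mul]
    ring

/-- The subspace `H` of `L²(B)` of the functions `K_q^{1/2} (a · x + b)`. -/
def affineSubspace (d : ℕ) (q : ℝ) : Submodule ℝ (Lp ℝ 2 (ballMeasure d)) :=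
  LinearMap.range (weightedAffine d q)

instance finiteDimensional_affineSubspace (d : ℕ) (q : ℝ) : FiniteDimensional ℝ (affineSubspace d q) :=
  inferInstanceAs (FiniteDimensional ℝ (LinearMap.range (weightedAffine d q)))

end BallFourier

end

noncomputable section

open Filter ProbabilityTheory

namespace BallFourier

/-!
Write `f e^{ig} = 1 + u` on the ball. Taylor's formula for `z ↦ |z| ^ q` on the Fourier side bounds
`‖𝓕 (1 + u)‖_q ^ q` by its second-order expansion at `1` plus a multiple of `‖u‖_1 ‖u‖_2 ^ 2`. To
second order `u` is `(f - 1) + i g - g² / 2`. The part `f - 1` decreases the norm, by positivity of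
`K_q`. At an even exponent `q = 2 n` the second variation in the direction `i g` is, up to a factor,
minus the integral of `(g(z_1) + ⋯ + g(z_n) - g(-z_{n+1}) - ⋯ - g(-z_{2n}))²` over the points of
`B ^ (2 n)` with `∑ z_j = 0`. This integral vanishes only if `g` is, up to a constant, additive near
the origin, that is for affine `g`, and weak compactness turns this into a spectral gap.

The expansion is useful only where `g` is small, so `g` is truncated at a level `η`; where `|g| > η`
the gain `1 - cos g`, which is at least a multiple of `g²` since `|g| ≤ 5π/4 < 2π`, pays for the
truncation. Exponents near `2 n` differ from `2 n` by a multiple of `|q - 2 n| ‖g‖_2 ^ 2`.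
-/

section Fourier

variable {V : Type*} [NormedAddCommGroup V] [InnerProductSpace ℝ V] [FiniteDimensional ℝ V]
  [MeasurableSpace V] [BorelSpace V]

theorem continuous_fourier {u : V → ℂ} (hu : Integrable u) : Continuous (𝓕 u) :=
  VectorFourier.fourierIntegral_continuous Real.continuous_fourierChar
    (by exact continuous_inner) hu

theorem norm_fourier_le (u : V → ℂ) (ξ : V) : ‖𝓕 u ξ‖ ≤ ∫ x, ‖u x‖ :=
  VectorFourier.norm_fourierIntegral_le_integral_norm _ _ _ u ξ

theorem continuous_fourierInv {u : V → ℂ} (hu : Integrable u) : Continuous (𝓕⁻ u) := by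
  simpa only [Real.fourierInv_eq_fourier_comp_neg] using continuous_fourier hu.comp_neg

theorem norm_fourierInv_le (u : V → ℂ) (x : V) : ‖𝓕⁻ u x‖ ≤ ∫ ξ, ‖u ξ‖ := by
  rw [Real.fourierInv_eq_fourier_neg]
  exact norm_fourier_le u (-x)

theorem integral_fourier_mul_eq {u v : V → ℂ} (hu : Integrable u) (hv : Integrable v) :
    ∫ ξ, 𝓕 u ξ * v ξ = ∫ x, u x * 𝓕 v x := by
  have hflip := VectorFourier.integral_fourierIntegral_smul_eq_flip (L := innerₗ V)
    Real.continuous_fourierChar (by exact continuous_inner) hu hv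
  rwa [flip_innerₗ] at hflip

/- Both sides define the same tempered distribution. -/
theorem fourier_toLp_ae_eq {u : V → ℂ} (hu : Integrable u) (hu2 : MemLp u 2) :
    (𝓕 (hu2.toLp u) : Lp ℂ 2 (volume : Measure V)) =ᵐ[volume] 𝓕 u := by
  refine ae_eq_of_integral_contDiff_smul_eq
    ((Lp.memLp _).locallyIntegrable (by norm_num)) (continuous_fourier hu).locallyIntegrable ?_
  intro φ hφ hφc
  set Φ : SchwartzMap V ℂ :=
    (hφc.comp_left (g := fun r : ℝ => (r : ℂ)) (by simp)).toSchwartzMap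
      (Complex.ofRealCLM.contDiff.comp hφ)
  have hdistr := congrArg (fun T => T Φ) (Lp.fourier_toTemperedDistribution_eq (hu2.toLp u))
  simp only [TemperedDistribution.fourier_apply, Lp.toTemperedDistribution_apply] at hdistr
  have hrepr : ∫ x, (𝓕 Φ) x • (hu2.toLp u) x = ∫ x, u x * 𝓕 (fun y => Φ y) x := by
    refine integral_congr_ae ?_
    filter_upwards [hu2.coeFn_toLp] with x hx
    rw [hx, smul_eq_mul, mul_comm]
    rfl
  rw [hrepr, ← integral_fourier_mul_eq hu Φ.integrable] at hdistr
  have hsmul : ∀ x (z : ℂ), φ x • z = Φ x * z := fun x z => Complex.real_smul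
  simp only [hsmul]
  simpa only [smul_eq_mul, mul_comm] using hdistr.symm

theorem memLp_two_fourier {u : V → ℂ} (hu : Integrable u) (hu2 : MemLp u 2) :
    MemLp (𝓕 u) 2 :=
  (memLp_congr_ae (fourier_toLp_ae_eq hu hu2)).1 (Lp.memLp _)

theorem integral_fourier_mul_conj_fourier {u v : V → ℂ} (hu : Integrable u) (hu2 : MemLp u 2)
    (hv : Integrable v) (hv2 : MemLp v 2) :
    ∫ ξ, 𝓕 u ξ * starRingEnd ℂ (𝓕 v ξ) = ∫ x, u x * starRingEnd ℂ (v x) := by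
  calc ∫ ξ, 𝓕 u ξ * starRingEnd ℂ (𝓕 v ξ)
      = inner ℂ (𝓕 (hv2.toLp v)) (𝓕 (hu2.toLp u)) := by
        rw [L2.inner_def]
        refine integral_congr_ae ?_
        filter_upwards [fourier_toLp_ae_eq hu hu2, fourier_toLp_ae_eq hv hv2] with ξ hξu hξv
        simp [hξu, hξv]
    _ = inner ℂ (hv2.toLp v) (hu2.toLp u) := Lp.inner_fourier_eq _ _
    _ = ∫ x, u x * starRingEnd ℂ (v x) := by
        rw [L2.inner_def]
        refine integral_congr_ae ?_
        filter_upwards [hu2.coeFn_toLp, hv2.coeFn_toLp] with x hxu hxv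
        simp [hxu, hxv]

theorem integral_norm_sq_fourier {u : V → ℂ} (hu : Integrable u) (hu2 : MemLp u 2) :
    ∫ ξ, ‖𝓕 u ξ‖ ^ 2 = ∫ x, ‖u x‖ ^ 2 := by
  have h := integral_fourier_mul_conj_fourier hu hu2 hu hu2
  simp only [Complex.mul_conj'] at h
  exact_mod_cast h

theorem fourierInv_sub_eq_fourier (N : V → ℂ) (s z : V) :
    𝓕⁻ N (s - z) = 𝓕 (fun ξ => Real.fourierChar (inner ℝ ξ s) • N ξ) z := by
  simp only [Real.fourierInv_eq, Real.fourier_eq, smul_smul, ← AddChar.map_add_eq_mul,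
    inner_sub_right, neg_add_eq_sub]

theorem integral_mul_fourierInv_sub {N u : V → ℂ} (hN : Integrable N) (hu : Integrable u)
    (s : V) : ∫ z, u z * 𝓕⁻ N (s - z) = 𝓕⁻ (fun ξ => N ξ * 𝓕 u ξ) s := by
  have hNs : Integrable fun ξ => Real.fourierChar (inner ℝ ξ s) • N ξ := by
    simpa using (Real.fourierIntegral_convergent_iff (-s)).2 hN
  simp only [fourierInv_sub_eq_fourier N s]
  rw [← integral_fourier_mul_eq hu hNs, Real.fourierInv_eq]
  simp only [Circle.smul_def, smul_eq_mul]
  congr! 2 with ξ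
  ring

theorem conj_fourier_conj_comp_sub (v : V → ℂ) (s ξ : V) :
    starRingEnd ℂ (𝓕 (fun x => starRingEnd ℂ (v (s - x))) ξ)
      = Real.fourierChar (inner ℝ ξ s) • 𝓕 v ξ := by
  rw [Real.fourier_eq, ← integral_conj, ← integral_sub_left_eq_self _ volume s, Real.fourier_eq,
    Circle.smul_def, smul_eq_mul, ← integral_const_mul]
  congr! 2 with x
  simp only [sub_sub_cancel, Circle.smul_def, smul_eq_mul, map_mul, Complex.conj_conj,
    ← Circle.coe_inv_eq_conj, ← AddChar.map_neg_eq_inv, ← mul_assoc, ← Circle.coe_mul,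
    ← AddChar.map_add_eq_mul, inner_sub_left, real_inner_comm s ξ, neg_neg, ← sub_eq_add_neg]

/- Not a special case of `integral_mul_fourierInv_sub`: for `v` in `L¹ ∩ L²` the Fourier transform
need not be integrable, and the proof goes through Plancherel's theorem instead. -/
theorem integral_mul_comp_sub {u v : V → ℂ} (hu : Integrable u) (hu2 : MemLp u 2)
    (hv : Integrable v) (hv2 : MemLp v 2) (s : V) :
    ∫ z, u z * v (s - z) = 𝓕⁻ (fun ξ => 𝓕 u ξ * 𝓕 v ξ) s := by
  have hmp : MeasurePreserving (fun x : V => s - x) := Measure.measurePreserving_sub_left volume s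
  have h := integral_fourier_mul_conj_fourier hu hu2
    (Complex.conjCLE.toContinuousLinearMap.integrable_comp (hmp.integrable_comp_of_integrable hv))
    ((hv2.comp_measurePreserving hmp).star)
  have hleft : ∫ z, u z * v (s - z)
      = ∫ z, u z * starRingEnd ℂ (starRingEnd ℂ (v (s - z))) := by
    simp only [Complex.conj_conj]
  rw [hleft, Real.fourierInv_eq]
  refine h.symm.trans ?_
  congr! 2 with ξ
  refine (congrArg (𝓕 u ξ * ·) (conj_fourier_conj_comp_sub v s ξ)).trans ?_
  simp only [Circle.smul_def, smul_eq_mul]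
  ring

/-- The real part of the inverse Fourier transform; it is used for symbols whose inverse Fourier
transform is real. -/
def rinv (N : V → ℂ) (s : V) : ℝ := (𝓕⁻ N s).re

theorem continuous_rinv {N : V → ℂ} (hN : Integrable N) : Continuous (rinv N) :=
  Complex.continuous_re.comp (continuous_fourierInv hN)

theorem abs_rinv_le (N : V → ℂ) (s : V) : |rinv N s| ≤ ∫ ξ, ‖N ξ‖ :=
  (Complex.abs_re_le_norm _).trans (norm_fourierInv_le N s)

theorem rinv_add {N N' : V → ℂ} (hN : Integrable N) (hN' : Integrable N') (s : V) :
    rinv (fun ξ => N ξ + N' ξ) s = rinv N s + rinv N' s := by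
  simp only [rinv, Real.fourierInv_eq_fourier_neg, Real.fourier_eq, smul_add]
  rw [integral_add ((Real.fourierIntegral_convergent_iff _).2 hN)
    ((Real.fourierIntegral_convergent_iff _).2 hN'), Complex.add_re]

theorem rinv_const_mul (c : ℝ) (N : V → ℂ) (s : V) :
    rinv (fun ξ => c * N ξ) s = c * rinv N s := by
  simp only [rinv, Real.fourierInv_eq, Circle.smul_def, smul_eq_mul]
  rw [← Complex.re_ofReal_mul, ← integral_const_mul]
  simp only [mul_left_comm]

theorem rinv_sum {ι : Type*} {N : ι → V → ℂ} (hN : ∀ i, Integrable (N i)) (t : Finset ι) (s : V) :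
    rinv (fun ξ => ∑ i ∈ t, N i ξ) s = ∑ i ∈ t, rinv (N i) s := by
  simp only [rinv, Real.fourierInv_eq_fourier_neg, Real.fourier_eq, Finset.smul_sum]
  rw [integral_finsetSum _ fun i _ => (Real.fourierIntegral_convergent_iff _).2 (hN i),
    Complex.re_sum]

end Fourier

variable {d : ℕ}

/-- The Euclidean space `ℝ^d`. -/
abbrev Space (d : ℕ) := EuclideanSpace ℝ (Fin d)

instance isFiniteMeasure_ballMeasure : IsFiniteMeasure (ballMeasure d) :=
  ⟨by simpa [ballMeasure, unitBall] using measure_closedBall_lt_top⟩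

theorem measurableSet_unitBall : MeasurableSet (unitBall d) :=
  Metric.isClosed_closedBall.measurableSet

theorem neg_mem_unitBall {x : Space d} : -x ∈ unitBall d ↔ x ∈ unitBall d := by
  simp [unitBall]

theorem measurePreserving_neg_ballMeasure :
    MeasurePreserving (fun x : Space d => -x) (ballMeasure d) (ballMeasure d) := by
  have h := (Measure.measurePreserving_neg (volume : Measure (Space d))).restrict_preimage
    (measurableSet_unitBall (d := d))
  rwa [show Neg.neg ⁻¹' unitBall d = unitBall d from Set.ext fun _ => neg_mem_unitBall] at h

theorem integral_comp_neg_ballMeasure {G : Type*} [NormedAddCommGroup G] [NormedSpace ℝ G]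
    (u : Space d → G) :
    ∫ x, u (-x) ∂(ballMeasure d) = ∫ x, u x ∂(ballMeasure d) :=
  measurePreserving_neg_ballMeasure.integral_comp (MeasurableEquiv.neg _).measurableEmbedding u

theorem integral_indicator_unitBall {E G : Type*} [Zero E] [NormedAddCommGroup G]
    [NormedSpace ℝ G] {Φ : Space d → E → G} (hΦ : ∀ x, Φ x 0 = 0) (u : Space d → E) :
    ∫ x, Φ x ((unitBall d).indicator u x) = ∫ x, Φ x (u x) ∂(ballMeasure d) := by
  rw [ballMeasure, ← integral_indicator measurableSet_unitBall]
  congr 1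
  funext x
  by_cases hx : x ∈ unitBall d <;> simp [hx, hΦ]

theorem integrable_indicator_unitBall {u : Space d → ℂ} (hu : Integrable u (ballMeasure d)) :
    Integrable ((unitBall d).indicator u) :=
  (integrable_indicator_iff measurableSet_unitBall).2 hu

theorem memLp_indicator_unitBall {u : Space d → ℂ} {p : ℝ≥0∞} (hu : MemLp u p (ballMeasure d)) :
    MemLp ((unitBall d).indicator u) p :=
  (memLp_indicator_iff_restrict measurableSet_unitBall).2 hu

/-- The Fourier transform of the extension by zero of a function on the unit ball. -/
def hat (u : Space d → ℂ) : Space d → ℂ := 𝓕 ((unitBall d).indicator u)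

theorem hat_apply (u : Space d → ℂ) (ξ : Space d) :
    hat u ξ = ∫ x, Real.fourierChar (-inner ℝ x ξ) • u x ∂(ballMeasure d) := by
  rw [hat, Real.fourier_eq,
    integral_indicator_unitBall (Φ := fun x z => Real.fourierChar (-inner ℝ x ξ) • z)
      fun _ => smul_zero _]

theorem hat_congr_ae {u v : Space d → ℂ} (h : u =ᵐ[ballMeasure d] v) : hat u = hat v := by
  funext ξ
  simp only [hat_apply]
  exact integral_congr_ae (h.mono fun x hx => congrArg (Real.fourierChar (-inner ℝ x ξ) • ·) hx)

theorem hat_add {u v : Space d → ℂ} (hu : Integrable u (ballMeasure d))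
    (hv : Integrable v (ballMeasure d)) (ξ : Space d) :
    hat (fun x => u x + v x) ξ = hat u ξ + hat v ξ := by
  simp only [hat_apply, smul_add]
  exact integral_add ((Real.fourierIntegral_convergent_iff ξ).2 hu)
    ((Real.fourierIntegral_convergent_iff ξ).2 hv)

theorem hat_const_mul (c : ℂ) (u : Space d → ℂ) (ξ : Space d) :
    hat (fun x => c * u x) ξ = c * hat u ξ := by
  simp only [hat_apply, Circle.smul_def, smul_eq_mul, mul_left_comm _ c, integral_const_mul]

theorem continuous_hat {u : Space d → ℂ} (hu : Integrable u (ballMeasure d)) :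
    Continuous (hat u) :=
  continuous_fourier (integrable_indicator_unitBall hu)

theorem norm_hat_le (u : Space d → ℂ) (ξ : Space d) :
    ‖hat u ξ‖ ≤ ∫ x, ‖u x‖ ∂(ballMeasure d) := by
  rw [hat_apply]
  refine (norm_integral_le_integral_norm _).trans_eq ?_
  simp only [Circle.norm_smul]

theorem memLp_hat {u : Space d → ℂ} (hu : MemLp u 2 (ballMeasure d)) : MemLp (hat u) 2 :=
  memLp_two_fourier (integrable_indicator_unitBall (hu.integrable one_le_two))
    (memLp_indicator_unitBall hu)

theorem integral_norm_sq_hat {u : Space d → ℂ} (hu : MemLp u 2 (ballMeasure d)) :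
    ∫ ξ, ‖hat u ξ‖ ^ 2 = ∫ x, ‖u x‖ ^ 2 ∂(ballMeasure d) :=
  (integral_norm_sq_fourier (integrable_indicator_unitBall (hu.integrable one_le_two))
    (memLp_indicator_unitBall hu)).trans
    (integral_indicator_unitBall (Φ := fun _ z => ‖z‖ ^ 2) (by simp) u)

/-- The Fourier transform of the extension by zero of a real function on the unit ball. -/
def rhat (h : Space d → ℝ) : Space d → ℂ := hat fun x => (h x : ℂ)

theorem rhat_add {g h : Space d → ℝ} (hg : Integrable g (ballMeasure d))
    (hh : Integrable h (ballMeasure d)) (ξ : Space d) :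
    rhat (fun x => g x + h x) ξ = rhat g ξ + rhat h ξ := by
  simpa [rhat] using hat_add hg.ofReal hh.ofReal ξ

theorem rhat_const_mul (c : ℝ) (h : Space d → ℝ) (ξ : Space d) :
    rhat (fun x => c * h x) ξ = c * rhat h ξ := by
  simpa [rhat] using hat_const_mul (c : ℂ) (fun x => (h x : ℂ)) ξ

theorem rhat_congr_ae {g h : Space d → ℝ} (hgh : g =ᵐ[ballMeasure d] h) : rhat g = rhat h :=
  hat_congr_ae (hgh.mono fun _ hx => congrArg Complex.ofReal hx)

theorem continuous_rhat {h : Space d → ℝ} (hh : Integrable h (ballMeasure d)) :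
    Continuous (rhat h) := continuous_hat hh.ofReal

theorem norm_rhat_le (h : Space d → ℝ) (ξ : Space d) :
    ‖rhat h ξ‖ ≤ ∫ x, |h x| ∂(ballMeasure d) := by
  simpa [rhat] using norm_hat_le (fun x => (h x : ℂ)) ξ

theorem memLp_rhat {h : Space d → ℝ} (hh : MemLp h 2 (ballMeasure d)) : MemLp (rhat h) 2 :=
  memLp_hat hh.ofReal

theorem conj_rhat (h : Space d → ℝ) (ξ : Space d) :
    starRingEnd ℂ (rhat h ξ) = rhat (fun x => h (-x)) ξ := by
  rw [rhat, rhat, hat_apply, hat_apply, ← integral_conj, ← integral_comp_neg_ballMeasure]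
  congr! 2
  simp [Circle.smul_def, ← Circle.coe_inv_eq_conj, AddChar.map_neg_eq_inv]

/-- The Fourier transform of the indicator of the ball. -/
def ballHat (d : ℕ) : Space d → ℂ := 𝓕 (ballIndicator d)

theorem rhat_one : rhat (fun _ : Space d => 1) = ballHat d := by
  simp [rhat, hat, ballHat, ballIndicator]

theorem ballHat_re (ξ : Space d) : ((ballHat d ξ).re : ℂ) = ballHat d ξ :=
  Complex.conj_eq_iff_re.1 (by rw [← rhat_one, conj_rhat])

theorem continuous_ballHat : Continuous (ballHat d) := by
  rw [← rhat_one]; exact continuous_rhat (integrable_const _)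

theorem memLp_ballHat : MemLp (ballHat d) 2 := by
  rw [← rhat_one]; exact memLp_rhat (memLp_const _)

/-- The volume of the unit ball, which is also the maximum of `|ballHat d|`. -/
def ballVol (d : ℕ) : ℝ := (ballMeasure d).real Set.univ

theorem ballVol_nonneg : 0 ≤ ballVol d := measureReal_nonneg

theorem norm_ballHat_le (ξ : Space d) : ‖ballHat d ξ‖ ≤ ballVol d := by
  rw [← rhat_one]; simpa [ballVol] using norm_rhat_le (fun _ => 1) ξ

theorem integrable_mul_rhat {N : Space d → ℂ} (hN : Integrable N) {h : Space d → ℝ}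
    (hh : Integrable h (ballMeasure d)) : Integrable (fun ξ => N ξ * rhat h ξ) :=
  hN.mul_bdd (continuous_rhat hh).aestronglyMeasurable (.of_forall fun ξ => norm_rhat_le h ξ)

theorem integrable_mul_ballHat {N : Space d → ℂ} (hN : Integrable N) :
    Integrable (fun ξ => N ξ * ballHat d ξ) := by
  simpa only [rhat_one] using integrable_mul_rhat hN (integrable_const (1 : ℝ))

theorem integrable_mul_ballHat_pow {N : Space d → ℂ} (hN : Integrable N) (n : ℕ) :
    Integrable (fun ξ => N ξ * ballHat d ξ ^ n) := by
  induction n with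
  | zero => simpa using hN
  | succ n ih => simpa only [pow_succ, ← mul_assoc] using integrable_mul_ballHat ih

theorem integral_mul_rinv {N : Space d → ℂ} (hN : Integrable N) {χ : Space d → ℝ}
    (hχ : Integrable χ (ballMeasure d)) (s : Space d) :
    ∫ z, χ z * rinv N (s - z) ∂(ballMeasure d) = rinv (fun ξ => N ξ * rhat χ ξ) s := by
  have hχc : Integrable (fun z => (χ z : ℂ)) (ballMeasure d) := hχ.ofReal
  have hint : Integrable (fun z => (χ z : ℂ) * 𝓕⁻ N (s - z)) (ballMeasure d) :=
    hχc.mul_bdd ((continuous_fourierInv hN).comp (continuous_sub_left s)).aestronglyMeasurable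
      (.of_forall fun z => norm_fourierInv_le N (s - z))
  rw [rinv, rhat]
  unfold hat
  rw [← integral_mul_fourierInv_sub hN (integrable_indicator_unitBall hχc),
    integral_indicator_unitBall (Φ := fun z w => w * 𝓕⁻ N (s - z)) fun _ => zero_mul _]
  refine Eq.trans ?_ (integral_re hint)
  simp only [rinv, RCLike.re_eq_complex_re, Complex.re_ofReal_mul]

theorem integrable_mul_rinv {N : Space d → ℂ} (hN : Integrable N) {χ : Space d → ℝ}
    (hχ : Integrable χ (ballMeasure d)) (s : Space d) :
    Integrable (fun z => χ z * rinv N (s - z)) (ballMeasure d) :=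
  hχ.mul_bdd ((continuous_rinv hN).comp (continuous_sub_left s)).aestronglyMeasurable
    (.of_forall fun z => abs_rinv_le N (s - z))

theorem integral_mul_indicator_sub {u v : Space d → ℝ} (hu : MemLp u 2 (ballMeasure d))
    (hv : MemLp v 2 (ballMeasure d)) (s : Space d) :
    ∫ z, u z * (unitBall d).indicator v (s - z) ∂(ballMeasure d)
      = rinv (fun ξ => rhat u ξ * rhat v ξ) s := by
  have huc : MemLp (fun x => (u x : ℂ)) 2 (ballMeasure d) := hu.ofReal
  have hvc : MemLp (fun x => (v x : ℂ)) 2 (ballMeasure d) := hv.ofReal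
  have hconv := integral_mul_comp_sub
    (integrable_indicator_unitBall (huc.integrable one_le_two)) (memLp_indicator_unitBall huc)
    (integrable_indicator_unitBall (hvc.integrable one_le_two)) (memLp_indicator_unitBall hvc) s
  rw [integral_indicator_unitBall
    (Φ := fun z w => w * (unitBall d).indicator (fun x => (v x : ℂ)) (s - z))
    fun _ => zero_mul _] at hconv
  refine Eq.trans ?_ (congrArg Complex.re hconv)
  rw [← Complex.ofReal_re (∫ z, u z * (unitBall d).indicator v (s - z) ∂(ballMeasure d)),
    ← integral_complex_ofReal]
  congr! 3 with z
  by_cases hz : s - z ∈ unitBall d <;> simp [hz]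

theorem integrable_mul_indicator_sub {u v : Space d → ℝ} (hu : MemLp u 2 (ballMeasure d))
    (hv : MemLp v 2 (ballMeasure d)) (s : Space d) :
    Integrable (fun z => u z * (unitBall d).indicator v (s - z)) (ballMeasure d) :=
  hu.integrable_mul <| (((memLp_indicator_iff_restrict measurableSet_unitBall).2
    hv).comp_measurePreserving (Measure.measurePreserving_sub_left volume s)).restrict _

theorem memLp_sq_of_top {g : Space d → ℝ} (hg : MemLp g ∞ (ballMeasure d)) :
    MemLp (fun x => g x ^ 2) ∞ (ballMeasure d) := by
  simp only [pow_two]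
  exact hg.mul hg

theorem memLp_two_of_top {g : Space d → ℝ} (hg : MemLp g ∞ (ballMeasure d)) :
    MemLp g 2 (ballMeasure d) := hg.mono_exponent le_top

theorem integrable_rhat_mul_rhat {g h : Space d → ℝ} (hg : MemLp g 2 (ballMeasure d))
    (hh : MemLp h 2 (ballMeasure d)) : Integrable (fun ξ => rhat g ξ * rhat h ξ) :=
  (memLp_rhat hg).integrable_mul (memLp_rhat hh)

theorem integrable_rhat_mul_ballHat_pow {g : Space d → ℝ} (hg : MemLp g 2 (ballMeasure d))
    (n : ℕ) : Integrable (fun ξ => rhat g ξ * ballHat d ξ ^ (n + 1)) := by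
  simpa only [pow_succ', ← mul_assoc, rhat_one] using
    integrable_mul_ballHat_pow (integrable_rhat_mul_rhat hg (memLp_const 1)) n

theorem integrable_ballHat_pow (n : ℕ) : Integrable (fun ξ => ballHat d ξ ^ (n + 2)) := by
  simpa only [rhat_one, pow_succ' _ (n + 1)] using
    integrable_rhat_mul_ballHat_pow (d := d) (g := fun _ => 1) (memLp_const _) n

section QuadInv

variable {A B C : Space d → ℂ}

/-- The quadratic polynomial in `t` whose coefficients are the inverse Fourier transforms of
`A`, `2 B` and `C`. Integrals of `(t + ∑ h_j(z_j))²` over a fibre `{∑ z_j = s}` have this form. -/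
def quadInv (A B C : Space d → ℂ) (t : ℝ) (s : Space d) : ℝ :=
  t ^ 2 * rinv A s + 2 * t * rinv B s + rinv C s

theorem integrable_quadInv_shift (hA : Integrable A) (hB : Integrable B) (hC : Integrable C)
    {χ : Space d → ℝ} (hχ : MemLp χ 2 (ballMeasure d)) (s : Space d) :
    Integrable (fun z => quadInv A B C (χ z) (s - z)) (ballMeasure d) := by
  refine ((integrable_mul_rinv hA hχ.integrable_sq s).add
    (integrable_mul_rinv hB ((hχ.integrable one_le_two).const_mul 2) s)).add ?_
  simpa only [one_mul] using integrable_mul_rinv hC (integrable_const (1 : ℝ)) s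

theorem integral_quadInv_shift (hA : Integrable A) (hB : Integrable B) (hC : Integrable C)
    {χ : Space d → ℝ} (hχ : MemLp χ 2 (ballMeasure d)) (t : ℝ) (s : Space d) :
    ∫ z, quadInv A B C (t + χ z) (s - z) ∂(ballMeasure d)
      = quadInv (fun ξ => A ξ * ballHat d ξ) (fun ξ => B ξ * ballHat d ξ + A ξ * rhat χ ξ)
          (fun ξ => C ξ * ballHat d ξ
            + ((2 : ℝ) * (B ξ * rhat χ ξ) + A ξ * rhat (fun x => χ x ^ 2) ξ)) t s := by
  have hχ1 : Integrable χ (ballMeasure d) := hχ.integrable one_le_two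
  have hone : Integrable (fun _ : Space d => (1 : ℝ)) (ballMeasure d) := integrable_const 1
  have hint {N : Space d → ℂ} (hN : Integrable N) {u : Space d → ℝ}
      (hu : Integrable u (ballMeasure d)) (c : ℝ) :
      Integrable (fun z => c * (u z * rinv N (s - z))) (ballMeasure d) :=
    (integrable_mul_rinv hN hu s).const_mul c
  have hval {N : Space d → ℂ} (hN : Integrable N) {u : Space d → ℝ}
      (hu : Integrable u (ballMeasure d)) (c : ℝ) :
      ∫ z, c * (u z * rinv N (s - z)) ∂(ballMeasure d) = c * rinv (fun ξ => N ξ * rhat u ξ) s := by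
    rw [integral_const_mul, integral_mul_rinv hN hu]
  have hAt := (hint hA hone (t ^ 2)).fun_add (hint hA hχ1 (2 * t))
  have hAB := (hAt.fun_add (hint hA hχ.integrable_sq 1)).fun_add (hint hB hone (2 * t))
  calc ∫ z, quadInv A B C (t + χ z) (s - z) ∂(ballMeasure d)
      = ∫ z, t ^ 2 * (1 * rinv A (s - z)) + 2 * t * (χ z * rinv A (s - z))
          + 1 * (χ z ^ 2 * rinv A (s - z)) + 2 * t * (1 * rinv B (s - z))
          + 2 * (χ z * rinv B (s - z)) + 1 * (1 * rinv C (s - z)) ∂(ballMeasure d) := by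
        refine integral_congr_ae (.of_forall fun z => ?_)
        simp only [quadInv]
        ring
    _ = _ := by
        rw [integral_add (hAB.fun_add (hint hB hχ1 2)) (hint hC hone 1),
          integral_add hAB (hint hB hχ1 2),
          integral_add (hAt.fun_add (hint hA hχ.integrable_sq 1)) (hint hB hone (2 * t)),
          integral_add hAt (hint hA hχ.integrable_sq 1),
          integral_add (hint hA hone (t ^ 2)) (hint hA hχ1 (2 * t))]
        rw [hval hA hone, hval hA hχ1, hval hA hχ.integrable_sq, hval hB hone, hval hB hχ1,
          hval hC hone, rhat_one]
        rw [quadInv, rinv_add (integrable_mul_ballHat hB) (integrable_mul_rhat hA hχ1),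
          rinv_add (integrable_mul_ballHat hC) (((integrable_mul_rhat hB hχ1).const_mul _).fun_add
            (integrable_mul_rhat hA hχ.integrable_sq)),
          rinv_add ((integrable_mul_rhat hB hχ1).const_mul _)
            (integrable_mul_rhat hA hχ.integrable_sq), rinv_const_mul]
        ring

theorem integral_sq_add_indicator_sub {p r : Space d → ℝ} (hp : MemLp p ∞ (ballMeasure d))
    (hr : MemLp r ∞ (ballMeasure d)) (t : ℝ) (s : Space d) :
    ∫ z, (unitBall d).indicator (fun y => (t + p z + r y) ^ 2) (s - z) ∂(ballMeasure d)
      = quadInv (fun ξ => ballHat d ξ * ballHat d ξ)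
          (fun ξ => rhat p ξ * ballHat d ξ + ballHat d ξ * rhat r ξ)
          (fun ξ => rhat (fun x => p x ^ 2) ξ * ballHat d ξ
            + ((2 : ℝ) * (rhat p ξ * rhat r ξ) + ballHat d ξ * rhat (fun x => r x ^ 2) ξ)) t s := by
  have hone : MemLp (fun _ : Space d => (1 : ℝ)) 2 (ballMeasure d) := memLp_const 1
  have hp' := memLp_two_of_top hp
  have hr' := memLp_two_of_top hr
  have hpp := memLp_two_of_top (memLp_sq_of_top hp)
  have hrr := memLp_two_of_top (memLp_sq_of_top hr)
  have hint {u v : Space d → ℝ} (hu : MemLp u 2 (ballMeasure d)) (hv : MemLp v 2 (ballMeasure d))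
      (c : ℝ) : Integrable (fun z => c * (u z * (unitBall d).indicator v (s - z)))
        (ballMeasure d) :=
    (integrable_mul_indicator_sub hu hv s).const_mul c
  have hval {u v : Space d → ℝ} (hu : MemLp u 2 (ballMeasure d)) (hv : MemLp v 2 (ballMeasure d))
      (c : ℝ) : ∫ z, c * (u z * (unitBall d).indicator v (s - z)) ∂(ballMeasure d)
        = c * rinv (fun ξ => rhat u ξ * rhat v ξ) s := by
    rw [integral_const_mul, integral_mul_indicator_sub hu hv]
  have hmul {u v : Space d → ℝ} := integrable_rhat_mul_rhat (d := d) (g := u) (h := v)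
  have hleft := (hint hone hone (t ^ 2)).fun_add (hint hp' hone (2 * t))
  have hmid := (hleft.fun_add (hint hone hr' (2 * t))).fun_add (hint hpp hone 1)
  calc ∫ z, (unitBall d).indicator (fun y => (t + p z + r y) ^ 2) (s - z) ∂(ballMeasure d)
      = ∫ z, t ^ 2 * (1 * (unitBall d).indicator (fun _ => 1) (s - z))
          + 2 * t * (p z * (unitBall d).indicator (fun _ => 1) (s - z))
          + 2 * t * (1 * (unitBall d).indicator r (s - z))
          + 1 * (p z ^ 2 * (unitBall d).indicator (fun _ => 1) (s - z))
          + 2 * (p z * (unitBall d).indicator r (s - z))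
          + 1 * (1 * (unitBall d).indicator (fun x => r x ^ 2) (s - z)) ∂(ballMeasure d) := by
        refine integral_congr_ae (.of_forall fun z => ?_)
        by_cases hz : s - z ∈ unitBall d
        · simp only [hz, Set.indicator_of_mem]
          ring
        · simp [hz]
    _ = _ := by
        rw [integral_add (hmid.fun_add (hint hp' hr' 2)) (hint hone hrr 1),
          integral_add hmid (hint hp' hr' 2),
          integral_add (hleft.fun_add (hint hone hr' (2 * t))) (hint hpp hone 1),
          integral_add hleft (hint hone hr' (2 * t)),
          integral_add (hint hone hone (t ^ 2)) (hint hp' hone (2 * t))]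
        rw [hval hone hone, hval hp' hone, hval hone hr', hval hpp hone, hval hp' hr',
          hval hone hrr, ← rhat_one, quadInv, rinv_add (hmul hp' hone) (hmul hone hr'),
          rinv_add (hmul hpp hone) (((hmul hp' hr').const_mul _).fun_add (hmul hone hrr)),
          rinv_add ((hmul hp' hr').const_mul _) (hmul hone hrr), rinv_const_mul]
        ring

end QuadInv

/-- Sum of the Fourier transforms of the first `n + 2` functions of a sequence. -/
def hatSum (h : ℕ → Space d → ℝ) (n : ℕ) (ξ : Space d) : ℂ :=
  ∑ j ∈ Finset.range (n + 2), rhat (h j) ξ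

/-- Sum of the Fourier transforms of the squares of the first `n + 2` functions. -/
def sqHatSum (h : ℕ → Space d → ℝ) (n : ℕ) (ξ : Space d) : ℂ :=
  ∑ j ∈ Finset.range (n + 2), rhat (fun x => h j x ^ 2) ξ

/-- Sum of the squares of the Fourier transforms of the first `n + 2` functions. -/
def hatSqSum (h : ℕ → Space d → ℝ) (n : ℕ) (ξ : Space d) : ℂ :=
  ∑ j ∈ Finset.range (n + 2), rhat (h j) ξ ^ 2

/-- The Fourier transform in `s` of the integral of `(∑ h_j(z_j))²` over the fibre
`{z ∈ B ^ (n + 2) : ∑ z_j = s}`. -/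
def quadSymbol (h : ℕ → Space d → ℝ) (n : ℕ) (ξ : Space d) : ℂ :=
  sqHatSum h n ξ * ballHat d ξ ^ (n + 1)
    + (hatSum h n ξ ^ 2 - hatSqSum h n ξ) * ballHat d ξ ^ n

/-- The `(n + 2)`-fold convolution of the indicator of the ball, i.e. the total mass of the fibre
`{z ∈ B ^ (n + 2) : ∑ z_j = s}`. -/
def fiberMass (d n : ℕ) (s : Space d) : ℝ := rinv (fun ξ => ballHat d ξ ^ (n + 2)) s

/-- The integral of `∑ h_j(z_j)` over the fibre `{z ∈ B ^ (n + 2) : ∑ z_j = s}`. -/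
def linCoeff (h : ℕ → Space d → ℝ) (n : ℕ) (s : Space d) : ℝ :=
  rinv (fun ξ => hatSum h n ξ * ballHat d ξ ^ (n + 1)) s

/-- The integral of `(t + ∑ h_j(z_j))²` over the fibre `{z ∈ B ^ (n + 2) : ∑ z_j = s}`. -/
def fiberQuad (h : ℕ → Space d → ℝ) (n : ℕ) (t : ℝ) (s : Space d) : ℝ :=
  t ^ 2 * fiberMass d n s + 2 * t * linCoeff h n s + rinv (quadSymbol h n) s

theorem continuous_fiberMass (n : ℕ) : Continuous (fiberMass d n) :=
  continuous_rinv (integrable_ballHat_pow n)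

section Sequence

variable {h : ℕ → Space d → ℝ}

theorem fiberQuad_eq_quadInv (n : ℕ) :
    fiberQuad h n = quadInv (fun ξ => ballHat d ξ ^ (n + 2))
      (fun ξ => hatSum h n ξ * ballHat d ξ ^ (n + 1)) (quadSymbol h n) := rfl

theorem integrable_hatSum_mul (hh : ∀ j, MemLp (h j) 2 (ballMeasure d)) (n k : ℕ) :
    Integrable (fun ξ => hatSum h n ξ * ballHat d ξ ^ (k + 1)) := by
  simp only [hatSum, Finset.sum_mul]
  exact integrable_finsetSum _ fun j _ => integrable_rhat_mul_ballHat_pow (hh j) k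

theorem integrable_quadSymbol (hh : ∀ j, MemLp (h j) ∞ (ballMeasure d)) (n : ℕ) :
    Integrable (quadSymbol h n) := by
  have hprod (i j : ℕ) : Integrable fun ξ => rhat (h i) ξ * rhat (h j) ξ :=
    integrable_rhat_mul_rhat (memLp_two_of_top (hh i)) (memLp_two_of_top (hh j))
  have hsq : Integrable fun ξ => hatSum h n ξ ^ 2 := by
    simp only [hatSum, pow_two, Finset.sum_mul_sum]
    exact integrable_finsetSum _ fun i _ => integrable_finsetSum _ fun j _ => hprod i j
  have hdiag : Integrable (hatSqSum h n) := by
    unfold hatSqSum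
    simp only [pow_two]
    exact integrable_finsetSum _ fun i _ => hprod i i
  refine Integrable.add ?_ (integrable_mul_ballHat_pow (hsq.sub hdiag) n)
  simp only [sqHatSum, Finset.sum_mul]
  exact integrable_finsetSum _ fun j _ =>
    integrable_rhat_mul_ballHat_pow (memLp_two_of_top (memLp_sq_of_top (hh j))) n

theorem integrable_fiberQuad_shift (hh : ∀ j, MemLp (h j) ∞ (ballMeasure d)) (n : ℕ)
    {χ : Space d → ℝ} (hχ : MemLp χ ∞ (ballMeasure d)) (s : Space d) :
    Integrable (fun z => fiberQuad h n (χ z) (s - z)) (ballMeasure d) :=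
  integrable_quadInv_shift (integrable_ballHat_pow n)
    (integrable_hatSum_mul (fun j => memLp_two_of_top (hh j)) n n) (integrable_quadSymbol hh n)
    (memLp_two_of_top hχ) s

theorem hatSum_succ (n : ℕ) (ξ : Space d) :
    hatSum h (n + 1) ξ = hatSum h n ξ + rhat (h (n + 2)) ξ := Finset.sum_range_succ _ _

theorem quadSymbol_succ (n : ℕ) (ξ : Space d) :
    quadSymbol h (n + 1) ξ = quadSymbol h n ξ * ballHat d ξ
      + (2 * (hatSum h n ξ * ballHat d ξ ^ (n + 1) * rhat (h (n + 2)) ξ)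
        + ballHat d ξ ^ (n + 2) * rhat (fun x => h (n + 2) x ^ 2) ξ) := by
  have hsq : sqHatSum h (n + 1) ξ = sqHatSum h n ξ + rhat (fun x => h (n + 2) x ^ 2) ξ :=
    Finset.sum_range_succ _ _
  have hdiag : hatSqSum h (n + 1) ξ = hatSqSum h n ξ + rhat (h (n + 2)) ξ ^ 2 :=
    Finset.sum_range_succ _ _
  rw [quadSymbol, quadSymbol, hsq, hdiag, hatSum_succ]
  ring

theorem fiberQuad_succ (hh : ∀ j, MemLp (h j) ∞ (ballMeasure d)) (n : ℕ) (t : ℝ) (s : Space d) :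
    fiberQuad h (n + 1) t s
      = ∫ z, fiberQuad h n (t + h (n + 2) z) (s - z) ∂(ballMeasure d) := by
  simp only [fiberQuad_eq_quadInv]
  rw [integral_quadInv_shift (integrable_ballHat_pow n)
    (integrable_hatSum_mul (fun j => memLp_two_of_top (hh j)) n n) (integrable_quadSymbol hh n)
    (memLp_two_of_top (hh _))]
  congr 1 <;> funext ξ
  · rw [hatSum_succ]
    ring
  · rw [quadSymbol_succ, Complex.ofReal_ofNat]

theorem fiberQuad_zero_eq (hh : ∀ j, MemLp (h j) ∞ (ballMeasure d)) (t : ℝ) (s : Space d) :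
    fiberQuad h 0 t s = ∫ z, (unitBall d).indicator (fun y => (t + h 0 z + h 1 y) ^ 2) (s - z)
      ∂(ballMeasure d) := by
  rw [integral_sq_add_indicator_sub (hh 0) (hh 1), fiberQuad_eq_quadInv]
  congr 1 <;> funext ξ
  · ring
  · simp only [hatSum, Finset.sum_range_succ, Finset.sum_range_zero]
    ring
  · simp only [quadSymbol, hatSum, sqHatSum, hatSqSum, Finset.sum_range_succ,
      Finset.sum_range_zero, Complex.ofReal_ofNat]
    ring

theorem fiberQuad_nonneg (hh : ∀ j, MemLp (h j) ∞ (ballMeasure d)) (n : ℕ) (t : ℝ)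
    (s : Space d) : 0 ≤ fiberQuad h n t s := by
  induction n generalizing t s with
  | zero =>
    rw [fiberQuad_zero_eq hh]
    exact integral_nonneg fun z => Set.indicator_nonneg (fun _ _ => sq_nonneg _) _
  | succ n ih =>
    rw [fiberQuad_succ hh]
    exact integral_nonneg fun z => ih _ _

end Sequence

theorem fiberMass_zero (s : Space d) : fiberMass d 0 s
    = (ballMeasure d).real ((fun z => s - z) ⁻¹' unitBall d) := by
  have hone : MemLp (fun _ : Space d => (1 : ℝ)) 2 (ballMeasure d) := memLp_const _
  have hconv := integral_mul_indicator_sub hone hone s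
  simp only [rhat_one, one_mul, ← pow_two] at hconv
  rw [fiberMass, ← hconv, ← integral_indicator_one
    (measurableSet_unitBall.preimage (continuous_sub_left s).measurable)]
  rfl

theorem integrable_fiberMass_sub (n : ℕ) (s : Space d) :
    Integrable (fun z => fiberMass d n (s - z)) (ballMeasure d) := by
  simpa only [one_mul, fiberMass] using
    integrable_mul_rinv (integrable_ballHat_pow n) (integrable_const (1 : ℝ)) s

theorem fiberMass_succ (n : ℕ) (s : Space d) :
    fiberMass d (n + 1) s = ∫ z, fiberMass d n (s - z) ∂(ballMeasure d) := by
  have hconv := integral_mul_rinv (integrable_ballHat_pow (d := d) n) (χ := fun _ => 1)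
    (integrable_const _) s
  simp only [one_mul, rhat_one] at hconv
  exact hconv.symm

theorem fiberMass_nonneg (n : ℕ) (s : Space d) : 0 ≤ fiberMass d n s := by
  induction n generalizing s with
  | zero =>
    rw [fiberMass_zero]
    exact measureReal_nonneg
  | succ n ih =>
    rw [fiberMass_succ]
    exact integral_nonneg fun z => ih (s - z)

theorem ballMeasure_ball_inter_pos {U : Set (Space d)} (hU : IsOpen U)
    (hne : (Metric.ball 0 1 ∩ U).Nonempty) : 0 < ballMeasure d U := by
  have hopen : IsOpen (Metric.ball 0 1 ∩ U) := Metric.isOpen_ball.inter hU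
  rw [ballMeasure, Measure.restrict_apply hU.measurableSet, Set.inter_comm]
  exact (hopen.measure_pos volume hne).trans_le
    (measure_mono (Set.inter_subset_inter_left U Metric.ball_subset_closedBall))

theorem fiberMass_pos (n : ℕ) {s : Space d} (hs : ‖s‖ < 2) : 0 < fiberMass d n s := by
  have hopen (ρ : ℝ) : IsOpen ((fun z => s - z) ⁻¹' Metric.ball (0 : Space d) ρ) :=
    Metric.isOpen_ball.preimage (continuous_sub_left s)
  induction n generalizing s with
  | zero =>
    have hhalf : ‖(2 : ℝ)⁻¹ • s‖ < 1 := by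
      rw [norm_smul, norm_inv, Real.norm_two]
      linarith
    have hsub : s - (2 : ℝ)⁻¹ • s = (2 : ℝ)⁻¹ • s := by
      rw [sub_eq_iff_eq_add, ← add_smul, ← two_mul, mul_inv_cancel₀ two_ne_zero, one_smul]
    rw [fiberMass_zero]
    refine ENNReal.toReal_pos (ne_of_gt ?_) (measure_ne_top _ _)
    refine (ballMeasure_ball_inter_pos (hopen 1) ⟨(2 : ℝ)⁻¹ • s, ?_, ?_⟩).trans_le
      (measure_mono (Set.preimage_mono Metric.ball_subset_closedBall))
    · simpa using hhalf
    · simpa [hsub] using hhalf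
  | succ n ih =>
    rw [fiberMass_succ, integral_pos_iff_support_of_nonneg (fun z => fiberMass_nonneg n _)
      (integrable_fiberMass_sub n s)]
    refine (ballMeasure_ball_inter_pos (hopen 2) ⟨0, by simp, by simpa using hs⟩).trans_le
      (measure_mono fun z hz => ?_)
    have hz2 : ‖s - z‖ < 2 := by simpa using hz
    exact (ih hz2 fun ρ => Metric.isOpen_ball.preimage (continuous_sub_left (s - z))).ne'

theorem continuous_linCoeff {h : ℕ → Space d → ℝ} (hh : ∀ j, MemLp (h j) 2 (ballMeasure d))
    (n : ℕ) : Continuous (linCoeff h n) := continuous_rinv (integrable_hatSum_mul hh n n)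

theorem sq_le_fiberMass_mul_fiberQuad {h : ℕ → Space d → ℝ}
    (hh : ∀ j, MemLp (h j) ∞ (ballMeasure d)) (n : ℕ) (t : ℝ) (s : Space d) :
    (fiberMass d n s * t + linCoeff h n s) ^ 2 ≤ fiberMass d n s * fiberQuad h n t s := by
  have hdiscrim : discrim (fiberMass d n s) (2 * linCoeff h n s) (rinv (quadSymbol h n) s) ≤ 0 :=
    discrim_le_zero fun x => by
      have hnonneg := fiberQuad_nonneg hh n x s
      rw [fiberQuad] at hnonneg
      linarith
  rw [discrim] at hdiscrim
  rw [fiberQuad]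
  nlinarith

theorem fiberMass_neg (n : ℕ) (s : Space d) : fiberMass d n (-s) = fiberMass d n s := by
  have hconj : starRingEnd ℂ (𝓕⁻ (fun ξ => ballHat d ξ ^ (n + 2)) s)
      = 𝓕⁻ (fun ξ => ballHat d ξ ^ (n + 2)) (-s) := by
    rw [Real.fourierInv_eq, Real.fourierInv_eq, ← integral_conj]
    congr! 2
    rw [← ballHat_re]
    simp [Circle.smul_def, ← Circle.coe_inv_eq_conj, AddChar.map_neg_eq_inv]
  rw [fiberMass, fiberMass, rinv, rinv, ← hconj, Complex.conj_re]

theorem integral_fiberMass_mul {χ : Space d → ℝ} (hχ : Integrable χ (ballMeasure d)) (n : ℕ) :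
    ∫ x, fiberMass d n x * χ x ∂(ballMeasure d)
      = (∫ ξ, ballHat d ξ ^ (n + 2) * rhat χ ξ).re := by
  have hconv := integral_mul_rinv (integrable_ballHat_pow (d := d) n) hχ 0
  rw [rinv, Real.fourierInv_eq] at hconv
  simp only [inner_zero_right, AddChar.map_zero_eq_one, one_smul, zero_sub] at hconv
  rw [← hconv]
  congr 1
  funext x
  rw [mul_comm, ← fiberMass_neg, fiberMass]

theorem integrable_norm_ballHat_pow (n : ℕ) : Integrable (fun ξ => ‖ballHat d ξ‖ ^ (n + 2)) := by
  simpa using (integrable_ballHat_pow (d := d) n).norm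

theorem norm_ballHat_pow_even {k : ℕ} (hk : Even k) (ξ : Space d) :
    ((‖ballHat d ξ‖ ^ k : ℝ) : ℂ) = ballHat d ξ ^ k := by
  rw [← ballHat_re ξ, Complex.norm_real, Real.norm_eq_abs, hk.pow_abs]
  push_cast
  rfl

theorem abs_mul_im_sq_add_re_sq_le {a M : ℝ} (ha : 1 ≤ a) {z : ℂ} (hz : ‖z‖ ≤ M) :
    |a * z.im ^ 2 + z.re ^ 2| ≤ a * M ^ 2 := by
  have hsq : z.re ^ 2 + z.im ^ 2 ≤ M ^ 2 := by
    rw [pow_two, pow_two, ← Complex.normSq_apply, ← Complex.sq_norm]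
    gcongr
  rw [abs_of_nonneg (by positivity)]
  nlinarith [sq_nonneg z.re]

/-- The quadratic form of the second variation of `‖𝓕 u‖_q^q` at the indicator of the ball in the
direction `i g`, for the exponent `q = N + 4` and up to a factor. -/
def quadForm (N : ℕ) (g : Space d → ℝ) : ℝ :=
  ∫ x, fiberMass d (N + 1) x * g x ^ 2 ∂(ballMeasure d)
    - ∫ ξ, ‖ballHat d ξ‖ ^ (N + 2) * ((N + 3) * (rhat g ξ).im ^ 2 + (rhat g ξ).re ^ 2)

theorem integrable_weighted_quad (N : ℕ) {g : Space d → ℝ} (hg : Integrable g (ballMeasure d)) :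
    Integrable fun ξ => ‖ballHat d ξ‖ ^ (N + 2)
      * ((N + 3) * (rhat g ξ).im ^ 2 + (rhat g ξ).re ^ 2) := by
  have hcont := continuous_rhat hg
  exact (integrable_norm_ballHat_pow N).mul_bdd
    (Continuous.aestronglyMeasurable (by fun_prop)) (.of_forall fun ξ =>
      abs_mul_im_sq_add_re_sq_le (by linarith [N.cast_nonneg (α := ℝ)]) (norm_rhat_le g ξ))

/-- The sequence whose first `r + 2` entries are `-g(-x)` and whose other entries are `g`. Its
fibre integral over `2 r + 4` variables is the second variation for the exponent `2 r + 4`. -/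
def signedSeq (r : ℕ) (g : Space d → ℝ) (j : ℕ) : Space d → ℝ :=
  if j < r + 2 then fun x => -g (-x) else g

theorem memLp_signedSeq {p : ℝ≥0∞} {g : Space d → ℝ} (hg : MemLp g p (ballMeasure d)) (r j : ℕ) :
    MemLp (signedSeq r g j) p (ballMeasure d) := by
  unfold signedSeq
  split_ifs
  · exact (hg.comp_measurePreserving measurePreserving_neg_ballMeasure).neg
  · exact hg

theorem signedSeq_of_le (g : Space d → ℝ) {r j : ℕ} (hj : r + 2 ≤ j) : signedSeq r g j = g :=
  if_neg hj.not_gt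

theorem sum_signedSeq {G : Type*} [AddCommMonoid G] (r : ℕ) (g : Space d → ℝ)
    (Φ : (Space d → ℝ) → G) :
    ∑ j ∈ Finset.range (2 * r + 2 + 2), Φ (signedSeq r g j)
      = (r + 2) • Φ (fun x => -g (-x)) + (r + 2) • Φ g := by
  rw [show 2 * r + 2 + 2 = (r + 2) + (r + 2) by ring, Finset.sum_range_add]
  have hfirst (j : ℕ) (hj : j ∈ Finset.range (r + 2)) : Φ (signedSeq r g j) = Φ fun x => -g (-x) :=
    congrArg Φ (if_pos (Finset.mem_range.1 hj))
  simp only [Finset.sum_congr rfl hfirst, signedSeq_of_le g (Nat.le_add_right _ _),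
    Finset.sum_const, Finset.card_range]

theorem rhat_neg_comp_neg (g : Space d → ℝ) (ξ : Space d) :
    rhat (fun x => -g (-x)) ξ = -starRingEnd ℂ (rhat g ξ) := by
  rw [conj_rhat]
  simpa using rhat_const_mul (-1) (fun x => g (-x)) ξ

theorem sq_sum_conj_sub_sum_sq_conj (m : ℝ) (z : ℂ) :
    (m * -starRingEnd ℂ z + m * z) ^ 2 - (m * (-starRingEnd ℂ z) ^ 2 + m * z ^ 2)
      = ((-(2 * m) * ((2 * m - 1) * z.im ^ 2 + z.re ^ 2) : ℝ) : ℂ) := by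
  apply Complex.ext <;> simp [pow_two] <;> ring

theorem quadSymbol_signedSeq (g : Space d → ℝ) (r : ℕ) (ξ : Space d) :
    quadSymbol (signedSeq r g) (2 * r + 2) ξ
      = (((2 * r + 4) * ((ballHat d ξ ^ (2 * r + 1 + 2) * rhat (fun x => g x ^ 2) ξ).re
        - ‖ballHat d ξ‖ ^ (2 * r + 2)
          * (((2 * r : ℕ) + 3) * (rhat g ξ).im ^ 2 + (rhat g ξ).re ^ 2)) : ℝ) : ℂ) := by
  have hlin : hatSum (signedSeq r g) (2 * r + 2) ξ
      = (r + 2) • rhat (fun x => -g (-x)) ξ + (r + 2) • rhat g ξ :=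
    sum_signedSeq r g fun h => rhat h ξ
  have hsq : sqHatSum (signedSeq r g) (2 * r + 2) ξ
      = (r + 2) • rhat (fun x => (-g (-x)) ^ 2) ξ + (r + 2) • rhat (fun x => g x ^ 2) ξ :=
    sum_signedSeq r g fun h => rhat (fun x => h x ^ 2) ξ
  have hdiag : hatSqSum (signedSeq r g) (2 * r + 2) ξ
      = (r + 2) • rhat (fun x => -g (-x)) ξ ^ 2 + (r + 2) • rhat g ξ ^ 2 :=
    sum_signedSeq r g fun h => rhat h ξ ^ 2
  have hreflect : rhat (fun x => (-g (-x)) ^ 2) ξ = starRingEnd ℂ (rhat (fun x => g x ^ 2) ξ) := by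
    simp only [neg_sq, conj_rhat]
  have hpow : ballHat d ξ ^ (2 * r + 2) = ((‖ballHat d ξ‖ ^ (2 * r + 2) : ℝ) : ℂ) :=
    (norm_ballHat_pow_even ⟨r + 1, by ring⟩ ξ).symm
  have hcast : ((r + 2 : ℕ) : ℂ) = ((r + 2 : ℝ) : ℂ) := by push_cast; rfl
  have hreal : ballHat d ξ ^ (2 * r + 2 + 1) = (((ballHat d ξ).re ^ (2 * r + 2 + 1) : ℝ) : ℂ) := by
    rw [Complex.ofReal_pow, ballHat_re]
  rw [quadSymbol, hlin, hsq, hdiag, hreflect, rhat_neg_comp_neg, hpow, hreal]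
  simp only [nsmul_eq_mul, hcast]
  rw [sq_sum_conj_sub_sum_sq_conj, Complex.re_ofReal_mul, ← mul_add, add_comm (starRingEnd ℂ _),
    Complex.add_conj]
  push_cast
  ring

theorem fiberQuad_signedSeq_eq {g : Space d → ℝ} (hg : MemLp g ∞ (ballMeasure d)) (r : ℕ) :
    fiberQuad (signedSeq r g) (2 * r + 2) 0 0 = (2 * r + 4) * quadForm (2 * r) g := by
  have hg2 : Integrable (fun x => g x ^ 2) (ballMeasure d) := (memLp_sq_of_top hg).integrable le_top
  have hmass := integrable_mul_rhat (integrable_ballHat_pow (2 * r + 1)) hg2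
  rw [fiberQuad, rinv, Real.fourierInv_eq]
  simp only [quadSymbol_signedSeq, inner_zero_right, AddChar.map_zero_eq_one, one_smul,
    integral_complex_ofReal, Complex.ofReal_re, integral_const_mul]
  have hmass_re : ∫ ξ, (ballHat d ξ ^ (2 * r + 1 + 2) * rhat (fun x => g x ^ 2) ξ).re
      = (∫ ξ, ballHat d ξ ^ (2 * r + 1 + 2) * rhat (fun x => g x ^ 2) ξ).re := integral_re hmass
  rw [integral_sub (by exact hmass.re) (integrable_weighted_quad (2 * r) (hg.integrable le_top)),
    quadForm, integral_fiberMass_mul hg2, hmass_re]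
  ring

theorem quadForm_nonneg_of_top {g : Space d → ℝ} (hg : MemLp g ∞ (ballMeasure d)) (r : ℕ) :
    0 ≤ quadForm (2 * r) g := by
  have hfiber := fiberQuad_nonneg (memLp_signedSeq hg r) (2 * r + 2) 0 0
  rw [fiberQuad_signedSeq_eq hg] at hfiber
  exact nonneg_of_mul_nonneg_right hfiber (by positivity)

/-- The integral of `∑ h_j(z_j)` over a fibre on which the last two coordinates are fixed, where
`h` is the signed sequence of `g`. If the second variation vanishes, this integral is zero almost
everywhere, which makes `g(z) + g(w)` a function of `z + w`. -/
def cauchyDefect (r : ℕ) (g : Space d → ℝ) (p : Space d × Space d) : ℝ :=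
  fiberMass d (2 * r) (0 - p.1 - p.2) * (g p.1 + g p.2)
    + linCoeff (signedSeq r g) (2 * r) (0 - p.1 - p.2)

theorem aemeasurable_cauchyDefect (r : ℕ) {g : Space d → ℝ} (hg : MemLp g 2 (ballMeasure d)) :
    AEMeasurable (cauchyDefect r g) ((ballMeasure d).prod (ballMeasure d)) := by
  have hcont : Continuous fun p : Space d × Space d => 0 - p.1 - p.2 := by fun_prop
  have hsum : AEMeasurable (fun p : Space d × Space d => g p.1 + g p.2)
      ((ballMeasure d).prod (ballMeasure d)) :=
    hg.1.aemeasurable.comp_fst.add hg.1.aemeasurable.comp_snd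
  exact (((continuous_fiberMass (2 * r)).comp hcont).measurable.aemeasurable.mul hsum).add
    ((continuous_linCoeff (memLp_signedSeq hg r) (2 * r)).comp hcont).measurable.aemeasurable

theorem lintegral_lintegral_fiberQuad {g : Space d → ℝ} (hg : MemLp g ∞ (ballMeasure d)) (r : ℕ) :
    ∫⁻ z, ∫⁻ w, ENNReal.ofReal
        (fiberQuad (signedSeq r g) (2 * r) (g z + g w) (0 - z - w))
        ∂(ballMeasure d) ∂(ballMeasure d)
      = ENNReal.ofReal ((2 * r + 4) * quadForm (2 * r) g) := by
  have hseq := memLp_signedSeq hg r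
  rw [← fiberQuad_signedSeq_eq hg, fiberQuad_succ hseq, signedSeq_of_le g (by lia),
    ofReal_integral_eq_lintegral_ofReal]
  · refine lintegral_congr fun z => ?_
    rw [fiberQuad_succ hseq, signedSeq_of_le g (by lia), zero_add,
      ofReal_integral_eq_lintegral_ofReal]
    · exact integrable_fiberQuad_shift hseq _ ((memLp_const (g z)).add hg) (0 - z)
    · exact .of_forall fun w => fiberQuad_nonneg hseq _ _ _
  · simpa only [zero_add] using integrable_fiberQuad_shift hseq _ hg 0
  · exact .of_forall fun z => fiberQuad_nonneg hseq _ _ _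

theorem cauchyDefect_sq_le {g : Space d → ℝ} (hg : MemLp g ∞ (ballMeasure d)) (r : ℕ)
    (z w : Space d) :
    cauchyDefect r g (z, w) ^ 2 ≤ (∫ ξ, ‖ballHat d ξ ^ (2 * r + 2)‖)
      * fiberQuad (signedSeq r g) (2 * r) (g z + g w) (0 - z - w) :=
  have hseq := memLp_signedSeq hg r
  (sq_le_fiberMass_mul_fiberQuad hseq (2 * r) (g z + g w) (0 - z - w)).trans
    (mul_le_mul_of_nonneg_right ((le_abs_self _).trans (abs_rinv_le _ _))
      (fiberQuad_nonneg hseq _ _ _))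

theorem lintegral_cauchyDefect_le {g : Space d → ℝ} (hg : MemLp g ∞ (ballMeasure d)) (r : ℕ) :
    ∫⁻ p, ENNReal.ofReal (cauchyDefect r g p ^ 2) ∂((ballMeasure d).prod (ballMeasure d))
      ≤ ENNReal.ofReal ((∫ ξ, ‖ballHat d ξ ^ (2 * r + 2)‖)
        * ((2 * r + 4) * quadForm (2 * r) g)) := by
  have hpointwise := cauchyDefect_sq_le hg r
  have hA0 : 0 ≤ ∫ ξ, ‖ballHat d ξ ^ (2 * r + 2)‖ := integral_nonneg fun _ => norm_nonneg _
  generalize ∫ ξ, ‖ballHat d ξ ^ (2 * r + 2)‖ = A at hpointwise hA0 ⊢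
  have hmeas : AEMeasurable (fun p => ENNReal.ofReal (cauchyDefect r g p ^ 2))
      ((ballMeasure d).prod (ballMeasure d)) :=
    ((aemeasurable_cauchyDefect r (memLp_two_of_top hg)).pow_const 2).ennreal_ofReal
  rw [ENNReal.ofReal_mul hA0, ← lintegral_lintegral_fiberQuad hg, lintegral_prod _ hmeas]
  simp only [← lintegral_const_mul' _ _ ENNReal.ofReal_ne_top, ← ENNReal.ofReal_mul hA0]
  exact lintegral_mono fun z => lintegral_mono fun w => ENNReal.ofReal_le_ofReal (hpointwise z w)

section Dominated

variable {g : Space d → ℝ} {G : ℕ → Space d → ℝ}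

theorem tendsto_rhat (hg : Integrable g (ballMeasure d))
    (hG : ∀ k, AEStronglyMeasurable (G k) (ballMeasure d)) (hle : ∀ k x, |G k x| ≤ |g x|)
    (hlim : ∀ x, Tendsto (fun k => G k x) atTop (𝓝 (g x))) (ξ : Space d) :
    Tendsto (fun k => rhat (G k) ξ) atTop (𝓝 (rhat g ξ)) := by
  have hchar : Continuous fun x : Space d => Real.fourierChar (-inner ℝ x ξ) :=
    Real.continuous_fourierChar.comp (continuous_id.inner continuous_const).neg
  simp only [rhat, hat_apply]
  refine tendsto_integral_of_dominated_convergence (fun x => |g x|)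
    (fun k => hchar.aestronglyMeasurable.smul
      (Complex.continuous_ofReal.comp_aestronglyMeasurable (hG k))) hg.abs
    (fun k => .of_forall fun x => ?_) (.of_forall fun x => ?_)
  · simpa using hle k x
  · exact ((Complex.continuous_ofReal.tendsto _).comp (hlim x)).const_smul _

theorem tendsto_quadForm (N : ℕ) (hg : MemLp g 2 (ballMeasure d))
    (hG : ∀ k, AEStronglyMeasurable (G k) (ballMeasure d)) (hle : ∀ k x, |G k x| ≤ |g x|)
    (hlim : ∀ x, Tendsto (fun k => G k x) atTop (𝓝 (g x))) :
    Tendsto (fun k => quadForm N (G k)) atTop (𝓝 (quadForm N g)) := by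
  have hg1 : Integrable g (ballMeasure d) := hg.integrable one_le_two
  have hGi (k : ℕ) : Integrable (G k) (ballMeasure d) :=
    hg1.mono (hG k) (.of_forall fun x => hle k x)
  refine Tendsto.sub (tendsto_integral_of_dominated_convergence
    (fun x => (∫ ξ, ‖ballHat d ξ ^ (N + 1 + 2)‖) * g x ^ 2)
    (fun k => (continuous_fiberMass _).aestronglyMeasurable.mul ((hG k).pow 2))
    (hg.integrable_sq.const_mul _) (fun k => .of_forall fun x => ?_)
    (.of_forall fun x => ((hlim x).pow 2).const_mul _))
    (tendsto_integral_of_dominated_convergence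
    (fun ξ => ‖ballHat d ξ‖ ^ (N + 2) * ((N + 3) * (∫ x, |g x| ∂(ballMeasure d)) ^ 2))
    (fun k => (integrable_weighted_quad N (hGi k)).1)
    ((integrable_norm_ballHat_pow N).mul_const _) (fun k => .of_forall fun ξ => ?_)
    (.of_forall fun ξ => ?_))
  · rw [norm_mul, norm_pow, Real.norm_eq_abs, Real.norm_eq_abs, ← sq_abs (g x)]
    exact mul_le_mul (abs_rinv_le _ _) (pow_le_pow_left₀ (abs_nonneg _) (hle k x) 2)
      (by positivity) (integral_nonneg fun _ => norm_nonneg _)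
  · rw [norm_mul, norm_pow, norm_norm]
    refine mul_le_mul_of_nonneg_left (abs_mul_im_sq_add_re_sq_le
      (by linarith [N.cast_nonneg (α := ℝ)]) ?_) (by positivity)
    exact (norm_rhat_le _ _).trans (integral_mono (hGi k).abs hg1.abs (hle k))
  · have hrhat := tendsto_rhat hg1 hG hle hlim ξ
    have him := (Complex.continuous_im.tendsto _).comp hrhat
    have hre := (Complex.continuous_re.tendsto _).comp hrhat
    exact (((him.pow 2).const_mul _).add (hre.pow 2)).const_mul _

theorem exists_rinv_rhat_mul_eq_integral (n : ℕ) (s : Space d) :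
    ∃ m : Space d → ℝ, MemLp m 2 (ballMeasure d) ∧ ∀ u : Space d → ℝ, MemLp u 2 (ballMeasure d) →
      rinv (fun ξ => rhat u ξ * ballHat d ξ ^ (n + 1)) s = ∫ z, u z * m z ∂(ballMeasure d) := by
  have hone : MemLp (fun _ : Space d => (1 : ℝ)) 2 (ballMeasure d) := memLp_const 1
  cases n with
  | zero =>
    refine ⟨fun z => (unitBall d).indicator (fun _ => 1) (s - z), ?_, fun u hu => ?_⟩
    · exact (((memLp_indicator_iff_restrict measurableSet_unitBall).2
        hone).comp_measurePreserving (Measure.measurePreserving_sub_left volume s)).restrict _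
    · simp only [integral_mul_indicator_sub hu hone, rhat_one, zero_add, pow_one]
  | succ n =>
    refine ⟨fun z => fiberMass d n (s - z), ?_, fun u hu => ?_⟩
    · exact (memLp_top_of_bound ((continuous_fiberMass n).comp
        (continuous_sub_left s)).aestronglyMeasurable _
        (.of_forall fun z => abs_rinv_le _ (s - z))).mono_exponent le_top
    · unfold fiberMass
      simp only [integral_mul_rinv (integrable_ballHat_pow n) (hu.integrable one_le_two), mul_comm]

theorem tendsto_rinv_rhat_mul (n : ℕ) (hg : MemLp g 2 (ballMeasure d))
    (hG : ∀ k, AEStronglyMeasurable (G k) (ballMeasure d)) (hle : ∀ k x, |G k x| ≤ |g x|)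
    (hlim : ∀ x, Tendsto (fun k => G k x) atTop (𝓝 (g x))) (s : Space d) :
    Tendsto (fun k => rinv (fun ξ => rhat (G k) ξ * ballHat d ξ ^ (n + 1)) s) atTop
      (𝓝 (rinv (fun ξ => rhat g ξ * ballHat d ξ ^ (n + 1)) s)) := by
  obtain ⟨m, hm, hrepr⟩ := exists_rinv_rhat_mul_eq_integral n s
  simp only [hrepr g hg, fun k => hrepr (G k) (hg.mono (hG k) (.of_forall fun x => hle k x))]
  refine tendsto_integral_of_dominated_convergence (fun x => ‖g x * m x‖)
    (fun k => (hG k).mul hm.1) (hg.integrable_mul hm).norm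
    (fun k => .of_forall fun x => ?_) (.of_forall fun x => (hlim x).mul_const _)
  rw [norm_mul, norm_mul]
  exact mul_le_mul_of_nonneg_right (hle k x) (norm_nonneg _)

theorem linCoeff_eq_sum {h : ℕ → Space d → ℝ} (hh : ∀ j, MemLp (h j) 2 (ballMeasure d)) (n : ℕ)
    (s : Space d) :
    linCoeff h n s
      = ∑ j ∈ Finset.range (n + 2), rinv (fun ξ => rhat (h j) ξ * ballHat d ξ ^ (n + 1)) s := by
  rw [← rinv_sum fun j => integrable_rhat_mul_ballHat_pow (hh j) n, linCoeff]
  simp only [hatSum, Finset.sum_mul]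

theorem tendsto_linCoeff_signedSeq (r n : ℕ) (hg : MemLp g 2 (ballMeasure d))
    (hG : ∀ k, AEStronglyMeasurable (G k) (ballMeasure d)) (hle : ∀ k x, |G k x| ≤ |g x|)
    (hlim : ∀ x, Tendsto (fun k => G k x) atTop (𝓝 (g x))) (s : Space d) :
    Tendsto (fun k => linCoeff (signedSeq r (G k)) n s) atTop
      (𝓝 (linCoeff (signedSeq r g) n s)) := by
  have hG2 (k : ℕ) : MemLp (G k) 2 (ballMeasure d) := hg.mono (hG k) (.of_forall fun x => hle k x)
  simp only [linCoeff_eq_sum (memLp_signedSeq hg r), linCoeff_eq_sum (memLp_signedSeq (hG2 _) r)]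
  refine tendsto_finsetSum _ fun j _ => tendsto_rinv_rhat_mul n (memLp_signedSeq hg r j)
    (fun k => (memLp_signedSeq (hG2 k) r j).1) (fun k x => ?_) (fun x => ?_) s
  · unfold signedSeq
    split_ifs
    · simpa using hle k (-x)
    · exact hle k x
  · unfold signedSeq
    split_ifs
    · exact (hlim (-x)).neg
    · exact hlim x

end Dominated

section Truncation

theorem tendsto_truncation {α : Type*} (g : α → ℝ) (x : α) :
    Tendsto (fun k : ℕ => truncation g k x) atTop (𝓝 (g x)) := by
  refine tendsto_const_nhds.congr' ?_
  filter_upwards [eventually_gt_atTop ⌈|g x|⌉₊] with k hk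
  exact (truncation_eq_self (Nat.lt_of_ceil_lt hk)).symm

variable {g : Space d → ℝ}

theorem tendsto_quadForm_truncation (hg : MemLp g 2 (ballMeasure d)) (N : ℕ) :
    Tendsto (fun k : ℕ => quadForm N (truncation g k)) atTop (𝓝 (quadForm N g)) :=
  tendsto_quadForm N hg (fun _ => hg.1.truncation)
    (fun k x => abs_truncation_le_abs_self g k x) (tendsto_truncation g)

theorem quadForm_nonneg (hg : MemLp g 2 (ballMeasure d)) (r : ℕ) : 0 ≤ quadForm (2 * r) g :=
  ge_of_tendsto' (tendsto_quadForm_truncation hg (2 * r))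
    fun _ => quadForm_nonneg_of_top hg.1.memLp_truncation r

theorem tendsto_lintegral_cauchyDefect_truncation (hg : MemLp g 2 (ballMeasure d)) (r : ℕ)
    (hzero : quadForm (2 * r) g = 0) :
    Tendsto (fun k : ℕ => ∫⁻ p, ENNReal.ofReal (cauchyDefect r (truncation g k) p ^ 2)
      ∂((ballMeasure d).prod (ballMeasure d))) atTop (𝓝 0) := by
  have hbound : Tendsto (fun k : ℕ => ENNReal.ofReal ((∫ ξ, ‖ballHat d ξ ^ (2 * r + 2)‖)
      * ((2 * r + 4) * quadForm (2 * r) (truncation g k)))) atTop (𝓝 0) := by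
    have hlim := ((tendsto_quadForm_truncation hg (2 * r)).const_mul (2 * r + 4 : ℝ)).const_mul
      (∫ ξ, ‖ballHat d ξ ^ (2 * r + 2)‖)
    rw [hzero, mul_zero, mul_zero] at hlim
    simpa using ENNReal.tendsto_ofReal hlim
  exact tendsto_of_tendsto_of_tendsto_of_le_of_le tendsto_const_nhds hbound (fun _ => zero_le)
    (fun _ => lintegral_cauchyDefect_le hg.1.memLp_truncation r)

theorem cauchyDefect_ae_eq_zero (hg : MemLp g 2 (ballMeasure d)) (r : ℕ)
    (hzero : quadForm (2 * r) g = 0) :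
    ∀ᵐ p ∂((ballMeasure d).prod (ballMeasure d)), cauchyDefect r g p = 0 := by
  have hlim (p : Space d × Space d) :
      Tendsto (fun k : ℕ => ENNReal.ofReal (cauchyDefect r (truncation g k) p ^ 2)) atTop
        (𝓝 (ENNReal.ofReal (cauchyDefect r g p ^ 2))) :=
    ENNReal.tendsto_ofReal <| Tendsto.pow (Tendsto.add
      (((tendsto_truncation g p.1).add (tendsto_truncation g p.2)).const_mul _)
      (tendsto_linCoeff_signedSeq r _ hg (fun _ => hg.1.truncation)
        (fun k x => abs_truncation_le_abs_self g k x) (tendsto_truncation g) _)) 2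
  have hfatou := lintegral_liminf_le' (u := atTop) fun k : ℕ =>
    ((aemeasurable_cauchyDefect r (hg.1.memLp_truncation (A := k))).pow_const 2).ennreal_ofReal
  simp only [fun p => (hlim p).liminf_eq,
    (tendsto_lintegral_cauchyDefect_truncation hg r hzero).liminf_eq, nonpos_iff_eq_zero] at hfatou
  rw [lintegral_eq_zero_iff' ((aemeasurable_cauchyDefect r hg).pow_const 2).ennreal_ofReal]
    at hfatou
  filter_upwards [hfatou] with p hp
  simpa [sq_nonpos_iff] using hp

end Truncation

section LocalCauchy

variable {V : Type*} [NormedAddCommGroup V] [NormedSpace ℝ V] {φ ψ : V → ℝ}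

theorem map_nsmul_of_locally_additive
    (hadd : ∀ x y, ‖x‖ < 1 → ‖y‖ < 1 → ‖x + y‖ < 1 → φ (x + y) = φ x + φ y) (n : ℕ) {y : V}
    (hy : (n + 1 : ℝ) * ‖y‖ < 1) : φ ((n + 1 : ℝ) • y) = (n + 1) * φ y := by
  induction n with
  | zero => simp
  | succ n ih =>
    push_cast at hy ⊢
    have hy0 := norm_nonneg y
    have hprev : ((n : ℝ) + 1) * ‖y‖ < 1 := by nlinarith
    have hnorm (c : ℝ) (hc : 0 ≤ c) : ‖c • y‖ = c * ‖y‖ := by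
      rw [norm_smul, Real.norm_of_nonneg hc]
    have hnext : ‖((n : ℝ) + 1) • y + y‖ < 1 := by
      rwa [← one_smul ℝ y, smul_smul, mul_one, ← add_smul, hnorm _ (by positivity)]
    rw [add_smul _ 1 y, one_smul, hadd _ _ (by rwa [hnorm _ (by positivity)]) (by nlinarith) hnext,
      ih hprev]
    ring

theorem exists_continuousLinearMap_of_locally_additive
    (hadd : ∀ x y, ‖x‖ < 1 → ‖y‖ < 1 → ‖x + y‖ < 1 → φ (x + y) = φ x + φ y)
    (hcont : ContinuousAt φ 0) : ∃ T : V →L[ℝ] ℝ, ∀ x, ‖x‖ < 1 → φ x = T x := by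
  have hmul (n : ℕ) (x : V) (hx : ‖x‖ < 1) : φ x = (n + 1) * φ ((n + 1 : ℝ)⁻¹ • x) := by
    have hn : (0 : ℝ) < n + 1 := by positivity
    rw [← map_nsmul_of_locally_additive hadd n, smul_inv_smul₀ hn.ne']
    rwa [norm_smul, norm_inv, Real.norm_of_nonneg hn.le, mul_inv_cancel_left₀ hn.ne']
  have hlt (n : ℕ) (x : V) (hx : ‖x‖ < n + 1) : ‖(n + 1 : ℝ)⁻¹ • x‖ < 1 := by
    have hn : (0 : ℝ) < n + 1 := by positivity
    rwa [norm_smul, norm_inv, Real.norm_of_nonneg hn.le, inv_mul_lt_one₀ hn]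
  -- The additive extension of `φ` rescales its argument into the unit ball.
  set A : V → ℝ := fun x => (⌊‖x‖⌋₊ + 1) * φ ((⌊‖x‖⌋₊ + 1 : ℝ)⁻¹ • x) with hA
  have hscale (n : ℕ) (x : V) (hx : ‖x‖ < n + 1) : A x = (n + 1) * φ ((n + 1 : ℝ)⁻¹ • x) := by
    simp only [hA]
    rw [hmul n _ (hlt _ x (Nat.lt_floor_add_one ‖x‖)), hmul ⌊‖x‖⌋₊ _ (hlt n x hx), smul_comm]
    ring
  have hext (x : V) (hx : ‖x‖ < 1) : A x = φ x := by
    simpa using hscale 0 x (by simpa using hx)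
  have hAadd (x y : V) : A (x + y) = A x + A y := by
    have hn : ‖x‖ + ‖y‖ < ⌊‖x‖ + ‖y‖⌋₊ + 1 := Nat.lt_floor_add_one _
    have hx : ‖x‖ < ⌊‖x‖ + ‖y‖⌋₊ + 1 := by linarith [norm_nonneg y]
    have hy : ‖y‖ < ⌊‖x‖ + ‖y‖⌋₊ + 1 := by linarith [norm_nonneg x]
    have hxy := hlt _ (x + y) ((norm_add_le x y).trans_lt hn)
    rw [hscale _ _ ((norm_add_le x y).trans_lt hn), hscale _ x hx, hscale _ y hy, smul_add,
      hadd _ _ (hlt _ x hx) (hlt _ y hy) (by rwa [← smul_add]), mul_add]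
  have hAcont : Continuous (AddMonoidHom.mk' A hAadd) := by
    refine continuous_of_continuousAt_zero _ (hcont.congr ?_)
    filter_upwards [Metric.ball_mem_nhds (0 : V) one_pos] with x hx
    exact (hext x (by simpa using hx)).symm
  exact ⟨(AddMonoidHom.mk' A hAadd).toRealLinearMap hAcont, fun x hx => (hext x hx).symm⟩

theorem exists_continuousLinearMap_of_add_eq
    (heq : ∀ x y, ‖x‖ < 1 → ‖y‖ < 1 → φ x + φ y = ψ (x + y)) (hcont : ContinuousAt φ 0) :
    ∃ T : V →L[ℝ] ℝ, ∀ x, ‖x‖ < 1 → φ x = T x + φ 0 := by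
  have hadd (x y : V) (hx : ‖x‖ < 1) (hy : ‖y‖ < 1) (hxy : ‖x + y‖ < 1) :
      φ (x + y) - φ 0 = (φ x - φ 0) + (φ y - φ 0) := by
    have hsum := heq (x + y) 0 hxy (by simp)
    rw [add_zero] at hsum
    linarith [heq x y hx hy]
  obtain ⟨T, hT⟩ := exists_continuousLinearMap_of_locally_additive (φ := fun x => φ x - φ 0) hadd
    (hcont.sub continuousAt_const)
  exact ⟨T, fun x hx => by rw [← hT x hx, sub_add_cancel]⟩

end LocalCauchy

theorem ballMeasure_eq_restrict_ball :
    ballMeasure d = volume.restrict (Metric.ball (0 : Space d) 1) := by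
  refine Measure.restrict_congr_set ?_
  rw [unitBall, ← Metric.ball_union_sphere]
  exact union_ae_eq_left_of_ae_eq_empty
    (ae_eq_empty.2 (Measure.addHaar_sphere_of_ne_zero _ _ one_ne_zero))

theorem ballMeasure_ae_norm_lt : ∀ᵐ x ∂(ballMeasure d), ‖x‖ < 1 := by
  rw [ballMeasure_eq_restrict_ball]
  filter_upwards [ae_restrict_mem Metric.isOpen_ball.measurableSet] with x hx
  simpa using hx

theorem neZero_ballMeasure : NeZero (ballMeasure d) :=
  ⟨fun hzero => by
    have hpos := ballMeasure_ball_inter_pos (d := d) isOpen_univ ⟨0, by simp⟩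
    simp [hzero] at hpos⟩

theorem exists_continuousOn_ae_eq_of_add_eq {g ψ : Space d → ℝ}
    (hψ : ContinuousOn ψ (Metric.ball 0 2))
    (hadd : ∀ᵐ p ∂((ballMeasure d).prod (ballMeasure d)), g p.1 + g p.2 = ψ (p.1 + p.2)) :
    ∃ φ : Space d → ℝ, ContinuousOn φ (Metric.ball 0 1) ∧ g =ᵐ[ballMeasure d] φ ∧
      ∀ x y, ‖x‖ < 1 → ‖y‖ < 1 → φ x + φ y = ψ (x + y) := by
  have := neZero_ballMeasure (d := d)
  obtain ⟨x₀, hx₀, hx₀lt⟩ := ((Measure.ae_ae_of_ae_prod hadd).and ballMeasure_ae_norm_lt).exists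
  have hball {x y : Space d} (hx : ‖x‖ < 1) (hy : ‖y‖ < 1) : x + y ∈ Metric.ball (0 : Space d) 2 :=
    mem_ball_zero_iff.2 (by linarith [norm_add_le x y])
  have hgφ : g =ᵐ[ballMeasure d] fun y => ψ (x₀ + y) - g x₀ := by
    filter_upwards [hx₀] with y hy
    linarith
  have hφ : ContinuousOn (fun y => ψ (x₀ + y) - g x₀) (Metric.ball 0 1) :=
    (hψ.comp (by fun_prop) fun y hy => hball hx₀lt (by simpa using hy)).sub continuousOn_const
  refine ⟨_, hφ, hgφ, fun x y hx hy => ?_⟩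
  -- Continuous functions that agree almost everywhere on an open set agree everywhere there.
  refine Measure.eqOn_open_of_ae_eq (μ := volume) (f := fun p : Space d × Space d =>
      ψ (x₀ + p.1) - g x₀ + (ψ (x₀ + p.2) - g x₀)) (g := fun p => ψ (p.1 + p.2)) (x := (x, y)) ?_
    (Metric.isOpen_ball.prod Metric.isOpen_ball)
    ((hφ.comp continuousOn_fst fun p hp => hp.1).add (hφ.comp continuousOn_snd fun p hp => hp.2))
    (hψ.comp (by fun_prop) fun p hp => hball (by simpa using hp.1) (by simpa using hp.2))
    ⟨by simpa using hx, by simpa using hy⟩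
  rw [Measure.volume_eq_prod, ← Measure.prod_restrict, ← ballMeasure_eq_restrict_ball]
  filter_upwards [hadd, Measure.quasiMeasurePreserving_fst.ae hgφ,
    Measure.quasiMeasurePreserving_snd.ae hgφ] with p hp hp1 hp2
  rw [← hp1, ← hp2, hp]

theorem exists_affine_of_add_eq {g ψ : Space d → ℝ} (hψ : ContinuousOn ψ (Metric.ball 0 2))
    (hadd : ∀ᵐ p ∂((ballMeasure d).prod (ballMeasure d)), g p.1 + g p.2 = ψ (p.1 + p.2)) :
    ∃ (α : Space d) (b : ℝ), g =ᵐ[ballMeasure d] fun x => inner ℝ α x + b := by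
  obtain ⟨φ, hφ, hgφ, heq⟩ := exists_continuousOn_ae_eq_of_add_eq hψ hadd
  obtain ⟨T, hT⟩ := exists_continuousLinearMap_of_add_eq heq
    (hφ.continuousAt (Metric.ball_mem_nhds 0 one_pos))
  refine ⟨(InnerProductSpace.toDual ℝ (Space d)).symm T, φ 0, ?_⟩
  filter_upwards [hgφ, ballMeasure_ae_norm_lt] with x hx hlt
  rw [hx, InnerProductSpace.toDual_symm_apply, hT x hlt]

theorem exists_affine_of_quadForm_eq_zero {g : Space d → ℝ} (hg : MemLp g 2 (ballMeasure d))
    (r : ℕ) (hzero : quadForm (2 * r) g = 0) :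
    ∃ (α : Space d) (b : ℝ), g =ᵐ[ballMeasure d] fun x => inner ℝ α x + b := by
  have hpos {s : Space d} (hs : ‖s‖ < 2) : 0 < fiberMass d (2 * r) (-s) :=
    fiberMass_pos _ (by simpa using hs)
  refine exists_affine_of_add_eq
    (ψ := fun s => -linCoeff (signedSeq r g) (2 * r) (-s) / fiberMass d (2 * r) (-s))
    (((continuous_linCoeff (memLp_signedSeq hg r) _).comp continuous_neg).neg.continuousOn.div
      ((continuous_fiberMass _).comp continuous_neg).continuousOn
      fun s hs => (hpos (by simpa using hs)).ne') ?_
  filter_upwards [cauchyDefect_ae_eq_zero hg r hzero,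
    Measure.quasiMeasurePreserving_fst.ae ballMeasure_ae_norm_lt,
    Measure.quasiMeasurePreserving_snd.ae ballMeasure_ae_norm_lt] with p hp hp1 hp2
  rw [cauchyDefect, show 0 - p.1 - p.2 = -(p.1 + p.2) by abel] at hp
  rw [eq_div_iff (hpos ((norm_add_le _ _).trans_lt (by linarith))).ne']
  linarith

theorem fiberQuad_affine {h : ℕ → Space d → ℝ} (hh : ∀ j, MemLp (h j) ∞ (ballMeasure d))
    {α : Space d} {c : ℕ → ℝ} (hα : ∀ j x, h j x = inner ℝ α x + c j) (n : ℕ) (t : ℝ)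
    (s : Space d) :
    fiberQuad h n t s
      = (t + inner ℝ α s + ∑ j ∈ Finset.range (n + 2), c j) ^ 2 * fiberMass d n s := by
  induction n generalizing t s with
  | zero =>
    rw [fiberQuad_zero_eq hh, fiberMass_zero, mul_comm, ← smul_eq_mul,
      ← integral_indicator_const _
        (measurableSet_unitBall.preimage (continuous_sub_left s).measurable)]
    congr 1
    funext z
    by_cases hz : s - z ∈ unitBall d
    · simp only [hz, Set.mem_preimage, Set.indicator_of_mem, hα, Finset.sum_range_succ,
        Finset.sum_range_zero, inner_sub_right]
      ring
    · simp [hz]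
  | succ n ih =>
    rw [fiberQuad_succ hh, fiberMass_succ, ← integral_const_mul]
    congr 1
    funext z
    rw [ih, hα, inner_sub_right, Finset.sum_range_succ _ (n + 2)]
    ring

theorem memLp_top_of_continuous {g : Space d → ℝ} (hg : Continuous g) :
    MemLp g ∞ (ballMeasure d) := by
  obtain ⟨C, hC⟩ := (isCompact_closedBall (0 : Space d) 1).exists_bound_of_continuousOn
    hg.continuousOn
  exact memLp_top_of_bound hg.aestronglyMeasurable C
    ((ae_restrict_mem measurableSet_unitBall).mono fun x hx => hC x hx)

theorem quadForm_affine (r : ℕ) (α : Space d) (b : ℝ) :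
    quadForm (2 * r) (fun x => inner ℝ α x + b) = 0 := by
  have hg : MemLp (fun x => inner ℝ α x + b) ∞ (ballMeasure d) :=
    memLp_top_of_continuous (by fun_prop)
  have hα (j : ℕ) (x : Space d) : signedSeq r (fun x => inner ℝ α x + b) j x
      = inner ℝ α x + signedSeq r (fun _ : Space d => b) j 0 := by
    unfold signedSeq
    split_ifs
    · simp only [inner_neg_right]
      ring
    · rfl
  have hsum : ∑ j ∈ Finset.range (2 * r + 2 + 2), signedSeq r (fun _ : Space d => b) j 0 = 0 := by
    rw [sum_signedSeq r _ fun h => h 0, smul_neg, neg_add_cancel]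
  have hfiber := fiberQuad_affine (memLp_signedSeq hg r) hα (2 * r + 2) 0 0
  rw [fiberQuad_signedSeq_eq hg, hsum] at hfiber
  have hne : (2 * r + 4 : ℝ) ≠ 0 := by positivity
  simpa [hne] using hfiber

section WeakCompactness

variable {H : Type*} [NormedAddCommGroup H] [InnerProductSpace ℝ H] [CompleteSpace H]
  [TopologicalSpace.SeparableSpace H]

theorem exists_weakly_convergent_subseq {x : ℕ → H} (hx : ∀ n, ‖x n‖ ≤ 1) :
    ∃ (y : H) (φ : ℕ → ℕ), StrictMono φ ∧ ‖y‖ ≤ 1 ∧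
      ∀ z, Tendsto (fun n => inner ℝ (x (φ n)) z) atTop (𝓝 (inner ℝ y z)) := by
  obtain ⟨f, hf, φ, hφ, hlim⟩ := WeakDual.isSeqCompact_closedBall ℝ H (0 : StrongDual ℝ H) 1
    (x := fun n => StrongDual.toWeakDual (InnerProductSpace.toDual ℝ H (x n)))
    (fun n => by simpa using hx n)
  refine ⟨(InnerProductSpace.toDual ℝ H).symm (WeakDual.toStrongDual f), φ, hφ, ?_, fun z => ?_⟩
  · rw [LinearIsometryEquiv.norm_map]
    simpa using hf
  · rw [InnerProductSpace.toDual_symm_apply]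
    exact ((WeakDual.eval_continuous (𝕜 := ℝ) (E := H) z).tendsto f).comp hlim

theorem exists_gap_on_unit_vectors {W : Submodule ℝ H} {B : H → ℝ}
    (hB : ∀ (x : ℕ → H) (y : H), (∀ n, ‖x n‖ ≤ 1) →
      (∀ z, Tendsto (fun n => inner ℝ (x n) z) atTop (𝓝 (inner ℝ y z))) →
      Tendsto (fun n => B (x n)) atTop (𝓝 (B y)))
    (hle : ∀ x, B x ≤ ‖x‖ ^ 2) (hker : ∀ x, B x = ‖x‖ ^ 2 → x ∈ W) :
    ∃ c : ℝ, 0 < c ∧ ∀ x ∈ Wᗮ, ‖x‖ = 1 → c ≤ 1 - B x := by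
  by_contra! hcon
  choose x hxW hx1 hxB using fun n : ℕ => hcon (1 / (n + 1)) Nat.one_div_pos_of_nat
  obtain ⟨y, φ, hφ, hy, hlim⟩ := exists_weakly_convergent_subseq fun n => (hx1 n).le
  have hgap : Tendsto (fun n : ℕ => 1 - 1 / ((φ n : ℝ) + 1)) atTop (𝓝 (1 - 0)) :=
    tendsto_const_nhds.sub (tendsto_one_div_add_atTop_nhds_zero_nat.comp hφ.tendsto_atTop)
  have hBy : 1 - 0 ≤ B y := le_of_tendsto_of_tendsto' hgap
    (hB (x ∘ φ) y (fun n => (hx1 _).le) hlim)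
    fun n => sub_le_comm.1 (hxB (φ n)).le
  have hyW : y ∈ W := hker y
    (le_antisymm (hle y) ((pow_le_one₀ (norm_nonneg _) hy).trans (by linarith)))
  have hyy : inner ℝ y y = 0 := tendsto_nhds_unique (hlim y)
    (tendsto_const_nhds.congr fun n => ((Submodule.mem_orthogonal' W _).1 (hxW (φ n)) y hyW).symm)
  rw [real_inner_self_eq_norm_sq] at hyy
  linarith [hle y]

theorem exists_gap_of_weakly_continuous {W : Submodule ℝ H} {B : H → ℝ}
    (hB : ∀ (x : ℕ → H) (y : H), (∀ n, ‖x n‖ ≤ 1) →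
      (∀ z, Tendsto (fun n => inner ℝ (x n) z) atTop (𝓝 (inner ℝ y z))) →
      Tendsto (fun n => B (x n)) atTop (𝓝 (B y)))
    (hhom : ∀ (t : ℝ) (x : H), B (t • x) = t ^ 2 * B x)
    (hle : ∀ x, B x ≤ ‖x‖ ^ 2) (hker : ∀ x, B x = ‖x‖ ^ 2 → x ∈ W) :
    ∃ c : ℝ, 0 < c ∧ ∀ x ∈ Wᗮ, c * ‖x‖ ^ 2 ≤ ‖x‖ ^ 2 - B x := by
  obtain ⟨c, hc, hgap⟩ := exists_gap_on_unit_vectors hB hle hker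
  refine ⟨c, hc, fun x hx => ?_⟩
  rcases eq_or_ne x 0 with rfl | hne
  · simpa using (hhom 0 0).le
  · have hunit := hgap (‖x‖⁻¹ • x) (Wᗮ.smul_mem _ hx)
      (by rw [norm_smul, norm_inv, norm_norm, inv_mul_cancel₀ (norm_ne_zero_iff.2 hne)])
    have hpos : 0 < ‖x‖ ^ 2 := by positivity
    have hscaled := mul_le_mul_of_nonneg_right hunit hpos.le
    rwa [hhom, inv_pow, sub_mul, one_mul, mul_right_comm, inv_mul_cancel₀ hpos.ne', one_mul]
      at hscaled

end WeakCompactness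

theorem quadForm_congr_ae {g h : Space d → ℝ} (N : ℕ) (hgh : g =ᵐ[ballMeasure d] h) :
    quadForm N g = quadForm N h := by
  rw [quadForm, quadForm, rhat_congr_ae hgh]
  congr 1
  refine integral_congr_ae ?_
  filter_upwards [hgh] with x hx
  rw [hx]

theorem quadForm_const_mul (N : ℕ) (t : ℝ) (g : Space d → ℝ) :
    quadForm N (fun x => t * g x) = t ^ 2 * quadForm N g := by
  rw [quadForm, quadForm, mul_sub, ← integral_const_mul, ← integral_const_mul]
  congr 2
  · funext x
    ring
  · funext ξ
    rw [rhat_const_mul, Complex.im_ofReal_mul, Complex.re_ofReal_mul]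
    ring

theorem integrable_fiberMass_mul {u : Space d → ℝ} (n : ℕ) (hu : Integrable u (ballMeasure d)) :
    Integrable (fun x => fiberMass d n x * u x) (ballMeasure d) :=
  hu.bdd_mul (continuous_fiberMass n).aestronglyMeasurable (.of_forall fun x => abs_rinv_le _ x)

theorem integral_add_smul_add_sq_smul {X : Type*} [MeasurableSpace X] {μ : Measure X}
    {a b c : X → ℝ} (ha : Integrable a μ) (hb : Integrable b μ) (hc : Integrable c μ) (t : ℝ) :
    ∫ x, (a x + t * b x + t ^ 2 * c x) ∂μ
      = ∫ x, a x ∂μ + t * ∫ x, b x ∂μ + t ^ 2 * ∫ x, c x ∂μ := by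
  rw [integral_add (ha.fun_add (hb.const_mul t)) (hc.const_mul _),
    integral_add ha (hb.const_mul t), integral_const_mul, integral_const_mul]

theorem integrable_weighted_cross (N : ℕ) {g h : Space d → ℝ} (hg : Integrable g (ballMeasure d))
    (hh : Integrable h (ballMeasure d)) :
    Integrable fun ξ => ‖ballHat d ξ‖ ^ (N + 2)
      * (2 * ((N + 3) * ((rhat g ξ).im * (rhat h ξ).im) + (rhat g ξ).re * (rhat h ξ).re)) := by
  have hpolar := ((integrable_weighted_quad N (hg.add hh)).sub (integrable_weighted_quad N hg)).sub
    (integrable_weighted_quad N hh)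
  refine hpolar.congr (.of_forall fun ξ => ?_)
  have hadd : rhat (g + h) ξ = rhat g ξ + rhat h ξ := rhat_add hg hh ξ
  simp only [Pi.sub_apply, hadd, Complex.add_im, Complex.add_re]
  ring

theorem exists_quadForm_add_smul (N : ℕ) {g h : Space d → ℝ} (hg : MemLp g 2 (ballMeasure d))
    (hh : MemLp h 2 (ballMeasure d)) :
    ∃ b : ℝ, ∀ t : ℝ, quadForm N (fun x => g x + t * h x)
      = quadForm N g + t * b + t ^ 2 * quadForm N h := by
  have hg1 : Integrable g (ballMeasure d) := hg.integrable one_le_two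
  have hh1 : Integrable h (ballMeasure d) := hh.integrable one_le_two
  have hcross : Integrable (fun x => fiberMass d (N + 1) x * (2 * (g x * h x))) (ballMeasure d) :=
    integrable_fiberMass_mul (N + 1) ((hg.integrable_mul hh).const_mul 2)
  have hspace := integral_add_smul_add_sq_smul (integrable_fiberMass_mul (N + 1) hg.integrable_sq)
    hcross (integrable_fiberMass_mul (N + 1) hh.integrable_sq)
  have hfreq := integral_add_smul_add_sq_smul (integrable_weighted_quad N hg1)
    (integrable_weighted_cross N hg1 hh1) (integrable_weighted_quad N hh1)
  refine ⟨(∫ x, fiberMass d (N + 1) x * (2 * (g x * h x)) ∂(ballMeasure d))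
    - ∫ ξ, ‖ballHat d ξ‖ ^ (N + 2)
      * (2 * ((N + 3) * ((rhat g ξ).im * (rhat h ξ).im) + (rhat g ξ).re * (rhat h ξ).re)),
    fun t => ?_⟩
  rw [quadForm, quadForm, quadForm, mul_sub, mul_sub, ← add_sub_add_comm, ← add_sub_add_comm,
    ← hspace, ← hfreq]
  congr 2
  · funext x
    ring
  · funext ξ
    rw [rhat_add hg1 (hh1.const_mul t), rhat_const_mul, Complex.add_im, Complex.add_re,
      Complex.im_ofReal_mul, Complex.re_ofReal_mul]
    ring

theorem quadForm_add_of_eq_zero (r : ℕ) {g h : Space d → ℝ} (hg : MemLp g 2 (ballMeasure d))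
    (hh : MemLp h 2 (ballMeasure d)) (hzero : quadForm (2 * r) h = 0) (t : ℝ) :
    quadForm (2 * r) (fun x => g x + t * h x) = quadForm (2 * r) g := by
  obtain ⟨b, hb⟩ := exists_quadForm_add_smul (2 * r) hg hh
  simp only [hzero, mul_zero, add_zero] at hb
  have hnonneg (s : ℝ) : 0 ≤ quadForm (2 * r) g + s * b :=
    (quadForm_nonneg (hg.add (hh.const_mul s)) r).trans_eq (hb s)
  have hb0 : b = 0 := by
    by_contra hne
    have hneg := hnonneg (-(quadForm (2 * r) g + 1) / b)
    rw [div_mul_cancel₀ _ hne] at hneg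
    linarith
  rw [hb, hb0, mul_zero, add_zero]

theorem kernel_even_eq_fiberMass (r : ℕ) :
    kernel d ((2 * r + 4 : ℕ) : ℝ) = fiberMass d (2 * r + 1) := by
  have hhat : kernelHat d ((2 * r + 4 : ℕ) : ℝ) = fun ξ => ballHat d ξ ^ (2 * r + 1 + 2) := by
    funext ξ
    have hexp : ((2 * r + 4 : ℕ) : ℝ) - 2 = (2 * r + 2 : ℕ) := by
      push_cast
      ring
    have heven := norm_ballHat_pow_even (d := d) (k := 2 * r + 2) ⟨r + 1, by ring⟩ ξ
    rw [kernelHat, hexp, Real.rpow_natCast]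
    exact (congrArg (· * ballHat d ξ) heven).trans (pow_succ _ _).symm
  funext x
  rw [kernel, hhat]
  rfl

theorem exists_fiberMass_lower_bound (n : ℕ) :
    ∃ κ : ℝ, 0 < κ ∧ ∀ x ∈ unitBall d, κ ≤ fiberMass d n x := by
  obtain ⟨x, hx, hmin⟩ := (isCompact_closedBall (0 : Space d) 1).exists_isMinOn
    ⟨0, by simp⟩ (continuous_fiberMass n).continuousOn
  refine ⟨fiberMass d n x, fiberMass_pos n ?_, fun y hy => hmin hy⟩
  have hx1 : ‖x‖ ≤ 1 := by simpa using hx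
  linarith

theorem fiberMass_pos_of_mem (n : ℕ) {x : Space d} (hx : x ∈ unitBall d) : 0 < fiberMass d n x :=
  let ⟨_, hκ, hle⟩ := exists_fiberMass_lower_bound n
  hκ.trans_le (hle x hx)

/-- Division of an element of `L²(𝔹)` by the square root of the kernel, which for an even exponent
is `fiberMass`. -/
def unweight (n : ℕ) (G : Lp ℝ 2 (ballMeasure d)) (x : Space d) : ℝ := G x / √(fiberMass d n x)

theorem memLp_div_sqrt_fiberMass (n : ℕ) {u : Space d → ℝ} (hu : MemLp u 2 (ballMeasure d)) :
    MemLp (fun x => u x / √(fiberMass d n x)) 2 (ballMeasure d) := by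
  obtain ⟨κ, hκ, hle⟩ := exists_fiberMass_lower_bound (d := d) n
  have htop : MemLp (fun x => (√(fiberMass d n x))⁻¹) ∞ (ballMeasure d) := by
    refine memLp_top_of_bound
      (continuous_fiberMass n).sqrt.measurable.inv.aestronglyMeasurable (√κ)⁻¹ ?_
    filter_upwards [ae_restrict_mem measurableSet_unitBall] with x hx
    rw [norm_inv, Real.norm_of_nonneg (Real.sqrt_nonneg _)]
    exact inv_anti₀ (Real.sqrt_pos.2 hκ) (Real.sqrt_le_sqrt (hle x hx))
  simp only [div_eq_mul_inv]
  exact htop.mul (r := 2) hu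

theorem memLp_unweight (n : ℕ) (G : Lp ℝ 2 (ballMeasure d)) :
    MemLp (unweight n G) 2 (ballMeasure d) :=
  memLp_div_sqrt_fiberMass n (Lp.memLp G)

theorem integrable_unweight (n : ℕ) (G : Lp ℝ 2 (ballMeasure d)) :
    Integrable (unweight n G) (ballMeasure d) :=
  (memLp_unweight n G).integrable one_le_two

theorem integral_fiberMass_mul_unweight_sq (n : ℕ) (G : Lp ℝ 2 (ballMeasure d)) :
    ∫ x, fiberMass d n x * unweight n G x ^ 2 ∂(ballMeasure d) = ‖G‖ ^ 2 := by
  rw [← real_inner_self_eq_norm_sq, L2.inner_def]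
  refine integral_congr_ae ?_
  filter_upwards [ae_restrict_mem measurableSet_unitBall] with x hx
  have hpos := fiberMass_pos_of_mem n hx
  rw [unweight, div_pow, Real.sq_sqrt hpos.le, mul_div_cancel₀ _ hpos.ne',
    real_inner_self_eq_norm_sq, Real.norm_eq_abs, sq_abs]

theorem exists_rhat_unweight_eq_inner (n : ℕ) (ξ : Space d) (L : ℂ →L[ℝ] ℝ) :
    ∃ a : Lp ℝ 2 (ballMeasure d), ∀ G : Lp ℝ 2 (ballMeasure d),
      L (rhat (unweight n G) ξ) = inner ℝ G a := by
  set e : Space d → ℂ := fun x => (Real.fourierChar (-inner ℝ x ξ) : ℂ)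
  have hcont : Continuous e := continuous_subtype_val.comp
    (Real.continuous_fourierChar.comp (continuous_id.inner continuous_const).neg)
  have hnorm (x : Space d) : ‖e x‖ ≤ 1 := (Circle.norm_coe _).le
  have hL : MemLp (fun x => L (e x)) 2 (ballMeasure d) :=
    L.comp_memLp' (MemLp.of_bound hcont.aestronglyMeasurable 1 (.of_forall hnorm))
  have hdual := memLp_div_sqrt_fiberMass n hL
  refine ⟨hdual.toLp _, fun G => ?_⟩
  have hint : Integrable (fun x => e x * (unweight n G x : ℂ)) (ballMeasure d) :=
    (integrable_unweight n G).ofReal.bdd_mul hcont.aestronglyMeasurable (.of_forall hnorm)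
  have hrhat : rhat (unweight n G) ξ = ∫ x, e x * (unweight n G x : ℂ) ∂(ballMeasure d) := by
    rw [rhat, hat_apply]
    rfl
  rw [hrhat, L2.inner_def, ← L.integral_comp_comm hint]
  refine integral_congr_ae ?_
  filter_upwards [hdual.coeFn_toLp] with x hx
  have hsmul : e x * (unweight n G x : ℂ) = unweight n G x • e x := by
    rw [Complex.real_smul, mul_comm]
  rw [hx, hsmul, map_smul, unweight, smul_eq_mul, RCLike.inner_apply, conj_trivial]
  ring

/-- The Fourier side of the quadratic form of `unweight G`: it is weakly continuous, being an
integral of squares of bounded linear functionals. -/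
def compactForm (r : ℕ) (G : Lp ℝ 2 (ballMeasure d)) : ℝ :=
  ∫ ξ, ‖ballHat d ξ‖ ^ (2 * r + 2) * (((2 * r : ℕ) + 3) * (rhat (unweight (2 * r + 1) G) ξ).im ^ 2
    + (rhat (unweight (2 * r + 1) G) ξ).re ^ 2)

theorem quadForm_unweight (r : ℕ) (G : Lp ℝ 2 (ballMeasure d)) :
    quadForm (2 * r) (unweight (2 * r + 1) G) = ‖G‖ ^ 2 - compactForm r G := by
  rw [quadForm, compactForm, integral_fiberMass_mul_unweight_sq]

theorem integral_abs_unweight_le {κ : ℝ} (hκ : 0 < κ) {n : ℕ}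
    (hle : ∀ x ∈ unitBall d, κ ≤ fiberMass d n x) {G : Lp ℝ 2 (ballMeasure d)} (hG : ‖G‖ ≤ 1) :
    ∫ x, |unweight n G x| ∂(ballMeasure d) ≤ ballVol d + κ⁻¹ := by
  have hsq := (memLp_unweight n G).integrable_sq
  have hmass := integrable_fiberMass_mul n hsq
  calc ∫ x, |unweight n G x| ∂(ballMeasure d)
    _ ≤ ∫ x, (1 + κ⁻¹ * (fiberMass d n x * unweight n G x ^ 2)) ∂(ballMeasure d) := by
        refine integral_mono_ae (integrable_unweight n G).abs
          ((integrable_const 1).add (hmass.const_mul _)) ?_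
        filter_upwards [ae_restrict_mem measurableSet_unitBall] with x hx
        have hweight : 1 ≤ κ⁻¹ * fiberMass d n x := by
          rw [← div_eq_inv_mul]
          exact (one_le_div hκ).2 (hle x hx)
        have hmul := le_mul_of_one_le_left (sq_nonneg (unweight n G x)) hweight
        rw [mul_assoc] at hmul
        change |unweight n G x| ≤ 1 + κ⁻¹ * (fiberMass d n x * unweight n G x ^ 2)
        nlinarith [sq_nonneg (|unweight n G x| - 1), sq_abs (unweight n G x)]
    _ = ballVol d + κ⁻¹ * ‖G‖ ^ 2 := by
        rw [integral_add (integrable_const 1) (hmass.const_mul _), integral_const_mul,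
          integral_fiberMass_mul_unweight_sq, integral_const, smul_eq_mul, mul_one,
          ballVol]
    _ ≤ ballVol d + κ⁻¹ := by
        gcongr
        exact mul_le_of_le_one_right (by positivity) (pow_le_one₀ (norm_nonneg G) hG)

theorem tendsto_compactForm (r : ℕ) {x : ℕ → Lp ℝ 2 (ballMeasure d)} {y : Lp ℝ 2 (ballMeasure d)}
    (hx : ∀ n, ‖x n‖ ≤ 1)
    (hlim : ∀ z, Tendsto (fun n => inner ℝ (x n) z) atTop (𝓝 (inner ℝ y z))) :
    Tendsto (fun n => compactForm r (x n)) atTop (𝓝 (compactForm r y)) := by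
  obtain ⟨κ, hκ, hle⟩ := exists_fiberMass_lower_bound (d := d) (2 * r + 1)
  refine tendsto_integral_of_dominated_convergence
    (fun ξ => ‖ballHat d ξ‖ ^ (2 * r + 2) * (((2 * r : ℕ) + 3) * (ballVol d + κ⁻¹) ^ 2))
    (fun n => (integrable_weighted_quad (2 * r) (integrable_unweight _ (x n))).1)
    ((integrable_norm_ballHat_pow (2 * r)).mul_const _)
    (fun n => .of_forall fun ξ => ?_) (.of_forall fun ξ => ?_)
  · rw [norm_mul, norm_pow, norm_norm]
    gcongr
    exact abs_mul_im_sq_add_re_sq_le (by linarith [Nat.cast_nonneg (α := ℝ) (2 * r)])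
      ((norm_rhat_le _ _).trans (integral_abs_unweight_le hκ hle (hx n)))
  · obtain ⟨a, ha⟩ := exists_rhat_unweight_eq_inner (2 * r + 1) ξ Complex.reCLM
    obtain ⟨b, hb⟩ := exists_rhat_unweight_eq_inner (2 * r + 1) ξ Complex.imCLM
    simp only [Complex.reCLM_apply] at ha
    simp only [Complex.imCLM_apply] at hb
    simp only [ha, hb]
    exact ((((hlim b).pow 2).const_mul _).add ((hlim a).pow 2)).const_mul _

theorem compactForm_smul (r : ℕ) (t : ℝ) (G : Lp ℝ 2 (ballMeasure d)) :
    compactForm r (t • G) = t ^ 2 * compactForm r G := by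
  have hae : unweight (2 * r + 1) (t • G) =ᵐ[ballMeasure d]
      fun x => t * unweight (2 * r + 1) G x := by
    filter_upwards [Lp.coeFn_smul t G] with x hx
    simp only [unweight, hx, Pi.smul_apply, smul_eq_mul, mul_div_assoc]
  have hquad := quadForm_congr_ae (2 * r) hae
  rw [quadForm_const_mul, quadForm_unweight, quadForm_unweight, norm_smul, mul_pow,
    Real.norm_eq_abs, sq_abs] at hquad
  linarith

theorem weighted_coeFn_even (r : ℕ) {g : Space d → ℝ} (hg : MemLp g 2 (ballMeasure d)) :
    weighted d ((2 * r + 4 : ℕ) : ℝ) g hg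
      =ᵐ[ballMeasure d] fun x => √(fiberMass d (2 * r + 1) x) * g x := by
  rw [weighted, ← kernel_even_eq_fiberMass]
  exact MemLp.coeFn_toLp _

theorem mem_affineSubspace_of_unweight (r : ℕ) {G : Lp ℝ 2 (ballMeasure d)} {α : Space d} {b : ℝ}
    (hG : unweight (2 * r + 1) G =ᵐ[ballMeasure d] fun x => inner ℝ α x + b) :
    G ∈ affineSubspace d ((2 * r + 4 : ℕ) : ℝ) := by
  refine ⟨(α, b), Lp.ext ?_⟩
  filter_upwards [weighted_coeFn_even r (memLp_affine d (α, b)), hG,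
    ae_restrict_mem measurableSet_unitBall] with x hweighted haffine hx
  have hpos := Real.sqrt_pos.2 (fiberMass_pos_of_mem (2 * r + 1) hx)
  refine hweighted.trans ?_
  simp only [← haffine, unweight]
  field_simp

theorem exists_gap_compactForm (r : ℕ) :
    ∃ c : ℝ, 0 < c ∧ ∀ G ∈ (affineSubspace d ((2 * r + 4 : ℕ) : ℝ))ᗮ,
      c * ‖G‖ ^ 2 ≤ ‖G‖ ^ 2 - compactForm r G := by
  have : Fact ((2 : ℝ≥0∞) ≠ ∞) := ⟨by norm_num⟩
  refine exists_gap_of_weakly_continuous (fun x y hx hlim => tendsto_compactForm r hx hlim)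
    (compactForm_smul r) (fun G => ?_) fun G hG => ?_
  · rw [← sub_nonneg, ← quadForm_unweight]
    exact quadForm_nonneg (memLp_unweight (2 * r + 1) G) r
  · have hzero : quadForm (2 * r) (unweight (2 * r + 1) G) = 0 := by
      rw [quadForm_unweight, hG, sub_self]
    obtain ⟨α, b, haffine⟩ := exists_affine_of_quadForm_eq_zero (memLp_unweight _ G) r hzero
    exact mem_affineSubspace_of_unweight r haffine

/-- The squared distance in `L²(𝔹)` from `K_q^{1/2} g` to the space `𝓗` of the functions
`K_q^{1/2} (α · x + b)`. -/
def affineDefect (q : ℝ) {g : Space d → ℝ} (hg : MemLp g 2 (ballMeasure d)) : ℝ :=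
  ‖weighted d q g hg - (affineSubspace d q).starProjection (weighted d q g hg)‖ ^ 2

theorem exists_quadForm_gap (r : ℕ) :
    ∃ c : ℝ, 0 < c ∧ ∀ (g : Space d → ℝ) (hg : MemLp g 2 (ballMeasure d)),
      c * affineDefect ((2 * r + 4 : ℕ) : ℝ) hg ≤ quadForm (2 * r) g := by
  obtain ⟨c, hc, hgap⟩ := exists_gap_compactForm (d := d) r
  refine ⟨c, hc, fun g hg => ?_⟩
  set G := weighted d ((2 * r + 4 : ℕ) : ℝ) g hg
  set W := affineSubspace d ((2 * r + 4 : ℕ) : ℝ)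
  obtain ⟨p, hp⟩ : W.starProjection G ∈ W := Submodule.starProjection_apply_mem _ _
  have hGgap := hgap _ (Submodule.sub_starProjection_mem_orthogonal (K := W) G)
  rw [← quadForm_unweight] at hGgap
  have hproj : W.starProjection G =ᵐ[ballMeasure d]
      fun x => √(fiberMass d (2 * r + 1) x) * (inner ℝ p.1 x + p.2) := by
    rw [← hp]
    exact weighted_coeFn_even r (memLp_affine d p)
  have hae : unweight (2 * r + 1) (G - W.starProjection G) =ᵐ[ballMeasure d]
      fun x => g x + (-1) * (inner ℝ p.1 x + p.2) := by
    filter_upwards [Lp.coeFn_sub G (W.starProjection G), weighted_coeFn_even r hg, hproj,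
      ae_restrict_mem measurableSet_unitBall] with x hsub hGx hprojx hx
    have hpos := Real.sqrt_pos.2 (fiberMass_pos_of_mem (2 * r + 1) hx)
    rw [unweight, hsub, Pi.sub_apply, hprojx, hGx]
    field_simp
    ring
  rw [quadForm_congr_ae _ hae,
    quadForm_add_of_eq_zero r hg (memLp_affine d p) (quadForm_affine r p.1 p.2) (-1)] at hGgap
  exact hGgap

section Taylor

theorem abs_sub_taylor_two_le {f f' f'' f''' : ℝ → ℝ} {C s : ℝ}
    (hf : ∀ x ∈ Set.uIcc 0 s, HasDerivAt f (f' x) x)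
    (hf' : ∀ x ∈ Set.uIcc 0 s, HasDerivAt f' (f'' x) x)
    (hf'' : ∀ x ∈ Set.uIcc 0 s, HasDerivAt f'' (f''' x) x)
    (hC : ∀ x ∈ Set.uIcc 0 s, |f''' x| ≤ C) :
    |f s - (f 0 + f' 0 * s + f'' 0 / 2 * s ^ 2)| ≤ C * |s| ^ 3 := by
  have hconv : Convex ℝ (Set.uIcc 0 s) := convex_uIcc 0 s
  have h0 : (0 : ℝ) ∈ Set.uIcc 0 s := Set.left_mem_uIcc
  have hC0 : 0 ≤ C := (abs_nonneg _).trans (hC 0 h0)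
  have habs (x) (hx : x ∈ Set.uIcc 0 s) : |x| ≤ |s| := by
    simpa using Set.abs_sub_left_of_mem_uIcc hx
  have hbound'' (x) (hx : x ∈ Set.uIcc 0 s) : |f'' x - f'' 0| ≤ C * |s| := by
    have := hconv.norm_image_sub_le_of_norm_hasDerivWithin_le
      (fun y hy => (hf'' y hy).hasDerivWithinAt) hC h0 hx
    rw [sub_zero] at this
    exact this.trans (mul_le_mul_of_nonneg_left (habs x hx) hC0)
  have hbound' (x) (hx : x ∈ Set.uIcc 0 s) : |f' x - f'' 0 * x - f' 0| ≤ C * |s| ^ 2 := by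
    have hderiv (y) (hy : y ∈ Set.uIcc 0 s) : HasDerivWithinAt (fun y => f' y - f'' 0 * y)
        (f'' y - f'' 0) (Set.uIcc 0 s) y :=
      ((hf' y hy).sub ((hasDerivAt_id y).const_mul (f'' 0))).hasDerivWithinAt.congr_deriv
        (by simp)
    have := hconv.norm_image_sub_le_of_norm_hasDerivWithin_le hderiv hbound'' h0 hx
    rw [sub_zero, mul_zero, sub_zero] at this
    refine this.trans ((mul_le_mul_of_nonneg_left (habs x hx) (by positivity)).trans_eq ?_)
    rw [mul_assoc, pow_two]
  have hderiv (y) (hy : y ∈ Set.uIcc 0 s) : HasDerivWithinAt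
      (fun y => f y - f' 0 * y - f'' 0 / 2 * y ^ 2) (f' y - f'' 0 * y - f' 0)
      (Set.uIcc 0 s) y := by
    refine ((((hf y hy).sub ((hasDerivAt_id y).const_mul (f' 0))).sub
      ((hasDerivAt_pow 2 y).const_mul (f'' 0 / 2))).hasDerivWithinAt).congr_deriv ?_
    norm_num
    ring
  have hfinal := hconv.norm_image_sub_le_of_norm_hasDerivWithin_le hderiv hbound' h0
    Set.right_mem_uIcc
  rw [Real.norm_eq_abs, sub_zero, Real.norm_eq_abs] at hfinal
  calc |f s - (f 0 + f' 0 * s + f'' 0 / 2 * s ^ 2)|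
      = |f s - f' 0 * s - f'' 0 / 2 * s ^ 2 - (f 0 - f' 0 * 0 - f'' 0 / 2 * 0 ^ 2)| := by
        congr 1; ring
    _ ≤ C * |s| ^ 2 * |s| := hfinal
    _ = C * |s| ^ 3 := by ring

theorem rpow_le_four_rpow_abs {y e : ℝ} (hy : 1 / 4 ≤ y) (hy4 : y ≤ 4) : y ^ e ≤ 4 ^ |e| := by
  have hy0 : 0 < y := by linarith
  rcases le_total 0 e with he | he
  · rw [abs_of_nonneg he]
    exact Real.rpow_le_rpow hy0.le hy4 he
  · rw [abs_of_nonpos he, ← neg_neg e, Real.rpow_neg hy0.le, ← Real.inv_rpow hy0.le, neg_neg]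
    refine Real.rpow_le_rpow (by positivity) ?_ (by linarith)
    rw [inv_le_comm₀ hy0 (by norm_num)]
    linarith

theorem exists_one_add_rpow_le {P : ℝ} (hP : 0 ≤ P) :
    ∃ C : ℝ, 0 ≤ C ∧ ∀ p s : ℝ, 1 ≤ p → p ≤ P → -(3 / 4) ≤ s → s ≤ 3 →
      (1 + s) ^ p ≤ 1 + p * s + p * (p - 1) / 2 * s ^ 2 + C * |s| ^ 3 := by
  refine ⟨P * P * (P + 2) * 4 ^ (P + 2), by positivity, fun p s hp hpP hs hs3 => ?_⟩
  have hmem (x) (hx : x ∈ Set.uIcc 0 s) : 1 / 4 ≤ 1 + x ∧ 1 + x ≤ 4 := by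
    rcases Set.mem_uIcc.1 hx with h | h <;> constructor <;> linarith
  have hderiv (c e x : ℝ) (hx : x ∈ Set.uIcc 0 s) :
      HasDerivAt (fun x => c * (1 + x) ^ e) (c * e * (1 + x) ^ (e - 1)) x := by
    have hne : 1 + id x ≠ 0 := by have := (hmem x hx).1; simp only [id]; linarith
    refine ((((hasDerivAt_id x).const_add 1).rpow_const (Or.inl hne)).const_mul c).congr_deriv ?_
    simp only [id]
    ring
  have hthird (x) (hx : x ∈ Set.uIcc 0 s) :
      |1 * p * (p - 1) * (p - 1 - 1) * (1 + x) ^ (p - 1 - 1 - 1)|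
        ≤ P * P * (P + 2) * 4 ^ (P + 2) := by
    obtain ⟨hlow, hup⟩ := hmem x hx
    have hexp : |p - 1 - 1 - 1| ≤ P + 2 := by rw [abs_le]; constructor <;> linarith
    rw [abs_mul, abs_mul, abs_mul, one_mul, abs_of_nonneg (Real.rpow_nonneg (by linarith) _)]
    gcongr
    · rw [abs_le]; constructor <;> linarith
    · rw [abs_le]; constructor <;> linarith
    · rw [abs_le]; constructor <;> linarith
    · exact (rpow_le_four_rpow_abs hlow hup).trans
        (Real.rpow_le_rpow_of_exponent_le (by norm_num) hexp)
  have htaylor := (abs_le.1 (abs_sub_taylor_two_le (hderiv 1 p) (hderiv (1 * p) (p - 1))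
    (hderiv (1 * p * (p - 1)) (p - 1 - 1)) hthird)).2
  simp only [add_zero, Real.one_rpow, one_mul, mul_one] at htaylor
  linarith

theorem rpow_eq_rpow_sub_mul_pow {x q : ℝ} {n : ℕ} (hx : 0 ≤ x) (hq : q ≠ 0) :
    x ^ q = x ^ (q - n) * x ^ n := by
  rw [← Real.rpow_add_natCast' hx (by rwa [sub_add_cancel]), sub_add_cancel]

theorem rpow_le_rpow_of_le_of_one_le {x M e Q : ℝ} (hx : 0 ≤ x) (hxM : x ≤ M) (hM : 1 ≤ M)
    (he : 0 ≤ e) (heQ : e ≤ Q) : x ^ e ≤ M ^ Q :=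
  (Real.rpow_le_rpow hx hxM he).trans (Real.rpow_le_rpow_of_exponent_le hM heQ)

theorem exists_norm_one_add_rpow_le {Q : ℝ} (hQ : 0 ≤ Q) :
    ∃ C : ℝ, 0 ≤ C ∧ ∀ (q : ℝ) (w : ℂ), 2 ≤ q → q ≤ Q → ‖w‖ ≤ 1 / 2 →
      ‖1 + w‖ ^ q ≤ 1 + q * w.re + q / 2 * ((q - 1) * w.re ^ 2 + w.im ^ 2) + C * ‖w‖ ^ 3 := by
  obtain ⟨A, hA, htaylor⟩ := exists_one_add_rpow_le (div_nonneg hQ zero_le_two)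
  refine ⟨A * 16 + 5 * Q * Q, by positivity, fun q w hq hqQ hw => ?_⟩
  have hnormSq : ‖w‖ ^ 2 = w.re ^ 2 + w.im ^ 2 := by
    rw [← Complex.normSq_eq_norm_sq, Complex.normSq_apply]; ring
  obtain ⟨hre, hre'⟩ := abs_le.1 (Complex.abs_re_le_norm w)
  set r := ‖w‖
  set s := 2 * w.re + r ^ 2 with hs
  have hnorm : ‖1 + w‖ ^ 2 = 1 + s := by
    rw [← Complex.normSq_eq_norm_sq, Complex.normSq_apply, hs, hnormSq]
    simp only [Complex.add_re, Complex.add_im, Complex.one_re, Complex.one_im]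
    ring
  have hpow : ‖1 + w‖ ^ q = (1 + s) ^ (q / 2) := by
    rw [← hnorm, ← Real.rpow_natCast, ← Real.rpow_mul (norm_nonneg _)]
    congr 1
    push_cast
    ring
  have habs : |s| ≤ 5 / 2 * r := by rw [abs_le]; constructor <;> nlinarith
  have hcube : |s| ^ 3 ≤ 16 * r ^ 3 := by
    calc |s| ^ 3 ≤ (5 / 2 * r) ^ 3 := by gcongr
      _ = 125 / 8 * r ^ 3 := by ring
      _ ≤ 16 * r ^ 3 := by gcongr; norm_num
  have hsq : s ^ 2 ≤ 4 * w.re ^ 2 + 5 * r ^ 3 := by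
    have hcross : w.re * r ^ 2 ≤ r * r ^ 2 := by gcongr
    have hfourth : r * r ^ 3 ≤ 1 * r ^ 3 := by gcongr; linarith
    linear_combination 4 * hcross + hfourth
  have hcoeff : 0 ≤ q / 2 * (q / 2 - 1) / 2 := by
    have : 0 ≤ q / 2 - 1 := by linarith
    positivity
  have hcoeffQ : q / 2 * (q / 2 - 1) / 2 ≤ Q * Q := by nlinarith only [hq, hqQ]
  have hremainder := mul_le_mul_of_nonneg_right hcoeffQ (by positivity : 0 ≤ 5 * r ^ 3)
  rw [hpow]
  calc (1 + s) ^ (q / 2) ≤ 1 + q / 2 * s + q / 2 * (q / 2 - 1) / 2 * s ^ 2 + A * |s| ^ 3 :=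
        htaylor _ _ (by linarith) (by linarith) (by nlinarith) (by nlinarith)
    _ ≤ 1 + q / 2 * s + q / 2 * (q / 2 - 1) / 2 * (4 * w.re ^ 2 + 5 * r ^ 3)
        + A * (16 * r ^ 3) := by gcongr
    _ ≤ _ := by linear_combination hremainder + q / 2 * (hs + hnormSq)

theorem norm_add_rpow_le_of_norm_one_add {C M q Q x : ℝ} {w : ℂ} (hC : 0 ≤ C) (hM : 1 ≤ M)
    (hq : 3 ≤ q) (hqQ : q ≤ Q) (hxM : |x| ≤ M)
    (hw : ‖1 + w‖ ^ q ≤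
      1 + q * w.re + q / 2 * ((q - 1) * w.re ^ 2 + w.im ^ 2) + C * ‖w‖ ^ 3) :
    ‖(x : ℂ) + x * w‖ ^ q ≤ |x| ^ q + q * |x| ^ (q - 2) * x * (x * w).re
      + q / 2 * |x| ^ (q - 2) * ((q - 1) * (x * w).re ^ 2 + (x * w).im ^ 2)
      + C * M ^ Q * ‖x * w‖ ^ 3 := by
  have hnorm : ‖(x : ℂ) + x * w‖ ^ q = |x| ^ q * ‖1 + w‖ ^ q := by
    rw [← mul_one_add, norm_mul, Complex.norm_real, Real.norm_eq_abs,
      Real.mul_rpow (abs_nonneg x) (norm_nonneg _)]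
  have hsq : |x| ^ q = |x| ^ (q - 2) * x ^ 2 := by
    rw [← sq_abs]
    exact_mod_cast rpow_eq_rpow_sub_mul_pow (n := 2) (abs_nonneg x) (by linarith)
  have hcube : |x| ^ q = |x| ^ (q - 3) * |x| ^ 3 := by
    exact_mod_cast rpow_eq_rpow_sub_mul_pow (n := 3) (abs_nonneg x) (by linarith)
  have hle : |x| ^ (q - 3) ≤ M ^ Q :=
    rpow_le_rpow_of_le_of_one_le (abs_nonneg x) hxM hM (by linarith) (by linarith)
  rw [hnorm, Complex.re_ofReal_mul, Complex.im_ofReal_mul, norm_mul, Complex.norm_real,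
    Real.norm_eq_abs]
  calc |x| ^ q * ‖1 + w‖ ^ q
      ≤ |x| ^ q * (1 + q * w.re + q / 2 * ((q - 1) * w.re ^ 2 + w.im ^ 2) + C * ‖w‖ ^ 3) := by
        gcongr
    _ = |x| ^ q + |x| ^ q * (q * w.re + q / 2 * ((q - 1) * w.re ^ 2 + w.im ^ 2))
        + C * |x| ^ q * ‖w‖ ^ 3 := by ring
    _ = |x| ^ q + |x| ^ (q - 2) * x ^ 2 * (q * w.re + q / 2 * ((q - 1) * w.re ^ 2 + w.im ^ 2))
        + C * |x| ^ (q - 3) * (|x| * ‖w‖) ^ 3 := by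
        nth_rw 2 [hsq]
        nth_rw 2 [hcube]
        ring
    _ ≤ |x| ^ q + |x| ^ (q - 2) * x ^ 2 * (q * w.re + q / 2 * ((q - 1) * w.re ^ 2 + w.im ^ 2))
        + C * M ^ Q * (|x| * ‖w‖) ^ 3 := by gcongr
    _ = _ := by ring

theorem norm_add_rpow_le_of_abs_le {M Q q x : ℝ} {z : ℂ} (hM : 1 ≤ M) (hq : 3 ≤ q) (hqQ : q ≤ Q)
    (hzM : ‖z‖ ≤ M) (hxz : |x| ≤ 2 * ‖z‖) :
    ‖(x : ℂ) + z‖ ^ q ≤ |x| ^ q + q * |x| ^ (q - 2) * x * z.re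
      + q / 2 * |x| ^ (q - 2) * ((q - 1) * z.re ^ 2 + z.im ^ 2)
      + (3 ^ Q + Q * 2 ^ Q) * M ^ Q * ‖z‖ ^ 3 := by
  have hQ : 0 ≤ Q := by linarith
  have hq1 : 0 ≤ q - 1 := by linarith
  have hz := norm_nonneg z
  have hzq : ‖z‖ ^ q ≤ M ^ Q * ‖z‖ ^ 3 := by
    rw [rpow_eq_rpow_sub_mul_pow (n := 3) hz (by linarith)]
    gcongr
    exact rpow_le_rpow_of_le_of_one_le hz hzM hM (by push_cast; linarith) (by push_cast; linarith)
  have hsum : ‖(x : ℂ) + z‖ ≤ 3 * ‖z‖ := by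
    refine (norm_add_le _ _).trans ?_
    rw [Complex.norm_real, Real.norm_eq_abs]
    linarith
  have hleft : ‖(x : ℂ) + z‖ ^ q ≤ 3 ^ Q * ‖z‖ ^ q := by
    refine (Real.rpow_le_rpow (norm_nonneg _) hsum (by linarith)).trans ?_
    rw [Real.mul_rpow (by norm_num) hz]
    gcongr
    norm_num
  have hlinear : |q * |x| ^ (q - 2) * x * z.re| ≤ Q * 2 ^ Q * ‖z‖ ^ q := by
    calc |q * |x| ^ (q - 2) * x * z.re| = q * (|x| ^ (q - 2) * |x|) * |z.re| := by
          rw [abs_mul, abs_mul, abs_mul, abs_of_nonneg (by linarith : (0 : ℝ) ≤ q),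
            abs_of_nonneg (by positivity : 0 ≤ |x| ^ (q - 2))]
          ring
      _ = q * |x| ^ (q - 1) * |z.re| := by
          rw [← Real.rpow_add_one' (abs_nonneg x) (by linarith)]
          ring_nf
      _ ≤ Q * (2 ^ Q * ‖z‖ ^ (q - 1)) * ‖z‖ := by
          gcongr
          · refine (Real.rpow_le_rpow (abs_nonneg x) hxz hq1).trans ?_
            rw [Real.mul_rpow (by norm_num) hz]
            gcongr
            · norm_num
            · linarith
          · exact Complex.abs_re_le_norm z
      _ = Q * 2 ^ Q * (‖z‖ ^ (q - 1) * ‖z‖) := by ring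
      _ = Q * 2 ^ Q * ‖z‖ ^ q := by
          rw [← Real.rpow_add_one' hz (by linarith), sub_add_cancel]
  have hquad : 0 ≤ q / 2 * |x| ^ (q - 2) * ((q - 1) * z.re ^ 2 + z.im ^ 2) := by positivity
  have hxq : 0 ≤ |x| ^ q := by positivity
  have hfactor : 0 ≤ 3 ^ Q + Q * 2 ^ Q := by positivity
  linarith [(abs_le.1 hlinear).1, mul_le_mul_of_nonneg_left hzq hfactor]

theorem exists_norm_add_rpow_le {M Q : ℝ} (hM : 1 ≤ M) (hQ : 0 ≤ Q) :
    ∃ C : ℝ, 0 ≤ C ∧ ∀ (q x : ℝ) (z : ℂ), 3 ≤ q → q ≤ Q → |x| ≤ M → ‖z‖ ≤ M →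
      ‖(x : ℂ) + z‖ ^ q ≤ |x| ^ q + q * |x| ^ (q - 2) * x * z.re
        + q / 2 * |x| ^ (q - 2) * ((q - 1) * z.re ^ 2 + z.im ^ 2) + C * ‖z‖ ^ 3 := by
  obtain ⟨A, hA, hexpand⟩ := exists_norm_one_add_rpow_le hQ
  have hlarge : 0 ≤ (3 ^ Q + Q * 2 ^ Q) * M ^ Q := by positivity
  have hsmall : 0 ≤ A * M ^ Q := by positivity
  refine ⟨_, add_nonneg hlarge hsmall, fun q x z hq hqQ hxM hzM => ?_⟩
  have hz3 : 0 ≤ ‖z‖ ^ 3 := by positivity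
  rcases lt_or_ge (2 * ‖z‖) |x| with hzx | hxz
  · have hx : 0 < |x| := (by positivity : 0 ≤ 2 * ‖z‖).trans_lt hzx
    have hw : ‖z / x‖ ≤ 1 / 2 := by
      rw [norm_div, Complex.norm_real, Real.norm_eq_abs, div_le_iff₀ hx]
      linarith
    have h := norm_add_rpow_le_of_norm_one_add hA hM hq hqQ hxM
      (hexpand q (z / x) (by linarith) hqQ hw)
    rw [mul_div_cancel₀ z (Complex.ofReal_ne_zero.2 (abs_pos.1 hx))] at h
    linarith [mul_nonneg hlarge hz3]
  · linarith [norm_add_rpow_le_of_abs_le hM hq hqQ hzM hxz, mul_nonneg hsmall hz3]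

end Taylor

section Powers

theorem abs_exp_sub_exp_le (u v : ℝ) :
    |Real.exp u - Real.exp v| ≤ |u - v| * (Real.exp u + Real.exp v) := by
  have hle (u v : ℝ) : Real.exp u - Real.exp v ≤ |u - v| * (Real.exp u + Real.exp v) := by
    have hmul : Real.exp v = Real.exp u * Real.exp (v - u) := by rw [← Real.exp_add]; ring_nf
    have htangent := mul_le_mul_of_nonneg_left (Real.add_one_le_exp (v - u)) (Real.exp_pos u).le
    have habs := mul_le_mul_of_nonneg_right (le_abs_self (u - v)) (Real.exp_pos u).le
    have := mul_nonneg (abs_nonneg (u - v)) (Real.exp_pos v).le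
    linarith
  refine abs_sub_le_iff.2 ⟨hle u v, ?_⟩
  rw [abs_sub_comm, add_comm]
  exact hle v u

theorem rpow_mul_abs_log_le {M S x e : ℝ} (hM : 1 ≤ M) (hx : 0 < x) (hxM : x ≤ M)
    (he : 1 / 2 ≤ e) (heS : e ≤ S) : x ^ e * |Real.log x| ≤ 2 + M ^ S * M := by
  have hMS : 0 ≤ M ^ S * M := by positivity
  rcases le_total x 1 with hx1 | hx1
  · have hlog := Real.abs_log_mul_self_rpow_lt x (1 / 2) hx hx1 (by norm_num)
    rw [abs_mul, abs_of_nonneg (Real.rpow_nonneg hx.le _)] at hlog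
    have hpow : x ^ e ≤ x ^ (1 / 2 : ℝ) := Real.rpow_le_rpow_of_exponent_ge hx hx1 he
    linarith [mul_le_mul_of_nonneg_right hpow (abs_nonneg (Real.log x))]
  · rw [abs_of_nonneg (Real.log_nonneg hx1)]
    have hpow : x ^ e ≤ M ^ S := rpow_le_rpow_of_le_of_one_le hx.le hxM hM (by linarith) heS
    have hlog : Real.log x ≤ M := (Real.log_le_self hx.le).trans hxM
    linarith [mul_le_mul hpow hlog (Real.log_nonneg hx1) (by positivity)]

theorem abs_rpow_sub_rpow_le {M S σ s s' x : ℝ} (hM : 1 ≤ M) (hx : 0 ≤ x) (hxM : x ≤ M)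
    (hσ : 0 ≤ σ) (hs : σ + 1 / 2 ≤ s) (hsS : s ≤ S) (hs' : σ + 1 / 2 ≤ s') (hsS' : s' ≤ S) :
    |x ^ s - x ^ s'| ≤ 2 * (2 + M ^ S * M) * |s - s'| * x ^ σ := by
  rcases hx.eq_or_lt' with rfl | hx0
  · rw [Real.zero_rpow (by linarith), Real.zero_rpow (by linarith), sub_zero, abs_zero]
    positivity
  · have hlog (e : ℝ) (he : σ + 1 / 2 ≤ e) (heS : e ≤ S) :
        |Real.log x| * x ^ e ≤ (2 + M ^ S * M) * x ^ σ := by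
      have hbound := rpow_mul_abs_log_le (S := S) (e := e - σ) hM hx0 hxM (by linarith)
        (by linarith)
      calc |Real.log x| * x ^ e = x ^ (e - σ) * |Real.log x| * x ^ σ := by
            rw [← sub_add_cancel e σ, Real.rpow_add hx0, add_sub_cancel_right]; ring
        _ ≤ (2 + M ^ S * M) * x ^ σ := by gcongr
    have hexp := abs_exp_sub_exp_le (Real.log x * s) (Real.log x * s')
    rw [← Real.rpow_def_of_pos hx0, ← Real.rpow_def_of_pos hx0, ← mul_sub, abs_mul] at hexp
    calc |x ^ s - x ^ s'| ≤ |Real.log x| * |s - s'| * (x ^ s + x ^ s') := hexp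
      _ = |s - s'| * (|Real.log x| * x ^ s + |Real.log x| * x ^ s') := by ring
      _ ≤ |s - s'| * ((2 + M ^ S * M) * x ^ σ + (2 + M ^ S * M) * x ^ σ) :=
          mul_le_mul_of_nonneg_left (add_le_add (hlog s hs hsS) (hlog s' hs' hsS'))
            (abs_nonneg _)
      _ = _ := by ring

end Powers

section Integrals

variable {X : Type*} [MeasurableSpace X] {μ : Measure X}

theorem integral_mul_le_sqrt_mul_sqrt {a b : X → ℝ} (ha : MemLp a 2 μ) (hb : MemLp b 2 μ)
    (ha0 : ∀ x, 0 ≤ a x) (hb0 : ∀ x, 0 ≤ b x) :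
    ∫ x, a x * b x ∂μ ≤ √(∫ x, a x ^ 2 ∂μ) * √(∫ x, b x ^ 2 ∂μ) := by
  have hholder := integral_mul_le_Lp_mul_Lq_of_nonneg (p := 2) (q := 2) (μ := μ)
    Real.HolderConjugate.two_two (.of_forall ha0) (.of_forall hb0) (by simpa using ha)
    (by simpa using hb)
  simpa [Real.sqrt_eq_rpow] using hholder

variable {E : Type*} [NormedAddCommGroup E] {v : X → E}

theorem integrable_norm_rpow_of_bound {B q : ℝ} (hv : MemLp v 2 μ) (hB : ∀ x, ‖v x‖ ≤ B)
    (hq : 2 ≤ q) : Integrable (fun x => ‖v x‖ ^ q) μ := by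
  refine (hv.norm.integrable_sq.const_mul (B ^ (q - 2))).mono'
    ((Real.continuous_rpow_const (by linarith)).comp_aestronglyMeasurable hv.1.norm)
    (.of_forall fun x => ?_)
  have hpow : ‖v x‖ ^ q = ‖v x‖ ^ (q - 2) * ‖v x‖ ^ 2 := by
    exact_mod_cast rpow_eq_rpow_sub_mul_pow (n := 2) (norm_nonneg _) (by linarith)
  rw [Real.norm_of_nonneg (by positivity), hpow]
  gcongr
  exact hB x

theorem memLp_of_bound {B q : ℝ} (hv : MemLp v 2 μ) (hB : ∀ x, ‖v x‖ ≤ B) (hq : 2 ≤ q) :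
    MemLp v (ENNReal.ofReal q) μ := by
  rw [← integrable_norm_rpow_iff hv.1 (by simp; linarith) (by simp),
    ENNReal.toReal_ofReal (by linarith)]
  exact integrable_norm_rpow_of_bound hv hB hq

theorem lpNorm_rpow_eq_integral {q : ℝ} (hv : AEStronglyMeasurable v μ) (hq : 0 < q) :
    lpNorm v (ENNReal.ofReal q) μ ^ q = ∫ x, ‖v x‖ ^ q ∂μ := by
  rw [lpNorm_eq_integral_norm_rpow_toReal (by simpa using hq) (by simp) hv,
    ENNReal.toReal_ofReal hq.le, ← Real.rpow_mul (integral_nonneg fun _ => by positivity),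
    inv_mul_cancel₀ hq.ne', Real.rpow_one]

end Integrals

section SecondOrder

variable {M S e q : ℝ} {u v : Space d → ℂ}

theorem integral_norm_sq_ballHat : ∫ ξ, ‖ballHat d ξ‖ ^ 2 = ballVol d := by
  rw [← rhat_one, rhat, integral_norm_sq_hat (memLp_const _)]
  simp [ballVol]

theorem norm_ballHat_rpow_le (hM : 1 ≤ M) (hvol : ballVol d ≤ M) (he : 1 ≤ e) (heS : e ≤ S)
    (ξ : Space d) : ‖ballHat d ξ‖ ^ e ≤ M ^ S * ‖ballHat d ξ‖ := by
  have hnn := norm_nonneg (ballHat d ξ)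
  rw [← sub_add_cancel e 1, Real.rpow_add_one' hnn (by linarith)]
  gcongr
  exact rpow_le_rpow_of_le_of_one_le hnn ((norm_ballHat_le ξ).trans hvol) hM (by linarith)
    (by linarith)

theorem continuous_norm_ballHat_rpow (he : 0 ≤ e) :
    Continuous fun ξ : Space d => ‖ballHat d ξ‖ ^ e :=
  continuous_ballHat.norm.rpow_const fun _ => Or.inr he

theorem integrable_norm_ballHat_rpow_mul {N : Space d → ℝ} (he : 0 ≤ e) (hN : Integrable N) :
    Integrable fun ξ => ‖ballHat d ξ‖ ^ e * N ξ := by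
  refine hN.bdd_mul (c := ballVol d ^ e) (continuous_norm_ballHat_rpow he).aestronglyMeasurable
    (.of_forall fun ξ => ?_)
  rw [Real.norm_of_nonneg (by positivity)]
  exact Real.rpow_le_rpow (norm_nonneg _) (norm_ballHat_le ξ) he

theorem integrable_norm_hat_mul_norm_hat (hu : MemLp u 2 (ballMeasure d))
    (hv : MemLp v 2 (ballMeasure d)) : Integrable fun ξ => ‖hat u ξ‖ * ‖hat v ξ‖ :=
  (memLp_hat hu).norm.integrable_mul (memLp_hat hv).norm

theorem integral_norm_ballHat_rpow_mul_le (hM : 1 ≤ M) (hvol : ballVol d ≤ M) (he : 1 ≤ e)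
    (heS : e ≤ S) (hu : MemLp u 2 (ballMeasure d)) (hv : MemLp v 2 (ballMeasure d)) :
    ∫ ξ, ‖ballHat d ξ‖ ^ e * (‖hat u ξ‖ * ‖hat v ξ‖)
      ≤ M ^ S * √(ballVol d) * ((∫ x, ‖u x‖ ∂(ballMeasure d))
        * √(∫ x, ‖v x‖ ^ 2 ∂(ballMeasure d))) := by
  have hcauchySchwarz := integral_mul_le_sqrt_mul_sqrt (memLp_ballHat (d := d)).norm
    (memLp_hat hv).norm (fun _ => norm_nonneg _) (fun _ => norm_nonneg _)
  rw [integral_norm_sq_ballHat, integral_norm_sq_hat hv] at hcauchySchwarz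
  have hint : Integrable fun ξ => ‖ballHat d ξ‖ * ‖hat v ξ‖ :=
    (memLp_ballHat (d := d)).norm.integrable_mul (memLp_hat hv).norm
  calc ∫ ξ, ‖ballHat d ξ‖ ^ e * (‖hat u ξ‖ * ‖hat v ξ‖)
      ≤ ∫ ξ, M ^ S * (∫ x, ‖u x‖ ∂(ballMeasure d)) * (‖ballHat d ξ‖ * ‖hat v ξ‖) := by
        refine integral_mono (integrable_norm_ballHat_rpow_mul (by linarith)
          (integrable_norm_hat_mul_norm_hat hu hv)) (hint.const_mul _) fun ξ => ?_
        calc ‖ballHat d ξ‖ ^ e * (‖hat u ξ‖ * ‖hat v ξ‖)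
            ≤ (M ^ S * ‖ballHat d ξ‖) * ((∫ x, ‖u x‖ ∂(ballMeasure d)) * ‖hat v ξ‖) := by
              gcongr
              · exact norm_ballHat_rpow_le hM hvol he heS ξ
              · exact norm_hat_le u ξ
          _ = _ := by ring
    _ = M ^ S * (∫ x, ‖u x‖ ∂(ballMeasure d)) * ∫ ξ, ‖ballHat d ξ‖ * ‖hat v ξ‖ :=
        integral_const_mul _ _
    _ ≤ M ^ S * (∫ x, ‖u x‖ ∂(ballMeasure d))
        * (√(ballVol d) * √(∫ x, ‖v x‖ ^ 2 ∂(ballMeasure d))) := by gcongr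
    _ = _ := by ring

/-- The quadratic term in the expansion of `‖ballHat d + hat u‖_q ^ q`, up to the factor
`q / 2`. The Fourier transform of the ball is real, which distinguishes `re` from `im`. -/
def secondOrder (q : ℝ) (u : Space d → ℂ) : ℝ :=
  ∫ ξ, ‖ballHat d ξ‖ ^ (q - 2) * ((q - 1) * (hat u ξ).re ^ 2 + (hat u ξ).im ^ 2)

theorem mul_re_sq_add_im_sq_add_le (hq : 2 ≤ q) (z w : ℂ) :
    (q - 1) * (z + w).re ^ 2 + (z + w).im ^ 2
      ≤ ((q - 1) * z.re ^ 2 + z.im ^ 2) + 2 * q * (‖w‖ * ‖z‖) + q * (‖w‖ * ‖w‖) := by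
  have hre : w.re * z.re ≤ ‖w‖ * ‖z‖ := by
    refine (le_abs_self _).trans ?_
    rw [abs_mul]
    gcongr <;> exact Complex.abs_re_le_norm _
  have him : w.im * z.im ≤ ‖w‖ * ‖z‖ := by
    refine (le_abs_self _).trans ?_
    rw [abs_mul]
    gcongr <;> exact Complex.abs_im_le_norm _
  have hnorm : ‖w‖ * ‖w‖ = w.re ^ 2 + w.im ^ 2 := by
    rw [Complex.norm_mul_self_eq_normSq, Complex.normSq_apply]; ring
  rw [Complex.add_re, Complex.add_im]
  nlinarith [mul_le_mul_of_nonneg_left hre (by linarith : 0 ≤ q - 1), sq_nonneg w.re,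
    sq_nonneg w.im]

theorem integrable_secondOrder (hq : 2 ≤ q) (hu : MemLp u 2 (ballMeasure d)) :
    Integrable fun ξ =>
      ‖ballHat d ξ‖ ^ (q - 2) * ((q - 1) * (hat u ξ).re ^ 2 + (hat u ξ).im ^ 2) :=
  integrable_norm_ballHat_rpow_mul (by linarith)
    (((memLp_hat hu).re.integrable_sq.const_mul (q - 1)).add (memLp_hat hu).im.integrable_sq)

theorem secondOrder_add_le_integral (hq : 2 ≤ q) (hu : MemLp u 2 (ballMeasure d))
    (hv : MemLp v 2 (ballMeasure d)) :
    secondOrder q (fun x => u x + v x) ≤ secondOrder q u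
      + 2 * q * (∫ ξ, ‖ballHat d ξ‖ ^ (q - 2) * (‖hat v ξ‖ * ‖hat u ξ‖))
      + q * ∫ ξ, ‖ballHat d ξ‖ ^ (q - 2) * (‖hat v ξ‖ * ‖hat v ξ‖) := by
  have hq2 : 0 ≤ q - 2 := by linarith
  have hintU := integrable_secondOrder hq hu
  have hintVU := (integrable_norm_ballHat_rpow_mul hq2
    (integrable_norm_hat_mul_norm_hat hv hu)).const_mul (2 * q)
  have hintVV := (integrable_norm_ballHat_rpow_mul hq2
    (integrable_norm_hat_mul_norm_hat hv hv)).const_mul q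
  rw [secondOrder, secondOrder, ← integral_const_mul, ← integral_const_mul,
    ← integral_add hintU hintVU, ← integral_add (hintU.fun_add hintVU) hintVV]
  refine integral_mono (integrable_secondOrder hq (hu.add hv))
    ((hintU.fun_add hintVU).fun_add hintVV) fun ξ => ?_
  dsimp only
  rw [hat_add (hu.integrable one_le_two) (hv.integrable one_le_two)]
  refine (mul_le_mul_of_nonneg_left (mul_re_sq_add_im_sq_add_le hq (hat u ξ) (hat v ξ))
    (by positivity : 0 ≤ ‖ballHat d ξ‖ ^ (q - 2))).trans_eq ?_
  ring

theorem secondOrder_add_le (hM : 1 ≤ M) (hvol : ballVol d ≤ M) (hq : 3 ≤ q) (hqS : q ≤ S)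
    (hu : MemLp u 2 (ballMeasure d)) (hv : MemLp v 2 (ballMeasure d)) :
    secondOrder q (fun x => u x + v x) ≤ secondOrder q u
      + 2 * S * (M ^ S * √(ballVol d)) * ((∫ x, ‖v x‖ ∂(ballMeasure d))
        * (√(∫ x, ‖u x‖ ^ 2 ∂(ballMeasure d)) + √(∫ x, ‖v x‖ ^ 2 ∂(ballMeasure d)))) := by
  have hbound {w : Space d → ℂ} (hw : MemLp w 2 (ballMeasure d)) :=
    integral_norm_ballHat_rpow_mul_le (S := S) (e := q - 2) hM hvol (by linarith) (by linarith)
      hv hw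
  have hnn (w : Space d → ℂ) : 0 ≤ ∫ ξ, ‖ballHat d ξ‖ ^ (q - 2) * (‖hat v ξ‖ * ‖hat w ξ‖) :=
    integral_nonneg fun _ => by positivity
  have hcross := mul_le_mul (by linarith : 2 * q ≤ 2 * S) (hbound hu) (hnn u) (by linarith)
  have hsquare := mul_le_mul (by linarith : q ≤ 2 * S) (hbound hv) (hnn v) (by linarith)
  linarith [secondOrder_add_le_integral (by linarith : 2 ≤ q) hu hv]

end SecondOrder

section Kernel

variable {M S q q' : ℝ} {u : Space d → ℂ}

theorem kernelHat_eq_ofReal (q : ℝ) (ξ : Space d) :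
    kernelHat d q ξ = ((‖ballHat d ξ‖ ^ (q - 2) * (ballHat d ξ).re : ℝ) : ℂ) := by
  rw [Complex.ofReal_mul, ballHat_re]
  rfl

theorem ballHat_neg (ξ : Space d) : ballHat d (-ξ) = ballHat d ξ := by
  rw [← Complex.conj_eq_iff_re.2 (ballHat_re ξ), ← rhat_one, conj_rhat, rhat, hat_apply,
    hat_apply, ← integral_comp_neg_ballMeasure]
  simp

theorem norm_kernelHat (hq : q ≠ 1) (ξ : Space d) :
    ‖kernelHat d q ξ‖ = ‖ballHat d ξ‖ ^ (q - 1) := by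
  change ‖((‖ballHat d ξ‖ ^ (q - 2) : ℝ) : ℂ) * ballHat d ξ‖ = _
  rw [norm_mul, Complex.norm_real, Real.norm_of_nonneg (by positivity),
    ← Real.rpow_add_one' (norm_nonneg _) fun h => hq (by linarith)]
  ring_nf

theorem integrable_kernelHat (hq : 3 ≤ q) : Integrable (kernelHat d q) := by
  refine (integrable_norm_iff ?_).1 ?_
  · exact ((Complex.continuous_ofReal.comp (continuous_norm_ballHat_rpow (by linarith))).mul
      continuous_ballHat).aestronglyMeasurable
  · simpa only [norm_kernelHat (by linarith : q ≠ 1)] using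
      integrable_norm_rpow_of_bound memLp_ballHat norm_ballHat_le (by linarith : 2 ≤ q - 1)

theorem fourier_kernelHat (q : ℝ) (x : Space d) : 𝓕 (kernelHat d q) x = (kernel d q x : ℂ) := by
  have hfourierInv : 𝓕⁻ (kernelHat d q) = 𝓕 (kernelHat d q) := by
    have heven : (fun ξ => kernelHat d q (-ξ)) = kernelHat d q := by
      funext ξ
      rw [kernelHat_eq_ofReal, kernelHat_eq_ofReal, ballHat_neg]
    rw [Real.fourierInv_eq_fourier_comp_neg, heven]
  have hconj : starRingEnd ℂ (𝓕 (kernelHat d q) x) = 𝓕⁻ (kernelHat d q) x := by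
    rw [Real.fourier_eq, Real.fourierInv_eq, ← integral_conj]
    congr! 2
    rw [kernelHat_eq_ofReal]
    simp [Circle.smul_def, ← Circle.coe_inv_eq_conj, AddChar.map_neg_eq_inv]
  rw [hfourierInv] at hconj
  rw [kernel, hfourierInv]
  exact (Complex.conj_eq_iff_re.1 hconj).symm

theorem integrable_kernel_mul (q : ℝ) {h : Space d → ℝ} (hh : Integrable h (ballMeasure d)) :
    Integrable (fun x => kernel d q x * h x) (ballMeasure d) :=
  hh.bdd_mul (continuous_kernel d q).aestronglyMeasurable
    (.of_forall fun x => abs_rinv_le (kernelHat d q) x)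

theorem integrable_hat_mul_kernelHat (hq : 3 ≤ q) (hu : Integrable u (ballMeasure d)) :
    Integrable fun ξ => hat u ξ * kernelHat d q ξ :=
  (integrable_kernelHat hq).bdd_mul (continuous_hat hu).aestronglyMeasurable
    (.of_forall fun ξ => norm_hat_le u ξ)

theorem re_hat_mul_kernelHat (q : ℝ) (u : Space d → ℂ) (ξ : Space d) :
    (hat u ξ * kernelHat d q ξ).re
      = ‖ballHat d ξ‖ ^ (q - 2) * (ballHat d ξ).re * (hat u ξ).re := by
  rw [kernelHat_eq_ofReal, Complex.re_mul_ofReal, mul_comm]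

theorem integrable_firstOrder (hq : 3 ≤ q) (hu : Integrable u (ballMeasure d)) :
    Integrable fun ξ => ‖ballHat d ξ‖ ^ (q - 2) * (ballHat d ξ).re * (hat u ξ).re := by
  simpa only [re_hat_mul_kernelHat, RCLike.re_eq_complex_re] using
    (integrable_hat_mul_kernelHat hq hu).re

theorem integral_firstOrder (hq : 3 ≤ q) (hu : Integrable u (ballMeasure d)) :
    ∫ ξ, ‖ballHat d ξ‖ ^ (q - 2) * (ballHat d ξ).re * (hat u ξ).re
      = ∫ x, kernel d q x * (u x).re ∂(ballMeasure d) := by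
  have hint : Integrable (fun x => u x * (kernel d q x : ℂ)) (ballMeasure d) :=
    hu.mul_bdd (Complex.continuous_ofReal.comp (continuous_kernel d q)).aestronglyMeasurable
      (.of_forall fun x => (Complex.norm_real _).trans_le (abs_rinv_le (kernelHat d q) x))
  have hparseval : ∫ ξ, hat u ξ * kernelHat d q ξ
      = ∫ x, u x * (kernel d q x : ℂ) ∂(ballMeasure d) := by
    unfold hat
    rw [integral_fourier_mul_eq (integrable_indicator_unitBall hu) (integrable_kernelHat hq)]
    simp only [fourier_kernelHat]
    exact integral_indicator_unitBall (Φ := fun x w => w * (kernel d q x : ℂ))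
      (fun _ => zero_mul _) u
  have hre := congrArg Complex.re hparseval
  simp only [← RCLike.re_eq_complex_re] at hre
  rw [← integral_re (integrable_hat_mul_kernelHat hq hu), ← integral_re hint] at hre
  simpa only [RCLike.re_eq_complex_re, re_hat_mul_kernelHat, Complex.re_mul_ofReal, mul_comm]
    using hre

theorem norm_kernelHat_sub_le (hM : 1 ≤ M) (hvol : ballVol d ≤ M) (hq : 7 / 2 ≤ q) (hqS : q ≤ S)
    (hq' : 7 / 2 ≤ q') (hqS' : q' ≤ S) (ξ : Space d) :
    ‖kernelHat d q ξ - kernelHat d q' ξ‖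
      ≤ 2 * (2 + M ^ S * M) * |q - q'| * ‖ballHat d ξ‖ ^ 2 := by
  have hpow := abs_rpow_sub_rpow_le (S := S) (σ := 1) (s := q - 2) (s' := q' - 2) hM
    (norm_nonneg (ballHat d ξ)) ((norm_ballHat_le ξ).trans hvol) zero_le_one (by linarith)
    (by linarith) (by linarith) (by linarith)
  rw [Real.rpow_one, sub_sub_sub_cancel_right] at hpow
  change ‖((‖ballHat d ξ‖ ^ (q - 2) : ℝ) : ℂ) * ballHat d ξ
    - ((‖ballHat d ξ‖ ^ (q' - 2) : ℝ) : ℂ) * ballHat d ξ‖ ≤ _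
  rw [← sub_mul, ← Complex.ofReal_sub, norm_mul, Complex.norm_real, Real.norm_eq_abs, pow_two,
    ← mul_assoc]
  gcongr

theorem abs_kernel_sub_kernel_le (hM : 1 ≤ M) (hvol : ballVol d ≤ M) (hq : 7 / 2 ≤ q)
    (hqS : q ≤ S) (hq' : 7 / 2 ≤ q') (hqS' : q' ≤ S) (x : Space d) :
    |kernel d q x - kernel d q' x| ≤ 2 * (2 + M ^ S * M) * |q - q'| * ballVol d := by
  have hk : Integrable (kernelHat d q) := integrable_kernelHat (by linarith)
  have hk' : Integrable (kernelHat d q') := integrable_kernelHat (by linarith)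
  have hsub : kernel d q x - kernel d q' x
      = rinv (fun ξ => kernelHat d q ξ - kernelHat d q' ξ) x := by
    have hadd := rinv_add hk (hk'.const_mul ((-1 : ℝ) : ℂ)) x
    rw [rinv_const_mul] at hadd
    simp only [Complex.ofReal_neg, Complex.ofReal_one, neg_one_mul, ← sub_eq_add_neg] at hadd
    exact hadd.symm
  rw [hsub]
  refine (abs_rinv_le _ x).trans ?_
  rw [← integral_norm_sq_ballHat, ← integral_const_mul]
  exact integral_mono (hk.sub hk').norm (memLp_ballHat.norm.integrable_sq.const_mul _)
    (norm_kernelHat_sub_le hM hvol hq hqS hq' hqS')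

end Kernel

section Expansion

variable {M S q : ℝ}

theorem exists_integral_norm_add_rpow_le (hM : 1 ≤ M) (hvol : ballVol d ≤ M) (hS : 0 ≤ S) :
    ∃ C : ℝ, 0 ≤ C ∧ ∀ (q : ℝ) (u : Space d → ℂ), 3 ≤ q → q ≤ S → MemLp u 2 (ballMeasure d) →
      ∫ x, ‖u x‖ ∂(ballMeasure d) ≤ M →
      ∫ ξ, ‖ballHat d ξ + hat u ξ‖ ^ q ≤ (∫ ξ, ‖ballHat d ξ‖ ^ q)
        + q * ((∫ x, kernel d q x * (u x).re ∂(ballMeasure d)) + secondOrder q u / 2)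
        + C * ((∫ x, ‖u x‖ ∂(ballMeasure d)) * ∫ x, ‖u x‖ ^ 2 ∂(ballMeasure d)) := by
  obtain ⟨C, hC, htaylor⟩ := exists_norm_add_rpow_le hM hS
  refine ⟨C, hC, fun q u hq3 hqS hu huM => ?_⟩
  have hq2 : 2 ≤ q := by linarith
  have hu1 : Integrable u (ballMeasure d) := hu.integrable one_le_two
  set A := ∫ x, ‖u x‖ ∂(ballMeasure d)
  have hhat (ξ : Space d) : ‖hat u ξ‖ ≤ A := norm_hat_le u ξ
  have hzeroth := integrable_norm_rpow_of_bound (memLp_ballHat (d := d)) norm_ballHat_le hq2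
  have hfirst := (integrable_firstOrder hq3 hu1).const_mul q
  have hsecond := (integrable_secondOrder hq2 hu).const_mul (q / 2)
  have hthird := (memLp_hat hu).norm.integrable_sq.const_mul (C * A)
  have hleft := integrable_norm_rpow_of_bound (memLp_ballHat.add (memLp_hat hu))
    (fun ξ => (norm_add_le _ _).trans (add_le_add (norm_ballHat_le ξ) (hhat ξ))) hq2
  have hpointwise (ξ : Space d) : ‖ballHat d ξ + hat u ξ‖ ^ q ≤ ‖ballHat d ξ‖ ^ q
      + q * (‖ballHat d ξ‖ ^ (q - 2) * (ballHat d ξ).re * (hat u ξ).re)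
      + q / 2 * (‖ballHat d ξ‖ ^ (q - 2) * ((q - 1) * (hat u ξ).re ^ 2 + (hat u ξ).im ^ 2))
      + C * A * ‖hat u ξ‖ ^ 2 := by
    have hnorm : |(ballHat d ξ).re| = ‖ballHat d ξ‖ := by
      rw [← Real.norm_eq_abs, ← Complex.norm_real, ballHat_re]
    have hexpand := htaylor q (ballHat d ξ).re (hat u ξ) hq3 hqS
      (hnorm.trans_le ((norm_ballHat_le ξ).trans hvol)) ((hhat ξ).trans huM)
    rw [ballHat_re, hnorm] at hexpand
    have hcubic : C * (‖hat u ξ‖ * ‖hat u ξ‖ ^ 2) ≤ C * (A * ‖hat u ξ‖ ^ 2) := by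
      gcongr
      exact hhat ξ
    linarith [pow_succ' ‖hat u ξ‖ 2]
  refine (integral_mono hleft (((hzeroth.fun_add hfirst).fun_add hsecond).fun_add hthird)
    hpointwise).trans_eq ?_
  rw [integral_add ((hzeroth.fun_add hfirst).fun_add hsecond) hthird,
    integral_add (hzeroth.fun_add hfirst) hsecond, integral_add hzeroth hfirst,
    integral_const_mul, integral_const_mul, integral_const_mul, integral_firstOrder hq3 hu1,
    integral_norm_sq_hat hu, secondOrder]
  ring

theorem norm_ballHat_rpow_mul_quad_le (hM : 1 ≤ M) (hvol : ballVol d ≤ M) (hq : 7 / 2 ≤ q)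
    (hqS : q ≤ S) {r : ℕ} (hr : 2 * r + 4 ≤ S) {a b : ℝ} (ha : 0 ≤ a) (hb : 0 ≤ b)
    (ξ : Space d) :
    ‖ballHat d ξ‖ ^ (q - 2) * ((q - 1) * b + a)
      ≤ ‖ballHat d ξ‖ ^ (2 * r + 2) * (((2 * r : ℕ) + 3) * b + a)
        + (2 * (2 + M ^ S * M) * S + M ^ S) * |q - (2 * r + 4)| * (a + b) := by
  have hM' : ‖ballHat d ξ‖ ≤ M := (norm_ballHat_le ξ).trans hvol
  have hweight := abs_rpow_sub_rpow_le (S := S) (σ := 0) (s := q - 2) (s' := 2 * r + 2) hM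
    (norm_nonneg (ballHat d ξ)) hM' le_rfl (by linarith) (by linarith) (by linarith)
    (by linarith)
  have hbound : ‖ballHat d ξ‖ ^ (2 * r + 2 : ℝ) ≤ M ^ S :=
    rpow_le_rpow_of_le_of_one_le (norm_nonneg _) hM' hM (by linarith) (by linarith)
  rw [Real.rpow_zero, mul_one, show q - 2 - (2 * r + 2) = q - (2 * r + 4) by ring] at hweight
  have hcast : (2 * r + 2 : ℝ) = (2 * r + 2 : ℕ) := by push_cast; rfl
  rw [hcast, Real.rpow_natCast] at hweight hbound
  have hfirst : (‖ballHat d ξ‖ ^ (q - 2) - ‖ballHat d ξ‖ ^ (2 * r + 2)) * ((q - 1) * b + a)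
      ≤ 2 * (2 + M ^ S * M) * |q - (2 * r + 4)| * (S * (a + b)) := by
    have hquad : (q - 1) * b + a ≤ S * (a + b) := by nlinarith
    have hquad0 : 0 ≤ (q - 1) * b + a := add_nonneg (mul_nonneg (by linarith) hb) ha
    exact mul_le_mul ((le_abs_self _).trans hweight) hquad hquad0 ((abs_nonneg _).trans hweight)
  have hsecond : ‖ballHat d ξ‖ ^ (2 * r + 2) * ((q - (2 * r + 4)) * b)
      ≤ M ^ S * (|q - (2 * r + 4)| * (a + b)) := by
    have hexponent : (q - (2 * r + 4)) * b ≤ |q - (2 * r + 4)| * (a + b) :=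
      mul_le_mul (le_abs_self _) (by linarith) hb (abs_nonneg _)
    calc _ ≤ ‖ballHat d ξ‖ ^ (2 * r + 2) * (|q - (2 * r + 4)| * (a + b)) := by gcongr
      _ ≤ _ := by gcongr
  push_cast
  linarith

theorem secondOrder_I_mul_le_integral (hM : 1 ≤ M) (hvol : ballVol d ≤ M) (hq : 7 / 2 ≤ q)
    (hqS : q ≤ S) {r : ℕ} (hr : 2 * r + 4 ≤ S) {g : Space d → ℝ}
    (hg : MemLp g 2 (ballMeasure d)) :
    secondOrder q (fun x => Complex.I * (g x : ℂ))
      ≤ (∫ ξ, ‖ballHat d ξ‖ ^ (2 * r + 2) * (((2 * r : ℕ) + 3) * (rhat g ξ).im ^ 2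
          + (rhat g ξ).re ^ 2))
        + (2 * (2 + M ^ S * M) * S + M ^ S) * |q - (2 * r + 4)|
          * ∫ x, g x ^ 2 ∂(ballMeasure d) := by
  have hplancherel : ∫ ξ, ‖rhat g ξ‖ ^ 2 = ∫ x, g x ^ 2 ∂(ballMeasure d) := by
    simpa [rhat] using integral_norm_sq_hat (u := fun x => (g x : ℂ)) hg.ofReal
  have hquad := integrable_weighted_quad (2 * r) (hg.integrable one_le_two)
  have herr := (memLp_rhat hg).norm.integrable_sq.const_mul
    ((2 * (2 + M ^ S * M) * S + M ^ S) * |q - (2 * r + 4)|)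
  rw [← hplancherel, ← integral_const_mul, ← integral_add hquad herr, secondOrder]
  refine integral_mono (integrable_secondOrder (by linarith) (hg.ofReal.const_mul _))
    (hquad.fun_add herr) fun ξ => ?_
  have hhat : hat (fun x => Complex.I * (g x : ℂ)) ξ = Complex.I * rhat g ξ := hat_const_mul _ _ _
  dsimp only
  rw [hhat, ← Complex.normSq_eq_norm_sq, Complex.normSq_apply, ← pow_two, ← pow_two]
  simpa using norm_ballHat_rpow_mul_quad_le hM hvol hq hqS hr (sq_nonneg (rhat g ξ).re)
    (sq_nonneg (rhat g ξ).im) ξ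

theorem abs_kernel_sub_fiberMass_le (hM : 1 ≤ M) (hvol : ballVol d ≤ M) (hq : 7 / 2 ≤ q)
    (hqS : q ≤ S) {r : ℕ} (hr : 2 * r + 4 ≤ S) (x : Space d) :
    |kernel d q x - fiberMass d (2 * r + 1) x|
      ≤ 2 * (2 + M ^ S * M) * |q - (2 * r + 4)| * ballVol d := by
  have hcast : ((2 * r + 4 : ℕ) : ℝ) = 2 * r + 4 := by push_cast; rfl
  rw [← kernel_even_eq_fiberMass, hcast]
  exact abs_kernel_sub_kernel_le hM hvol hq hqS (by linarith) hr x

theorem integral_fiberMass_mul_sq_le (hM : 1 ≤ M) (hvol : ballVol d ≤ M) (hq : 7 / 2 ≤ q)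
    (hqS : q ≤ S) {r : ℕ} (hr : 2 * r + 4 ≤ S) {g : Space d → ℝ}
    (hg : MemLp g 2 (ballMeasure d)) :
    ∫ x, fiberMass d (2 * r + 1) x * g x ^ 2 ∂(ballMeasure d)
      ≤ (∫ x, kernel d q x * g x ^ 2 ∂(ballMeasure d))
        + 2 * (2 + M ^ S * M) * |q - (2 * r + 4)| * ballVol d
          * ∫ x, g x ^ 2 ∂(ballMeasure d) := by
  have hkernel := integrable_kernel_mul q hg.integrable_sq
  have herr := hg.integrable_sq.const_mul
    (2 * (2 + M ^ S * M) * |q - (2 * r + 4)| * ballVol d)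
  rw [← integral_const_mul, ← integral_add hkernel herr]
  refine integral_mono (integrable_fiberMass_mul _ hg.integrable_sq) (hkernel.fun_add herr)
    fun x => ?_
  dsimp only
  rw [← add_mul]
  gcongr
  linarith [neg_le_of_abs_le (abs_kernel_sub_fiberMass_le hM hvol hq hqS hr x)]

theorem exists_secondOrder_I_mul_le (hM : 1 ≤ M) (hvol : ballVol d ≤ M) {r : ℕ}
    (hr : 2 * r + 4 ≤ S) :
    ∃ C : ℝ, 0 ≤ C ∧ ∀ (q : ℝ) (g : Space d → ℝ), 7 / 2 ≤ q → q ≤ S →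
      MemLp g 2 (ballMeasure d) →
      secondOrder q (fun x => Complex.I * (g x : ℂ))
        ≤ (∫ x, kernel d q x * g x ^ 2 ∂(ballMeasure d)) - quadForm (2 * r) g
          + C * |q - (2 * r + 4)| * ∫ x, g x ^ 2 ∂(ballMeasure d) := by
  have hS : 0 ≤ S := by linarith [r.cast_nonneg (α := ℝ)]
  have hV := ballVol_nonneg (d := d)
  refine ⟨2 * (2 + M ^ S * M) * S + M ^ S + 2 * (2 + M ^ S * M) * ballVol d, by positivity,
    fun q g hq hqS hg => ?_⟩
  have hquad : quadForm (2 * r) g = (∫ x, fiberMass d (2 * r + 1) x * g x ^ 2 ∂(ballMeasure d))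
      - ∫ ξ, ‖ballHat d ξ‖ ^ (2 * r + 2) * (((2 * r : ℕ) + 3) * (rhat g ξ).im ^ 2
          + (rhat g ξ).re ^ 2) := rfl
  rw [hquad]
  linarith [secondOrder_I_mul_le_integral hM hvol hq hqS hr hg,
    integral_fiberMass_mul_sq_le hM hvol hq hqS hr hg]

theorem exists_fiberMass_le (n : ℕ) : ∃ K : ℝ, 0 < K ∧ ∀ x : Space d, fiberMass d n x ≤ K :=
  ⟨(∫ ξ, ‖ballHat d ξ ^ (n + 2)‖) + 1,
    add_pos_of_nonneg_of_pos (integral_nonneg fun _ => norm_nonneg _) one_pos,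
    fun x => (le_abs_self _).trans ((abs_rinv_le _ x).trans (le_add_of_nonneg_right zero_le_one))⟩

theorem exists_kernel_bounds (hM : 1 ≤ M) (hvol : ballVol d ≤ M) {r : ℕ} (hr : 2 * r + 5 ≤ S) :
    ∃ ρ : ℝ, 0 < ρ ∧ ρ ≤ 1 / 4 ∧ ∃ κ : ℝ, 0 < κ ∧ ∃ K : ℝ, 0 < K ∧
      ∀ q : ℝ, |q - (2 * r + 4)| < ρ →
        (∀ x ∈ unitBall d, κ ≤ kernel d q x) ∧ ∀ x, kernel d q x ≤ K := by
  obtain ⟨κ, hκ, hlow⟩ := exists_fiberMass_lower_bound (d := d) (2 * r + 1)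
  obtain ⟨K, hK, hup⟩ := exists_fiberMass_le (d := d) (2 * r + 1)
  set B := 2 * (2 + M ^ S * M) * ballVol d
  have hB : 0 ≤ B := by have := ballVol_nonneg (d := d); positivity
  refine ⟨min (1 / 4) (κ / (2 * (B + 1))), by positivity, min_le_left _ _, κ / 2, by positivity,
    K + κ, by positivity, fun q hq => ?_⟩
  have hnear := abs_lt.1 (hq.trans_le (min_le_left _ _))
  have hsmall := (hq.trans_le (min_le_right _ _)).le
  rw [le_div_iff₀ (by positivity)] at hsmall
  have hclose (x : Space d) : |kernel d q x - fiberMass d (2 * r + 1) x| ≤ κ / 2 := by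
    have hdiff := abs_kernel_sub_fiberMass_le hM hvol (q := q) (S := S) (r := r)
      (by linarith [hnear.1]) (by linarith [hnear.2]) (by linarith) x
    linarith [abs_nonneg (q - (2 * r + 4))]
  exact ⟨fun x hx => by linarith [hlow x hx, neg_le_of_abs_le (hclose x)],
    fun x => by linarith [hup x, le_of_abs_le (hclose x)]⟩

end Expansion

theorem affineDefect_le_add (q : ℝ) {g h : Space d → ℝ} (hg : MemLp g 2 (ballMeasure d))
    (hh : MemLp h 2 (ballMeasure d)) :
    affineDefect q hg ≤ 2 * affineDefect q hh + 2 * ‖weighted d q (g - h) (hg.sub hh)‖ ^ 2 := by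
  have hadd : weighted d q g hg = weighted d q h hh + weighted d q (g - h) (hg.sub hh) := by
    unfold weighted
    rw [← MemLp.toLp_add]
    congr 1
    funext x
    simp only [Pi.add_apply, Pi.sub_apply]
    ring
  have hcontract := (affineSubspace d q)ᗮ.norm_starProjection_apply_le
    (weighted d q (g - h) (hg.sub hh))
  unfold affineDefect
  rw [← Submodule.starProjection_orthogonal_val, ← Submodule.starProjection_orthogonal_val, hadd,
    map_add]
  set a := (affineSubspace d q)ᗮ.starProjection (weighted d q h hh)
  set b := (affineSubspace d q)ᗮ.starProjection (weighted d q (g - h) (hg.sub hh))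
  nlinarith [pow_le_pow_left₀ (norm_nonneg _) (norm_add_le a b) 2,
    pow_le_pow_left₀ (norm_nonneg _) hcontract 2, sq_nonneg (‖a‖ - ‖b‖)]

theorem norm_sq_weighted_even (r : ℕ) {g : Space d → ℝ} (hg : MemLp g 2 (ballMeasure d)) :
    ‖weighted d ((2 * r + 4 : ℕ) : ℝ) g hg‖ ^ 2
      = ∫ x, fiberMass d (2 * r + 1) x * g x ^ 2 ∂(ballMeasure d) := by
  rw [← real_inner_self_eq_norm_sq, L2.inner_def]
  refine integral_congr_ae ((weighted_coeFn_even r hg).mono fun x hx => ?_)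
  dsimp only
  rw [real_inner_self_eq_norm_sq, Real.norm_eq_abs, sq_abs, hx, mul_pow,
    Real.sq_sqrt (fiberMass_nonneg _ _)]

theorem exists_affineDefect_le (r : ℕ) {w : ℝ} (hw : 0 < w) :
    ∃ c : ℝ, 0 < c ∧ ∀ (g h : Space d → ℝ) (hg : MemLp g 2 (ballMeasure d)),
      MemLp h 2 (ballMeasure d) →
      c * affineDefect ((2 * r + 4 : ℕ) : ℝ) hg
        ≤ quadForm (2 * r) h / 2 + w * ∫ x, (g x - h x) ^ 2 ∂(ballMeasure d) := by
  obtain ⟨c, hc, hgap⟩ := exists_quadForm_gap (d := d) r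
  obtain ⟨K, hK, hmass⟩ := exists_fiberMass_le (d := d) (2 * r + 1)
  refine ⟨min (c / 4) (w / (2 * K)), by positivity, fun g h hg hh => ?_⟩
  set m := min (c / 4) (w / (2 * K))
  have hm : 0 ≤ m := by positivity
  have hmc : m ≤ c / 4 := min_le_left _ _
  have hmw : m * (2 * K) ≤ w := (le_div_iff₀ (by positivity)).1 (min_le_right _ _)
  have hdiff : ‖weighted d ((2 * r + 4 : ℕ) : ℝ) (g - h) (hg.sub hh)‖ ^ 2
      ≤ K * ∫ x, (g x - h x) ^ 2 ∂(ballMeasure d) := by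
    rw [norm_sq_weighted_even, ← integral_const_mul]
    have hsq := (hg.sub hh).integrable_sq
    exact integral_mono (integrable_fiberMass_mul _ hsq) (hsq.const_mul _) fun x =>
      mul_le_mul_of_nonneg_right (hmass x) (sq_nonneg _)
  have hdefect : 0 ≤ affineDefect ((2 * r + 4 : ℕ) : ℝ) hh := sq_nonneg _
  calc m * affineDefect ((2 * r + 4 : ℕ) : ℝ) hg
      ≤ m * (2 * affineDefect ((2 * r + 4 : ℕ) : ℝ) hh
          + 2 * (K * ∫ x, (g x - h x) ^ 2 ∂(ballMeasure d))) :=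
        mul_le_mul_of_nonneg_left
          ((affineDefect_le_add _ hg hh).trans (by linarith)) hm
    _ = 2 * (m * affineDefect ((2 * r + 4 : ℕ) : ℝ) hh)
          + m * (2 * K) * ∫ x, (g x - h x) ^ 2 ∂(ballMeasure d) := by ring
    _ ≤ 2 * (c / 4 * affineDefect ((2 * r + 4 : ℕ) : ℝ) hh)
          + w * ∫ x, (g x - h x) ^ 2 ∂(ballMeasure d) := by gcongr
    _ ≤ _ := by linarith [hgap h hh]

theorem truncation_eq_self_or_eq_zero {α : Type*} (g : α → ℝ) (η : ℝ) (x : α) :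
    |g x| ≤ η ∧ truncation g η x = g x ∨ η ≤ |g x| ∧ truncation g η x = 0 := by
  by_cases hx : g x ∈ Set.Ioc (-η) η
  · exact .inl ⟨abs_le.2 ⟨hx.1.le, hx.2⟩, Set.indicator_of_mem hx _⟩
  · refine .inr ⟨not_lt.1 fun hlt => hx ?_, Set.indicator_of_notMem hx _⟩
    exact ⟨(abs_lt.1 hlt).1, (abs_lt.1 hlt).2.le⟩

/-- The perturbation `f e^{ig} - 1` of the constant function `1`. -/
def perturb (f g : ℝ) : ℂ := (f : ℂ) * Complex.exp (Complex.I * (g : ℂ)) - 1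

section Pointwise

variable {f g η : ℝ}

theorem perturb_re (f g : ℝ) : (perturb f g).re = f * Real.cos g - 1 := by
  simp [perturb, mul_comm Complex.I, Complex.exp_ofReal_mul_I_re]

theorem norm_perturb_le_two (hf0 : 0 ≤ f) (hf : f ≤ 1) (g : ℝ) : ‖perturb f g‖ ≤ 2 := by
  unfold perturb
  refine (norm_sub_le _ _).trans ?_
  rw [norm_mul, Complex.norm_exp_I_mul_ofReal, mul_one, Complex.norm_real, Real.norm_eq_abs,
    abs_of_nonneg hf0, norm_one]
  linarith

theorem norm_perturb_sub_le_add (hf : f ≤ 1) (g : ℝ) (z : ℂ) :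
    ‖perturb f g - z‖ ≤ (1 - f) + ‖Complex.exp (Complex.I * (g : ℂ)) - 1 - z‖ := by
  have hsplit : perturb f g - z = ((f - 1 : ℝ) : ℂ) * Complex.exp (Complex.I * (g : ℂ))
      + (Complex.exp (Complex.I * (g : ℂ)) - 1 - z) := by
    unfold perturb
    push_cast
    ring
  rw [hsplit]
  refine (norm_add_le _ _).trans_eq ?_
  rw [norm_mul, Complex.norm_exp_I_mul_ofReal, mul_one, Complex.norm_real, Real.norm_eq_abs,
    abs_of_nonpos (by linarith), neg_sub]

theorem norm_perturb_le (hf : f ≤ 1) (g : ℝ) : ‖perturb f g‖ ≤ (1 - f) + |g| := by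
  have hsplit := norm_perturb_sub_le_add hf g 0
  rw [sub_zero, sub_zero] at hsplit
  exact hsplit.trans (add_le_add_right Real.norm_exp_I_mul_ofReal_sub_one_le _)

theorem norm_perturb_sub_I_mul_le (hf : f ≤ 1) (hg : |g| ≤ 1) :
    ‖perturb f g - Complex.I * (g : ℂ)‖ ≤ (1 - f) + g ^ 2 := by
  have hnorm : ‖Complex.I * (g : ℂ)‖ = |g| := by simp
  have hexp := Complex.norm_exp_sub_one_sub_id_le (hnorm.trans_le hg)
  rw [hnorm, sq_abs] at hexp
  exact (norm_perturb_sub_le_add hf g _).trans (add_le_add_right hexp _)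

theorem mul_cos_sub_one_le (hf0 : 0 ≤ f) (hf : f ≤ 1) (hg : |g| ≤ 5 * Real.pi / 4) :
    f * Real.cos g - 1 ≤ -(1 / (4 * Real.pi ^ 2)) * (g ^ 2 + (1 - f)) := by
  have hpi := Real.pi_gt_three
  have hconst : 1 / (4 * Real.pi ^ 2) ≤ 1 / 4 := by
    rw [div_le_div_iff₀ (by positivity) (by positivity)]
    nlinarith
  have hsq : 1 / (4 * Real.pi ^ 2) * g ^ 2 ≤ 25 / 64 := by
    rw [one_div_mul_eq_div, div_le_iff₀ (by positivity), ← sq_abs g]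
    nlinarith [abs_nonneg g]
  have hcos : Real.cos g ≤ 1 - 1 / (4 * Real.pi ^ 2) * g ^ 2 := by
    rcases le_total |g| Real.pi with h | h
    · refine (Real.cos_le_one_sub_mul_cos_sq h).trans ?_
      gcongr
      · norm_num
      · nlinarith
    · have hnonpos : Real.cos g ≤ 0 := by
        rw [← Real.cos_abs]
        exact Real.cos_nonpos_of_pi_div_two_le_of_le (by linarith) (by linarith)
      linarith
  nlinarith [mul_le_mul_of_nonneg_left hcos hf0,
    mul_le_mul_of_nonneg_right hconst (sub_nonneg.2 hf)]

theorem mul_cos_sub_one_le_of_abs_le_one (hf : f ≤ 1) (hg : |g| ≤ 1) :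
    f * Real.cos g - 1 ≤ -(1 / 2) * g ^ 2 + g ^ 4 - 1 / (4 * Real.pi ^ 2) * (1 - f) := by
  have hpi := Real.pi_gt_three
  have hconst : 1 / (4 * Real.pi ^ 2) ≤ 1 / 4 := by
    rw [div_le_div_iff₀ (by positivity) (by positivity)]
    nlinarith
  have hcos := abs_le.1 (Real.cos_bound hg)
  rw [Even.pow_abs (by decide)] at hcos
  have hg2 : g ^ 2 ≤ 1 := (sq_le_one_iff_abs_le_one g).2 hg
  have hg4 : g ^ 4 ≤ 1 := by nlinarith [sq_nonneg g]
  have hcos_ge : 1 / 4 ≤ Real.cos g := by linarith [hcos.1]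
  nlinarith [hcos.2, mul_le_mul_of_nonneg_right (hconst.trans hcos_ge) (sub_nonneg.2 hf)]

end Pointwise

section TruncatedPerturbation

variable {α : Type*} {f g : α → ℝ} {η : ℝ} {x : α}

theorem norm_perturb_sub_truncation_le_abs (hf : f x ≤ 1) (hη1 : η ≤ 1) :
    ‖perturb (f x) (g x) - Complex.I * (truncation g η x : ℂ)‖ ≤ (1 - f x) + |g x| := by
  rcases truncation_eq_self_or_eq_zero g η x with ⟨hsmall, htrunc⟩ | ⟨-, htrunc⟩
  · have hg1 := hsmall.trans hη1
    rw [htrunc]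
    refine (norm_perturb_sub_I_mul_le hf hg1).trans (add_le_add_right ?_ _)
    rw [← sq_abs, pow_two]
    exact mul_le_of_le_one_left (abs_nonneg _) hg1
  · rw [htrunc, Complex.ofReal_zero, mul_zero, sub_zero]
    exact norm_perturb_le hf (g x)

theorem norm_perturb_sub_truncation_le_sq (hf : f x ≤ 1) (hη : 0 < η) (hη1 : η ≤ 1) :
    ‖perturb (f x) (g x) - Complex.I * (truncation g η x : ℂ)‖ ≤ (1 - f x) + g x ^ 2 / η := by
  rcases truncation_eq_self_or_eq_zero g η x with ⟨hsmall, htrunc⟩ | ⟨hlarge, htrunc⟩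
  · rw [htrunc]
    refine (norm_perturb_sub_I_mul_le hf (hsmall.trans hη1)).trans (add_le_add_right ?_ _)
    exact le_div_self (sq_nonneg _) hη hη1
  · rw [htrunc, Complex.ofReal_zero, mul_zero, sub_zero]
    refine (norm_perturb_le hf (g x)).trans (add_le_add_right ?_ _)
    rw [le_div_iff₀ hη, ← sq_abs, pow_two]
    gcongr

theorem mul_re_perturb_le {k κ K : ℝ} (hκ : 0 ≤ κ) (hκk : κ ≤ k) (hkK : k ≤ K) (hf0 : 0 ≤ f x)
    (hf : f x ≤ 1) (hg : |g x| ≤ 5 * Real.pi / 4) (hη1 : η ≤ 1) :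
    k * (perturb (f x) (g x)).re ≤ -(1 / 2) * (k * truncation g η x ^ 2) + K * η ^ 2 * g x ^ 2
      - κ / (4 * Real.pi ^ 2) * (g x - truncation g η x) ^ 2
      - κ / (4 * Real.pi ^ 2) * (1 - f x) := by
  have hk : 0 ≤ k := hκ.trans hκk
  have hK : 0 ≤ K := hk.trans hkK
  have hloss {t : ℝ} (ht : 0 ≤ t) :
      κ / (4 * Real.pi ^ 2) * t ≤ k * (1 / (4 * Real.pi ^ 2) * t) := by
    rw [div_eq_mul_one_div, mul_assoc]
    gcongr
  have hdeficit := hloss (sub_nonneg.2 hf)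
  rw [perturb_re]
  rcases truncation_eq_self_or_eq_zero g η x with ⟨hsmall, htrunc⟩ | ⟨-, htrunc⟩
  · have hcos := mul_le_mul_of_nonneg_left
      (mul_cos_sub_one_le_of_abs_le_one hf (hsmall.trans hη1)) hk
    have hquartic : k * (g x ^ 2 * g x ^ 2) ≤ K * (η ^ 2 * g x ^ 2) := by
      have hsq : g x ^ 2 ≤ η ^ 2 := sq_le_sq' (neg_le_of_abs_le hsmall) (le_of_abs_le hsmall)
      gcongr
    rw [htrunc, sub_self]
    linarith
  · have hcos := mul_le_mul_of_nonneg_left (mul_cos_sub_one_le hf0 hf hg) hk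
    have hsquare := hloss (sq_nonneg (g x))
    have herr : 0 ≤ K * η ^ 2 * g x ^ 2 := by positivity
    rw [htrunc, sub_zero]
    linarith

end TruncatedPerturbation

section Estimates

theorem sq_le_of_le_add_abs {r s t : ℝ} (hr : 0 ≤ r) (hs0 : 0 ≤ s) (hs1 : s ≤ 1)
    (hle : r ≤ s + |t|) : r ^ 2 ≤ 2 * s + 2 * t ^ 2 := by
  nlinarith [pow_le_pow_left₀ hr hle 2, sq_nonneg (s - |t|), sq_abs t]

theorem sqrt_two_mul_add_le {s t : ℝ} (hs : 0 ≤ s) (ht : 0 ≤ t) :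
    √(2 * s + 2 * t) ≤ 2 * √s + 2 * √t := by
  rw [Real.sqrt_le_left (by positivity)]
  nlinarith [Real.sq_sqrt hs, Real.sq_sqrt ht, mul_nonneg (Real.sqrt_nonneg s) (Real.sqrt_nonneg t)]

theorem integral_abs_le_sqrt {g : Space d → ℝ} (hg : MemLp g 2 (ballMeasure d)) :
    ∫ x, |g x| ∂(ballMeasure d) ≤ √(ballVol d) * √(∫ x, g x ^ 2 ∂(ballMeasure d)) := by
  have hcauchy := integral_mul_le_sqrt_mul_sqrt (μ := ballMeasure d) (a := fun _ => 1)
    (b := fun x => |g x|) (memLp_const 1) hg.abs (fun _ => zero_le_one) (fun _ => abs_nonneg _)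
  simpa [sq_abs, ballVol] using hcauchy

theorem integral_truncation_sq_le {g : Space d → ℝ} (hg : MemLp g 2 (ballMeasure d)) (η : ℝ) :
    ∫ x, truncation g η x ^ 2 ∂(ballMeasure d) ≤ ∫ x, g x ^ 2 ∂(ballMeasure d) :=
  integral_mono hg.1.memLp_truncation.integrable_sq hg.integrable_sq fun x =>
    sq_le_sq.2 (abs_truncation_le_abs_self g η x)

variable {f g : Space d → ℝ}

theorem aestronglyMeasurable_perturb (hfm : AEStronglyMeasurable f (ballMeasure d))
    (hgm : AEStronglyMeasurable g (ballMeasure d)) :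
    AEStronglyMeasurable (fun x => perturb (f x) (g x)) (ballMeasure d) :=
  ((hfm.aemeasurable.complex_ofReal.mul
    (hgm.aemeasurable.complex_ofReal.const_mul Complex.I).cexp).sub
      aemeasurable_const).aestronglyMeasurable

theorem memLp_perturb (hfm : AEStronglyMeasurable f (ballMeasure d))
    (hf : ∀ᵐ x ∂(ballMeasure d), 0 ≤ f x ∧ f x ≤ 1)
    (hgm : AEStronglyMeasurable g (ballMeasure d)) (p : ℝ≥0∞) :
    MemLp (fun x => perturb (f x) (g x)) p (ballMeasure d) :=
  .of_bound (aestronglyMeasurable_perturb hfm hgm) 2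
    (hf.mono fun _ hx => norm_perturb_le_two hx.1 hx.2 _)

theorem integrable_one_sub (hfm : AEStronglyMeasurable f (ballMeasure d))
    (hf : ∀ᵐ x ∂(ballMeasure d), 0 ≤ f x ∧ f x ≤ 1) :
    Integrable (fun x => 1 - f x) (ballMeasure d) :=
  .of_bound (aestronglyMeasurable_const.sub hfm) 1 (hf.mono fun x hx => by
    rw [Real.norm_eq_abs, abs_of_nonneg (by linarith [hx.2])]
    linarith [hx.1])

theorem integral_one_sub_nonneg (hf : ∀ᵐ x ∂(ballMeasure d), 0 ≤ f x ∧ f x ≤ 1) :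
    0 ≤ ∫ x, (1 - f x) ∂(ballMeasure d) :=
  integral_nonneg_of_ae (hf.mono fun _ hx => sub_nonneg.2 hx.2)

theorem integral_norm_perturb_le_ballVol (hfm : AEStronglyMeasurable f (ballMeasure d))
    (hf : ∀ᵐ x ∂(ballMeasure d), 0 ≤ f x ∧ f x ≤ 1)
    (hgm : AEStronglyMeasurable g (ballMeasure d)) :
    ∫ x, ‖perturb (f x) (g x)‖ ∂(ballMeasure d) ≤ 2 * ballVol d := by
  refine (integral_mono_ae (memLp_one_iff_integrable.1 (memLp_perturb hfm hf hgm 1)).norm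
    (integrable_const 2) (hf.mono fun x hx => norm_perturb_le_two hx.1 hx.2 _)).trans_eq ?_
  rw [integral_const, smul_eq_mul, mul_comm]
  rfl

theorem integral_norm_perturb_le (hfm : AEStronglyMeasurable f (ballMeasure d))
    (hf : ∀ᵐ x ∂(ballMeasure d), 0 ≤ f x ∧ f x ≤ 1) (hg : MemLp g 2 (ballMeasure d)) :
    ∫ x, ‖perturb (f x) (g x)‖ ∂(ballMeasure d) ≤ (∫ x, (1 - f x) ∂(ballMeasure d))
      + √(ballVol d) * √(∫ x, g x ^ 2 ∂(ballMeasure d)) := by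
  have hint_f := integrable_one_sub hfm hf
  have hint_g := (hg.integrable one_le_two).abs
  have hmono := integral_mono_ae (memLp_one_iff_integrable.1 (memLp_perturb hfm hf hg.1 1)).norm
    (hint_f.fun_add hint_g) (hf.mono fun x hx => norm_perturb_le hx.2 (g x))
  rw [integral_add hint_f hint_g] at hmono
  linarith [integral_abs_le_sqrt hg]

theorem integral_norm_sq_le_of_le_add_abs (hfm : AEStronglyMeasurable f (ballMeasure d))
    (hf : ∀ᵐ x ∂(ballMeasure d), 0 ≤ f x ∧ f x ≤ 1) (hg : MemLp g 2 (ballMeasure d))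
    {w : Space d → ℂ} (hw : MemLp w 2 (ballMeasure d))
    (hle : ∀ᵐ x ∂(ballMeasure d), ‖w x‖ ≤ (1 - f x) + |g x|) :
    ∫ x, ‖w x‖ ^ 2 ∂(ballMeasure d) ≤ 2 * (∫ x, (1 - f x) ∂(ballMeasure d))
      + 2 * ∫ x, g x ^ 2 ∂(ballMeasure d) := by
  have hint_f := (integrable_one_sub hfm hf).const_mul 2
  have hint_g := hg.integrable_sq.const_mul 2
  rw [← integral_const_mul, ← integral_const_mul, ← integral_add hint_f hint_g]
  refine integral_mono_ae hw.norm.integrable_sq (hint_f.fun_add hint_g) ?_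
  filter_upwards [hf, hle] with x hx hxle
  exact sq_le_of_le_add_abs (norm_nonneg _) (by linarith [hx.2]) (by linarith [hx.1]) hxle

theorem memLp_I_mul_truncation (hgm : AEStronglyMeasurable g (ballMeasure d)) (η : ℝ) :
    MemLp (fun x => Complex.I * (truncation g η x : ℂ)) 2 (ballMeasure d) :=
  hgm.memLp_truncation.ofReal.const_mul _

theorem memLp_perturb_sub (hfm : AEStronglyMeasurable f (ballMeasure d))
    (hf : ∀ᵐ x ∂(ballMeasure d), 0 ≤ f x ∧ f x ≤ 1)
    (hgm : AEStronglyMeasurable g (ballMeasure d)) (η : ℝ) :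
    MemLp (fun x => perturb (f x) (g x) - Complex.I * (truncation g η x : ℂ)) 2 (ballMeasure d) :=
  (memLp_perturb hfm hf hgm 2).sub (memLp_I_mul_truncation hgm η)

theorem integral_norm_perturb_sub_le (hfm : AEStronglyMeasurable f (ballMeasure d))
    (hf : ∀ᵐ x ∂(ballMeasure d), 0 ≤ f x ∧ f x ≤ 1) (hg : MemLp g 2 (ballMeasure d))
    {η : ℝ} (hη : 0 < η) (hη1 : η ≤ 1) :
    ∫ x, ‖perturb (f x) (g x) - Complex.I * (truncation g η x : ℂ)‖ ∂(ballMeasure d)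
      ≤ (∫ x, (1 - f x) ∂(ballMeasure d)) + (∫ x, g x ^ 2 ∂(ballMeasure d)) / η := by
  have hint_f := integrable_one_sub hfm hf
  have hint_g := hg.integrable_sq.div_const η
  rw [← integral_div, ← integral_add hint_f hint_g]
  exact integral_mono_ae ((memLp_perturb_sub hfm hf hg.1 η).integrable one_le_two).norm
    (hint_f.fun_add hint_g) (hf.mono fun x hx => norm_perturb_sub_truncation_le_sq hx.2 hη hη1)

theorem secondOrder_perturb_le {M S q η : ℝ} (hM : 1 ≤ M) (hvol : ballVol d ≤ M) (hq : 3 ≤ q)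
    (hqS : q ≤ S) (hfm : AEStronglyMeasurable f (ballMeasure d))
    (hf : ∀ᵐ x ∂(ballMeasure d), 0 ≤ f x ∧ f x ≤ 1) (hg : MemLp g 2 (ballMeasure d))
    (hη : 0 < η) (hη1 : η ≤ 1) :
    secondOrder q (fun x => perturb (f x) (g x))
      ≤ secondOrder q (fun x => Complex.I * (truncation g η x : ℂ))
        + 2 * S * (M ^ S * √(ballVol d))
          * (((∫ x, (1 - f x) ∂(ballMeasure d)) + (∫ x, g x ^ 2 ∂(ballMeasure d)) / η)
            * (3 * √(∫ x, g x ^ 2 ∂(ballMeasure d)) + 2 * √(∫ x, (1 - f x) ∂(ballMeasure d)))) := by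
  have hmem := memLp_perturb_sub hfm hf hg.1 η
  have hadd := secondOrder_add_le hM hvol hq hqS (memLp_I_mul_truncation hg.1 η) hmem
  simp only [add_sub_cancel] at hadd
  have hL1 := integral_norm_perturb_sub_le hfm hf hg hη hη1
  have hL2 := Real.sqrt_le_sqrt (integral_norm_sq_le_of_le_add_abs hfm hf hg hmem
    (hf.mono fun x hx => norm_perturb_sub_truncation_le_abs hx.2 hη1))
  have htrunc := Real.sqrt_le_sqrt (integral_truncation_sq_le hg η)
  have hnorm (x : Space d) : ‖Complex.I * (truncation g η x : ℂ)‖ ^ 2 = truncation g η x ^ 2 := by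
    simp
  simp only [hnorm] at hadd
  have ha := integral_one_sub_nonneg hf
  have hX : 0 ≤ ∫ x, g x ^ 2 ∂(ballMeasure d) := integral_nonneg fun _ => sq_nonneg _
  have hsum := sqrt_two_mul_add_le ha hX
  have hS : 0 ≤ S := by linarith
  exact hadd.trans (add_le_add_right (mul_le_mul_of_nonneg_left
    (mul_le_mul hL1 (by linarith) (by positivity) (by positivity)) (by positivity)) _)

theorem integral_kernel_mul_perturb_le {q κ K η : ℝ} (hκ : 0 ≤ κ)
    (hlow : ∀ x ∈ unitBall d, κ ≤ kernel d q x) (hup : ∀ x, kernel d q x ≤ K)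
    (hfm : AEStronglyMeasurable f (ballMeasure d))
    (hf : ∀ᵐ x ∂(ballMeasure d), 0 ≤ f x ∧ f x ≤ 1) (hg : MemLp g 2 (ballMeasure d))
    (hgb : ∀ᵐ x ∂(ballMeasure d), |g x| ≤ 5 * Real.pi / 4) (hη1 : η ≤ 1) :
    ∫ x, kernel d q x * (perturb (f x) (g x)).re ∂(ballMeasure d)
      ≤ -(1 / 2) * (∫ x, kernel d q x * truncation g η x ^ 2 ∂(ballMeasure d))
        + K * η ^ 2 * (∫ x, g x ^ 2 ∂(ballMeasure d))
        - κ / (4 * Real.pi ^ 2) * (∫ x, (g x - truncation g η x) ^ 2 ∂(ballMeasure d))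
        - κ / (4 * Real.pi ^ 2) * ∫ x, (1 - f x) ∂(ballMeasure d) := by
  have htrunc : MemLp (truncation g η) 2 (ballMeasure d) := hg.1.memLp_truncation
  have hmain := (integrable_kernel_mul q htrunc.integrable_sq).const_mul (-(1 / 2))
  have herror := hg.integrable_sq.const_mul (K * η ^ 2)
  have htail := (hg.sub htrunc).integrable_sq.const_mul (κ / (4 * Real.pi ^ 2))
  have hdeficit := (integrable_one_sub hfm hf).const_mul (κ / (4 * Real.pi ^ 2))
  have hbound := integral_mono_ae (integrable_kernel_mul q
    ((memLp_perturb hfm hf hg.1 2).integrable one_le_two).re)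
    (((hmain.add herror).sub htail).sub hdeficit) (by
      filter_upwards [hf, hgb, ae_restrict_mem measurableSet_unitBall] with x hx hxg hxB
      exact mul_re_perturb_le hκ (hlow x hxB) (hup x) hx.1 hx.2 hxg hη1)
  rw [integral_sub' ((hmain.add herror).sub htail) hdeficit,
    integral_sub' (hmain.add herror) htail, integral_add' hmain herror] at hbound
  simp only [integral_const_mul] at hbound
  exact hbound

end Estimates

section Conclusion

variable {f g : Space d → ℝ}

theorem integral_norm_perturb_mul_integral_sq_le (hfm : AEStronglyMeasurable f (ballMeasure d))
    (hf : ∀ᵐ x ∂(ballMeasure d), 0 ≤ f x ∧ f x ≤ 1) (hg : MemLp g 2 (ballMeasure d)) :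
    (∫ x, ‖perturb (f x) (g x)‖ ∂(ballMeasure d))
        * ∫ x, ‖perturb (f x) (g x)‖ ^ 2 ∂(ballMeasure d)
      ≤ 2 * (1 + √(ballVol d))
        * (((∫ x, (1 - f x) ∂(ballMeasure d)) + √(∫ x, g x ^ 2 ∂(ballMeasure d)))
          * ((∫ x, (1 - f x) ∂(ballMeasure d)) + ∫ x, g x ^ 2 ∂(ballMeasure d))) := by
  have hL1 := integral_norm_perturb_le hfm hf hg
  have hL2 := integral_norm_sq_le_of_le_add_abs hfm hf hg (memLp_perturb hfm hf hg.1 2)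
    (hf.mono fun x hx => norm_perturb_le hx.2 _)
  have ha := integral_one_sub_nonneg hf
  have hsq : 0 ≤ ∫ x, ‖perturb (f x) (g x)‖ ^ 2 ∂(ballMeasure d) :=
    integral_nonneg fun _ => sq_nonneg _
  set a := ∫ x, (1 - f x) ∂(ballMeasure d)
  set X := ∫ x, g x ^ 2 ∂(ballMeasure d)
  have hfactor : a + √(ballVol d) * √X ≤ (1 + √(ballVol d)) * (a + √X) := by
    linarith [mul_nonneg (Real.sqrt_nonneg (ballVol d)) ha, Real.sqrt_nonneg X]
  refine (mul_le_mul (hL1.trans hfactor) hL2 hsq (by positivity)).trans_eq ?_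
  ring

theorem exists_integral_kernel_add_secondOrder_le {M S : ℝ} (r : ℕ) (hM : 1 ≤ M)
    (hvol : ballVol d ≤ M) (hS : 2 * r + 5 ≤ S) :
    ∃ ρ : ℝ, 0 < ρ ∧ ρ ≤ 1 / 4 ∧ ∃ w : ℝ, 0 < w ∧ ∃ C : ℝ, 0 ≤ C ∧
    ∀ (q η : ℝ) (f g : Space d → ℝ), |q - (2 * r + 4)| < ρ → 0 < η → η ≤ 1 →
      AEStronglyMeasurable f (ballMeasure d) →
      (∀ᵐ x ∂(ballMeasure d), 0 ≤ f x ∧ f x ≤ 1) → MemLp g 2 (ballMeasure d) →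
      (∀ᵐ x ∂(ballMeasure d), |g x| ≤ 5 * Real.pi / 4) →
      (∫ x, kernel d q x * (perturb (f x) (g x)).re ∂(ballMeasure d))
          + secondOrder q (fun x => perturb (f x) (g x)) / 2
        ≤ -(quadForm (2 * r) (truncation g η) / 2
            + w * ∫ x, (g x - truncation g η x) ^ 2 ∂(ballMeasure d))
          - w * (∫ x, (1 - f x) ∂(ballMeasure d))
          + C * (|q - (2 * r + 4)| * (∫ x, g x ^ 2 ∂(ballMeasure d))
            + (η ^ 2 * (∫ x, g x ^ 2 ∂(ballMeasure d))
              + ((∫ x, (1 - f x) ∂(ballMeasure d)) + (∫ x, g x ^ 2 ∂(ballMeasure d)) / η)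
                * (3 * √(∫ x, g x ^ 2 ∂(ballMeasure d))
                  + 2 * √(∫ x, (1 - f x) ∂(ballMeasure d))))) := by
  obtain ⟨ρ, hρ, hρ4, κ, hκ, K, hK, hker⟩ := exists_kernel_bounds (d := d) (r := r) hM hvol hS
  obtain ⟨C₁, hC₁, hphase⟩ := exists_secondOrder_I_mul_le (d := d) (r := r) hM hvol (S := S)
    (by linarith)
  set C₂ := 2 * S * (M ^ S * √(ballVol d))
  have hS0 : 0 ≤ S := by linarith [Nat.cast_nonneg (α := ℝ) r]
  refine ⟨ρ, hρ, hρ4, κ / (4 * Real.pi ^ 2), by positivity, K + C₁ + C₂, by positivity,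
    fun q η f g hq hη hη1 hfm hf hg hgb => ?_⟩
  obtain ⟨hlow, hup⟩ := hker q hq
  have hqr := abs_lt.1 (hq.trans_le hρ4)
  have hfirst := integral_kernel_mul_perturb_le hκ.le hlow hup hfm hf hg hgb hη1
  have hsecond := secondOrder_perturb_le hM hvol (q := q) (S := S) (by linarith) (by linarith)
    hfm hf hg hη hη1
  have htrunc := hphase q (truncation g η) (by linarith) (by linarith) hg.1.memLp_truncation
  have hmono := mul_le_mul_of_nonneg_left (integral_truncation_sq_le hg η)
    (mul_nonneg hC₁ (abs_nonneg (q - (2 * r + 4))))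
  have ha := integral_one_sub_nonneg hf
  have hX : 0 ≤ ∫ x, g x ^ 2 ∂(ballMeasure d) := integral_nonneg fun _ => sq_nonneg _
  set a := ∫ x, (1 - f x) ∂(ballMeasure d)
  set X := ∫ x, g x ^ 2 ∂(ballMeasure d)
  set Z := (a + X / η) * (3 * √X + 2 * √a)
  have hKt : 0 ≤ (K + C₂) * (|q - (2 * r + 4)| * X) := by positivity
  have hKη : 0 ≤ (C₁ + C₂) * (η ^ 2 * X) := by positivity
  have hKZ : 0 ≤ (K + C₁) * Z := by positivity
  have hCt : 0 ≤ C₁ * (|q - (2 * r + 4)| * X) := by positivity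
  have hCZ : 0 ≤ C₂ * Z := by positivity
  linarith

theorem mul_le_mul_sub_of_le_sub {q S t e l : ℝ} (hq : 1 ≤ q) (hqS : q ≤ S) (he : 0 ≤ e)
    (hl : 0 ≤ l) (ht : t ≤ e - l) : q * t ≤ S * e - l := by
  calc q * t ≤ q * (e - l) := by gcongr
    _ = q * e - q * l := mul_sub _ _ _
    _ ≤ S * e - l := sub_le_sub (by gcongr) (le_mul_of_one_le_left hl hq)

theorem exists_integral_norm_rpow_le_of_truncation (r : ℕ) :
    ∃ ρ : ℝ, 0 < ρ ∧ ρ ≤ 1 / 4 ∧ ∃ c : ℝ, 0 < c ∧ ∃ k : ℝ, 0 < k ∧ ∃ A : ℝ, 0 ≤ A ∧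
    ∃ L : ℝ, ∀ (q η : ℝ) (f g : Space d → ℝ) (hg : MemLp g 2 (ballMeasure d)),
      |q - (2 * r + 4)| < ρ → 0 < η → η ≤ 1 →
      AEStronglyMeasurable f (ballMeasure d) →
      (∀ᵐ x ∂(ballMeasure d), 0 ≤ f x ∧ f x ≤ 1) →
      (∀ᵐ x ∂(ballMeasure d), |g x| ≤ 5 * Real.pi / 4) →
      ∫ ξ, ‖ballHat d ξ + hat (fun x => perturb (f x) (g x)) ξ‖ ^ q
        ≤ (∫ ξ, ‖ballHat d ξ‖ ^ q) - c * affineDefect ((2 * r + 4 : ℕ) : ℝ) hg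
        + L * |q - (2 * r + 4)| * (∫ x, g x ^ 2 ∂(ballMeasure d))
        + (A * (η ^ 2 * (∫ x, g x ^ 2 ∂(ballMeasure d))
          + ((∫ x, (1 - f x) ∂(ballMeasure d)) + (∫ x, g x ^ 2 ∂(ballMeasure d)) / η)
            * (3 * √(∫ x, g x ^ 2 ∂(ballMeasure d)) + 2 * √(∫ x, (1 - f x) ∂(ballMeasure d)))
          + ((∫ x, (1 - f x) ∂(ballMeasure d)) + √(∫ x, g x ^ 2 ∂(ballMeasure d)))
            * ((∫ x, (1 - f x) ∂(ballMeasure d)) + ∫ x, g x ^ 2 ∂(ballMeasure d)))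
          - k * ∫ x, (1 - f x) ∂(ballMeasure d)) := by
  have hV := ballVol_nonneg (d := d)
  have hM : 1 ≤ 2 * ballVol d + 1 := by linarith
  have hvol : ballVol d ≤ 2 * ballVol d + 1 := by linarith
  obtain ⟨ρ, hρ, hρ4, w, hw, C, hC, hvar⟩ :=
    exists_integral_kernel_add_secondOrder_le (d := d) r hM hvol le_rfl
  obtain ⟨B, hB, hexp⟩ := exists_integral_norm_add_rpow_le (d := d) hM hvol (S := 2 * r + 5)
    (by linarith)
  obtain ⟨c, hc, hgap⟩ := exists_affineDefect_le (d := d) r hw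
  set S : ℝ := 2 * r + 5
  refine ⟨ρ, hρ, hρ4, c, hc, w, hw, S * C + B * (2 * (1 + √(ballVol d))), by positivity, S * C,
    fun q η f g hg hq hη hη1 hfm hf hgb => ?_⟩
  have hqr := abs_lt.1 (hq.trans_le hρ4)
  have hexpansion := hexp q _ (by linarith) (by linarith) (memLp_perturb hfm hf hg.1 2)
    ((integral_norm_perturb_le_ballVol hfm hf hg.1).trans (by linarith))
  have hcubic := mul_le_mul_of_nonneg_left (integral_norm_perturb_mul_integral_sq_le hfm hf hg) hB
  have hvariation := hvar q η f g hq hη hη1 hfm hf hg hgb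
  have hdefect := hgap g (truncation g η) hg hg.1.memLp_truncation
  have ha := integral_one_sub_nonneg hf
  have hX : 0 ≤ ∫ x, g x ^ 2 ∂(ballMeasure d) := integral_nonneg fun _ => sq_nonneg _
  set a := ∫ x, (1 - f x) ∂(ballMeasure d)
  set X := ∫ x, g x ^ 2 ∂(ballMeasure d)
  set E := η ^ 2 * X + (a + X / η) * (3 * √X + 2 * √a)
  set P := (a + √X) * (a + X)
  have hEP : 0 ≤ S * C * P ∧ 0 ≤ B * (2 * (1 + √(ballVol d))) * E := by
    constructor <;> positivity
  have hloss : 0 ≤ c * affineDefect ((2 * r + 4 : ℕ) : ℝ) hg + w * a :=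
    add_nonneg (mul_nonneg hc.le (sq_nonneg _)) (mul_nonneg hw.le ha)
  have herror : 0 ≤ C * (|q - (2 * r + 4)| * X + E) := by positivity
  have hscaled := mul_le_mul_sub_of_le_sub (q := q) (S := S) (by linarith) (by linarith) herror
    hloss (hvariation.trans (by linarith))
  linarith

theorem exists_truncation_level {G : ℝ} (hG : 0 ≤ G) (hG1 : G ≤ 1) :
    ∃ η : ℝ, 0 < η ∧ η ≤ 1 ∧ η ^ 2 * G ^ 2 ≤ G ^ 3 ∧ G ^ 2 / η ≤ G * √G := by
  rcases hG.eq_or_lt with rfl | hpos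
  · exact ⟨1, one_pos, le_rfl, by norm_num, by norm_num⟩
  · refine ⟨√G, Real.sqrt_pos.2 hpos, Real.sqrt_le_one.2 hG1, ?_, ?_⟩
    · rw [Real.sq_sqrt hG, ← pow_succ']
    · rw [div_le_iff₀ (Real.sqrt_pos.2 hpos), mul_assoc, Real.mul_self_sqrt hG, pow_two]

theorem remainder_sub_le {A k a G : ℝ} (hA : 0 ≤ A) (hk : 0 < k) (ha : 0 ≤ a)
    (hak : 4 * A * √a ≤ k) (hG : 0 ≤ G) (hG1 : G ≤ 1) :
    A * (G ^ 3 + (a + G * √G) * (3 * G + 2 * √a) + (a + G) * (a + G ^ 2)) - k * a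
      ≤ (5 * A + 2 * A ^ 2 / k) * (a * G + a ^ 2 + G ^ 2 * √G) := by
  have hcube : G ^ 3 ≤ G ^ 2 * √G := by
    rw [pow_succ]
    gcongr
    exact Real.le_sqrt_of_sq_le (pow_le_of_le_one hG hG1 two_ne_zero)
  have haG : a * G ^ 2 ≤ a * G :=
    mul_le_mul_of_nonneg_left (pow_le_of_le_one hG hG1 two_ne_zero) ha
  have habsorb : 2 * A * √a * a ≤ k / 2 * a := mul_le_mul_of_nonneg_right (by linarith) ha
  have hyoung : 2 * A * (√a * (G * √G)) ≤ k / 2 * a + 2 * A ^ 2 / k * G ^ 3 := by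
    have hsquare : k / 2 * a + 2 * A ^ 2 / k * G ^ 3 - 2 * A * (√a * (G * √G))
        = k / 2 * (√a - 2 * A / k * (G * √G)) ^ 2 := by
      rw [sub_sq, mul_pow, mul_pow, Real.sq_sqrt ha, Real.sq_sqrt hG]
      field_simp
      ring
    exact sub_nonneg.1 (hsquare ▸ by positivity)
  have hB : 0 ≤ 2 * A ^ 2 / k := by positivity
  have hrest : 0 ≤ 2 * A ^ 2 / k * (a * G + a ^ 2) + A * (4 * a ^ 2) := by positivity
  linarith [mul_le_mul_of_nonneg_left hcube hA, mul_le_mul_of_nonneg_left hcube hB,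
    mul_le_mul_of_nonneg_left haG hA]

theorem lpNorm_sub_one_eq_integral (hfm : AEStronglyMeasurable f (ballMeasure d))
    (hf : ∀ᵐ x ∂(ballMeasure d), 0 ≤ f x ∧ f x ≤ 1) :
    lpNorm (fun x => f x - 1) 1 (ballMeasure d) = ∫ x, (1 - f x) ∂(ballMeasure d) := by
  have hm : AEStronglyMeasurable (fun x => f x - 1) (ballMeasure d) :=
    hfm.sub aestronglyMeasurable_const
  rw [lpNorm_one_eq_integral_norm hm]
  refine integral_congr_ae (hf.mono fun x hx => ?_)
  dsimp only
  rw [Real.norm_eq_abs, abs_of_nonpos (by linarith [hx.2]), neg_sub]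

theorem lpNorm_two_sq_eq_integral (hgm : AEStronglyMeasurable g (ballMeasure d)) :
    lpNorm g 2 (ballMeasure d) ^ 2 = ∫ x, g x ^ 2 ∂(ballMeasure d) := by
  rw [lpNorm_eq_integral_norm_rpow_toReal two_ne_zero ENNReal.ofNat_ne_top hgm,
    ← Real.rpow_natCast, ← Real.rpow_mul (integral_nonneg fun _ => by positivity)]
  simp

theorem fourier_modulated (hfm : AEStronglyMeasurable f (ballMeasure d))
    (hf : ∀ᵐ x ∂(ballMeasure d), 0 ≤ f x ∧ f x ≤ 1)
    (hgm : AEStronglyMeasurable g (ballMeasure d)) :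
    𝓕 (modulated d f g) = fun ξ => ballHat d ξ + hat (fun x => perturb (f x) (g x)) ξ := by
  funext ξ
  have hone : hat (fun _ : Space d => (1 : ℂ)) = ballHat d := by simp [← rhat_one, rhat]
  rw [← hone, ← hat_add (integrable_const 1) ((memLp_perturb hfm hf hgm 2).integrable one_le_two)]
  simp only [perturb, add_sub_cancel]
  rfl

theorem memLp_fourier_modulated (hfm : AEStronglyMeasurable f (ballMeasure d))
    (hf : ∀ᵐ x ∂(ballMeasure d), 0 ≤ f x ∧ f x ≤ 1)
    (hgm : AEStronglyMeasurable g (ballMeasure d)) {q : ℝ} (hq : 2 ≤ q) :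
    MemLp (𝓕 (modulated d f g)) (ENNReal.ofReal q) := by
  rw [fourier_modulated hfm hf hgm]
  exact memLp_of_bound (memLp_ballHat.add (memLp_hat (memLp_perturb hfm hf hgm 2)))
    (fun ξ => (norm_add_le _ _).trans (add_le_add (norm_ballHat_le ξ) (norm_hat_le _ ξ))) hq

theorem exists_integral_norm_fourier_modulated_rpow_le (r : ℕ) :
    ∃ δ : ℝ, 0 < δ ∧ ∃ ρ : ℝ, 0 < ρ ∧ ∃ c : ℝ, 0 < c ∧ ∃ C : ℝ, 0 < C ∧ ∃ L : ℝ,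
    ∀ (q : ℝ) (f g : Space d → ℝ) (hg : MemLp g 2 (ballMeasure d)),
      |q - ((2 * r + 4 : ℕ) : ℝ)| < ρ → AEStronglyMeasurable f (ballMeasure d) →
      (∀ᵐ x ∂(ballMeasure d), 0 ≤ f x ∧ f x ≤ 1) →
      (∀ᵐ x ∂(ballMeasure d), |g x| ≤ 5 * Real.pi / 4) →
      lpNorm (fun x => f x - 1) 1 (ballMeasure d) ≤ δ → lpNorm g 2 (ballMeasure d) ≤ δ →
      ∫ ξ, ‖𝓕 (modulated d f g) ξ‖ ^ q
        ≤ (∫ ξ, ‖𝓕 (ballIndicator d) ξ‖ ^ q) - c * affineDefect ((2 * r + 4 : ℕ) : ℝ) hg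
        + L * |q - ((2 * r + 4 : ℕ) : ℝ)| * lpNorm g 2 (ballMeasure d) ^ 2
        + C * (lpNorm (fun x => f x - 1) 1 (ballMeasure d) * lpNorm g 2 (ballMeasure d))
        + C * (lpNorm (fun x => f x - 1) 1 (ballMeasure d) ^ 2
            + lpNorm g 2 (ballMeasure d) ^ (5 / 2 : ℝ)) := by
  obtain ⟨ρ, hρ, -, c, hc, k, hk, A, hA, L, hexp⟩ :=
    exists_integral_norm_rpow_le_of_truncation (d := d) r
  refine ⟨min 1 ((k / (4 * (A + 1))) ^ 2), by positivity, ρ, hρ, c, hc, 5 * A + 2 * A ^ 2 / k + 1,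
    by positivity, L, fun q f g hg hq hfm hf hgb hfδ hgδ => ?_⟩
  have hcast : ((2 * r + 4 : ℕ) : ℝ) = 2 * r + 4 := by push_cast; rfl
  have ha : 0 ≤ lpNorm (fun x => f x - 1) 1 (ballMeasure d) := lpNorm_nonneg
  have hG : 0 ≤ lpNorm g 2 (ballMeasure d) := lpNorm_nonneg
  have hG1 : lpNorm g 2 (ballMeasure d) ≤ 1 := hgδ.trans (min_le_left _ _)
  obtain ⟨η, hη, hη1, hηsq, hηdiv⟩ := exists_truncation_level hG hG1
  have hmain := hexp q η f g hg (by rwa [hcast] at hq) hη hη1 hfm hf hgb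
  rw [← lpNorm_two_sq_eq_integral hg.1, ← lpNorm_sub_one_eq_integral hfm hf, Real.sqrt_sq hG,
    ← hcast] at hmain
  rw [fourier_modulated hfm hf hg.1]
  set a := lpNorm (fun x => f x - 1) 1 (ballMeasure d)
  set G := lpNorm g 2 (ballMeasure d)
  have hak : 4 * A * √a ≤ k := by
    have hsqrt : √a ≤ k / (4 * (A + 1)) :=
      Real.sqrt_le_iff.2 ⟨by positivity, hfδ.trans (min_le_right _ _)⟩
    rw [le_div_iff₀ (by positivity)] at hsqrt
    linarith [Real.sqrt_nonneg a]
  have hremainder := remainder_sub_le hA hk ha hak hG hG1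
  have hlevel : A * (η ^ 2 * G ^ 2 + (a + G ^ 2 / η) * (3 * G + 2 * √a) + (a + G) * (a + G ^ 2))
      ≤ A * (G ^ 3 + (a + G * √G) * (3 * G + 2 * √a) + (a + G) * (a + G ^ 2)) := by
    gcongr
  have hpow : G ^ (5 / 2 : ℝ) = G ^ 2 * √G := by
    rw [Real.sqrt_eq_rpow, ← Real.rpow_natCast, ← Real.rpow_add' hG (by norm_num)]
    norm_num
  have hpos : 0 ≤ a * G + a ^ 2 + G ^ 2 * √G := by positivity
  rw [hpow]
  change _ ≤ (∫ ξ, ‖ballHat d ξ‖ ^ q) - _ + _ + _ + _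
  linarith

end Conclusion

end BallFourier

end

theorem mainTheorem3 (d : ℕ) (hd : 1 ≤ d) (qbar : ℕ) (hqbar : 4 ≤ qbar) (heven : Even qbar) :
    ∃ δ₀ : ℝ, 0 < δ₀ ∧ ∃ ρ : ℝ, 0 < ρ ∧ ∃ c : ℝ, 0 < c ∧ ∃ C : ℝ, 0 < C ∧
    ∃ ω : ℝ → ℝ, Filter.Tendsto ω (𝓝 0) (𝓝 0) ∧
    ∀ (q : ℝ) (f g : EuclideanSpace ℝ (Fin d) → ℝ)
      (hg : MemLp g 2 (BallFourier.ballMeasure d)),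
      3 < q → |q - qbar| < ρ →
      AEStronglyMeasurable f (BallFourier.ballMeasure d) →
      (∀ᵐ x ∂(BallFourier.ballMeasure d), 0 ≤ f x ∧ f x ≤ 1) →
      (∀ᵐ x ∂(BallFourier.ballMeasure d), |g x| ≤ 5 * Real.pi / 4) →
      lpNorm (fun x => f x - 1) 1 (BallFourier.ballMeasure d) ≤ δ₀ →
      lpNorm g 2 (BallFourier.ballMeasure d) ≤ δ₀ →
      MemLp (𝓕 (BallFourier.modulated d f g)) (ENNReal.ofReal q) volume ∧
      MemLp (𝓕 (BallFourier.ballIndicator d)) (ENNReal.ofReal q) volume ∧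
      lpNorm (𝓕 (BallFourier.modulated d f g)) (ENNReal.ofReal q) volume ^ q ≤
        lpNorm (𝓕 (BallFourier.ballIndicator d)) (ENNReal.ofReal q) volume ^ q
        - c * ‖BallFourier.weighted d qbar g hg
            - (BallFourier.affineSubspace d qbar).starProjection
                (BallFourier.weighted d qbar g hg)‖ ^ 2
        + ω (q - qbar) * lpNorm g 2 (BallFourier.ballMeasure d) ^ 2
        + C * (lpNorm (fun x => f x - 1) 1 (BallFourier.ballMeasure d)
            * lpNorm g 2 (BallFourier.ballMeasure d))
        + C * (lpNorm (fun x => f x - 1) 1 (BallFourier.ballMeasure d) ^ 2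
            + lpNorm g 2 (BallFourier.ballMeasure d) ^ (5 / 2 : ℝ)) := by
  obtain ⟨r, rfl⟩ : ∃ r, qbar = 2 * r + 4 := by
    obtain ⟨m, hm⟩ := heven
    exact ⟨m - 2, by omega⟩
  obtain ⟨δ, hδ, ρ, hρ, c, hc, C, hC, L, hexp⟩ :=
    BallFourier.exists_integral_norm_fourier_modulated_rpow_le (d := d) r
  refine ⟨δ, hδ, ρ, hρ, c, hc, C, hC, fun t => L * |t|, ?_,
    fun q f g hg hq3 hq hfm hf hgb hfδ hgδ => ?_⟩
  · have hcont : Continuous fun t : ℝ => L * |t| := by fun_prop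
    simpa using hcont.tendsto 0
  have hmod := BallFourier.memLp_fourier_modulated hfm hf hg.1 (q := q) (by linarith)
  have hball : MemLp (𝓕 (BallFourier.ballIndicator d)) (ENNReal.ofReal q) volume :=
    BallFourier.memLp_of_bound BallFourier.memLp_ballHat BallFourier.norm_ballHat_le (by linarith)
  refine ⟨hmod, hball, ?_⟩
  rw [BallFourier.lpNorm_rpow_eq_integral hmod.1 (by linarith),
    BallFourier.lpNorm_rpow_eq_integral hball.1 (by linarith)]
  exact hexp q f g hg hq hfm hf hgb hfδ hgδ
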